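/- Let $K$ be an algebraically closed field, $d\ge 0$, $S=\operatorname{Spec}K[[u_1,\dots,u_{d+1}]]$ and $$T_S=\operatorname{Spec}\frac{K[[u_1,\dots,u_{d+1},x,y]]}{(xy-u_1\cdots u_{d+1})},$$ with its natural map $T_S\to S$. For $A\subset\{1,\dots,d+1\}$ put $u_A=\prod_{j\in A}u_j$. Let $\mathcal A=(A_1,\dots,A_k)$ be a collection of proper nonempty subsets of $\{1,\dots,d+1\}$ that is smooth, i.e. for all distinct $i,j$ some $A_\ell$ contains exactly one of $i,j$. Let $\phi\colon\widetilde T_S^{\mathcal A}\to T_S$ be the composite of the successive blowups, for $\ell=1,\dots,k$, along the strict transform of the Weil divisor $V(x,u_{A_\ell})$ under the composite of the preceding blowups. Here the strict transform of a closed subset $Z$ under a birational morphism $f$ is the closure of the preimage of the part of $Z$ over which $f$ is an isomorphism. Write $m<_{\mathcal A}n$ if there is $\ell$ with $m\in A_\ell$, $n\notin A_\ell$, such that for every $i<\ell$ the set $A_i$ contains both or neither of $m,n$. Let $\eta$ be a permutation of $\{1,\dots,d+1\}$ with $\eta(1)<_{\mathcal A}\eta(2)<_{\mathcal A}\dots<_{\mathcal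 A}\eta(d+1)$. Then the irreducible components of the fibre of $\widetilde T_S^{\mathcal A}\to S$ over the closed point can be numbered $E_0,E_1,\dots,E_{d+1}$, without repetition, so that $E_0$ and $E_{d+1}$ are the strict transforms of the branches $y=0$ and $x=0$ of the fibre of $T_S\to S$ over the closed point, $E_{i-1}\cap E_i$ is a single point $N_i$ for $1\le i\le d+1$, and $E_i\cap E_j=\emptyset$ if $|i-j|>1$. For every such numbering and every $1\le i\le d+1$: 1. $N_i\in\Sigma_{\eta(i)}$, where $\Sigma_j$ denotes the connected component of the singular locus of $\widetilde T_S^{\mathcal A}\to S$ that dominates $V(u_j)$, i.e. whose image contains the generic point of $V(u_j)$. The singular locus is the set of points at which the map is not regular (flat with geometrically regular fibre). 2. $E_i,\dots,E_{d+1}$ are contained in the strict transform of $V(x,u_{\eta(i)})$ via $\phi$. 3. The intersection of the strict transforms via $\phi$ of $$V(x,u_{\eta(1)}),\dots,V(x,u_{\eta(i)}),\ V(y,u_{\eta(i)}),\dots,V(y,u_{\eta(d+1)})$$ is exactly $\{N_i\}$. -/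

import Mathlib

open CategoryTheory AlgebraicGeometry

universe u

noncomputable section

namespace NodalBlowup

/-! ### Blowups and strict transforms -/

/-- An ideal sheaf whose closed subscheme is an effective Cartier divisor: locally it is generated
by one nonzerodivisor. -/
def IsEffectiveCartier {X : Scheme.{u}} (I : X.IdealSheafData) : Prop :=
  ∀ p : X, ∃ U : X.affineOpens, p ∈ U.1 ∧
    ∃ a ∈ nonZeroDivisors Γ(X, U.1), I.ideal U = Ideal.span {a}

/-- `b : X' ⟶ X` is the blowup of `X` along the closed subscheme with ideal sheaf `I`: the inverse
image of the subscheme is an effective Cartier divisor, and `b` is universal with this property. -/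
def IsBlowup {X' X : Scheme.{u}} (b : X' ⟶ X) (I : X.IdealSheafData) : Prop :=
  IsEffectiveCartier (I.comap b) ∧
    ∀ ⦃Y : Scheme.{u}⦄ (g : Y ⟶ X), IsEffectiveCartier (I.comap g) → ∃! h : Y ⟶ X', h ≫ b = g

/-- The largest open subset of the target over which `f` is an isomorphism. -/
def isoLocus {X Y : Scheme.{u}} (f : X ⟶ Y) : Y.Opens :=
  sSup {U : Y.Opens | IsIso (f ∣_ U)}

/-- The strict transform of a closed subset `Z` under a birational morphism `f`: the closure of the
part of `Z` over which `f` is an isomorphism. -/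
def strictTransform {X Y : Scheme.{u}} (f : X ⟶ Y) (Z : Set Y) : Set X :=
  closure (f ⁻¹' (Z ∩ isoLocus f))

/-! ### The singular locus of a morphism -/

/-- For a local homomorphism of Noetherian local rings `A → B`: it is flat, and its closed fibre is
geometrically regular over the residue field `k` of `A`. An `A`-algebra `L` which is a field and
finite over `A` is the same as a finite field extension of `k`, and then
`L ⊗[A] B = L ⊗[k] (B ⊗[A] k)`. -/
def IsRegularAlgebra (A B : Type u) [CommRing A] [CommRing B] [Algebra A B] : Prop :=
  Module.Flat A B ∧ ∀ (L : Type u) [Field L] [Algebra A L] [Module.Finite A L],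
    IsRegularRing (TensorProduct A L B)

/-- The morphism `f` is regular at `p`: it is flat at `p`, and the local ring at `p` of the fibre
through `p` is geometrically regular. For morphisms locally of finite type between locally
Noetherian schemes this is smoothness at `p`. -/
def IsRegularAt {X S : Scheme.{u}} (f : X ⟶ S) (p : X) : Prop :=
  letI := (f.stalkMap p).hom.toAlgebra
  IsRegularAlgebra (S.presheaf.stalk (f p)) (X.presheaf.stalk p)

/-- The singular locus of a morphism. -/
def singularLocus {X S : Scheme.{u}} (f : X ⟶ S) : Set X :=
  {p | ¬ IsRegularAt f p}

/-! ### The schemes `S` and `T_S` -/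

variable (d : ℕ) (K : Type u) [Field K]

/-- `K[[u_1, …, u_{d+1}]]`, with the variables indexed by `0, …, d`. -/
abbrev RingS : Type u := MvPowerSeries (Fin (d + 1)) K

/-- `K[[u_1, …, u_{d+1}, x, y]]`: `Sum.inl j` is the index of a `u`-variable, `Sum.inr 0` that of
`x` and `Sum.inr 1` that of `y`. -/
abbrev RingP : Type u := MvPowerSeries (Fin (d + 1) ⊕ Fin 2) K

/-- `K[[u_1, …, u_{d+1}, x, y]] / (x y - u_1 ⋯ u_{d+1})`. -/
abbrev RingT : Type u :=
  RingP d K ⧸ Ideal.span {(MvPowerSeries.X (Sum.inr 0) * MvPowerSeries.X (Sum.inr 1) -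
    ∏ j : Fin (d + 1), MvPowerSeries.X (Sum.inl j) : RingP d K)}

/-- The element `x`. -/
def xT : RingT d K := Ideal.Quotient.mk _ (MvPowerSeries.X (Sum.inr 0))

/-- The element `y`. -/
def yT : RingT d K := Ideal.Quotient.mk _ (MvPowerSeries.X (Sum.inr 1))

/-- The elements `u_j`. -/
def uT (j : Fin (d + 1)) : RingT d K := Ideal.Quotient.mk _ (MvPowerSeries.X (Sum.inl j))

/-- `S = Spec K[[u_1, …, u_{d+1}]]`. -/
abbrev S : Scheme.{u} := Spec (CommRingCat.of (RingS d K))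

/-- `T_S = Spec K[[u_1, …, u_{d+1}, x, y]] / (x y - u_1 ⋯ u_{d+1})`. -/
abbrev TS : Scheme.{u} := Spec (CommRingCat.of (RingT d K))

/-- The projection `T_S ⟶ S`, given by `u_j ↦ u_j`. -/
def projTS : TS d K ⟶ S d K :=
  Spec.map (CommRingCat.ofHom ((Ideal.Quotient.mk _).comp
    (MvPowerSeries.rename (Sum.inl : Fin (d + 1) → Fin (d + 1) ⊕ Fin 2) :
      RingS d K →ₐ[K] RingP d K).toRingHom))

variable {d}

/-- The closed point `0` of `S`. -/
def closedPointS : S d K := IsLocalRing.closedPoint (RingS d K)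

/-- The generic point `Q_j` of `V(u_j) ⊆ S` is characterised by `closure {Q_j} = V(u_j)`. -/
def IsGenericPointOfDivisor (j : Fin (d + 1)) (q : S d K) : Prop :=
  closure {q} = (PrimeSpectrum.zeroLocus {(MvPowerSeries.X j : RingS d K)} : Set (S d K))

/-- The closed subset `V(x, u_A)` of `T_S`, where `u_A = ∏_{j ∈ A} u_j`. -/
def divX (A : Finset (Fin (d + 1))) : Set (TS d K) :=
  PrimeSpectrum.zeroLocus {xT d K, ∏ j ∈ A, uT d K j}

/-- The closed subset `V(y, u_A)` of `T_S`, where `u_A = ∏_{j ∈ A} u_j`. -/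
def divY (A : Finset (Fin (d + 1))) : Set (TS d K) :=
  PrimeSpectrum.zeroLocus {yT d K, ∏ j ∈ A, uT d K j}

/-- The branch `x = 0` of the fibre of `T_S ⟶ S` over the closed point. -/
def branchX : Set (TS d K) :=
  PrimeSpectrum.zeroLocus (insert (xT d K) (Set.range (uT d K)))

/-- The branch `y = 0` of the fibre of `T_S ⟶ S` over the closed point. -/
def branchY : Set (TS d K) :=
  PrimeSpectrum.zeroLocus (insert (yT d K) (Set.range (uT d K)))

/-! ### Smooth collections -/

/-- A collection of subsets of a finite set is smooth if every two distinct elements are separated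
by one of its members. -/
def IsSmoothCollection {F : Type*} (𝒜 : List (Finset F)) : Prop :=
  ∀ i j : F, i ≠ j → ∃ A ∈ 𝒜, (j ∈ A ∧ i ∉ A) ∨ (i ∈ A ∧ j ∉ A)

/-- The `𝒜`-ordering: `m <_𝒜 n` if some member `A` of the collection contains `m` but not `n`, and
every earlier member contains both or none of `m`, `n`. -/
def CollectionLT {F : Type*} (𝒜 : List (Finset F)) (m n : F) : Prop :=
  ∃ (pre : List (Finset F)) (A : Finset F) (post : List (Finset F)),
    𝒜 = pre ++ A :: post ∧ m ∈ A ∧ n ∉ A ∧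
      ∀ B ∈ pre, (m ∈ B ∧ n ∈ B) ∨ (m ∉ B ∧ n ∉ B)

/-! ### The iterated blowup -/

variable {K}

/-- `φ : X ⟶ T_S` is the composite of the sequence of blowups defined by the collection
`(A_1, …, A_k)`: the `i`-th one is the blowup of the strict transform, via the composite of the
preceding ones, of the (reduced) divisor `V(x, u_{A_i})`. -/
inductive IsIteratedBlowup :
    List (Finset (Fin (d + 1))) → ∀ {X : Scheme.{u}}, (X ⟶ TS d K) → Prop
  | nil : IsIteratedBlowup [] (𝟙 (TS d K))
  | concat {𝒜 : List (Finset (Fin (d + 1)))} {X X' : Scheme.{u}} {φ : X ⟶ TS d K}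
      {A : Finset (Fin (d + 1))} {b : X' ⟶ X} (hφ : IsIteratedBlowup 𝒜 φ)
      (hb : IsBlowup b (Scheme.IdealSheafData.vanishingIdeal
        ⟨strictTransform φ (divX K A), isClosed_closure⟩)) :
      IsIteratedBlowup (𝒜 ++ [A]) (b ≫ φ)

/-- The special fibre of `X ⟶ T_S ⟶ S`, as a closed subset of `X`. -/
def specialFibre {X : Scheme.{u}} (φ : X ⟶ TS d K) : Set X :=
  (φ ≫ projTS d K) ⁻¹' {closedPointS K}

/-- The exceptional chain and its nodes, with their numbering. The irreducible components of the
special fibre are `comp 0`, the branch `y = 0`; then the exceptional curves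
`E_1 = comp 1, …, E_d = comp d`; and last `comp (d + 1)`, the branch `x = 0`. Consecutive components
meet in exactly one point, the others are disjoint. The node `N_{i+1}`, written `node i`, is the
point where `comp i` and `comp (i + 1)` meet; thus `N_1` is the node on the branch `y = 0`,
`N_{d+1}` is the node on the branch `x = 0`, and `N_i`, `N_{i+1}` lie on `E_i`. -/
structure ExceptionalChain {X : Scheme.{u}} (φ : X ⟶ TS d K) where
  comp : Fin (d + 2) → Set X
  node : Fin (d + 1) → X
  comp_injective : Function.Injective comp
  range_comp : Set.range comp = {Z | Maximal (fun Z => IsIrreducible Z ∧ Z ⊆ specialFibre φ) Z}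
  comp_zero : comp 0 = strictTransform φ (branchY K)
  comp_last : comp (Fin.last (d + 1)) = strictTransform φ (branchX K)
  comp_inter : ∀ i : Fin (d + 1), comp i.castSucc ∩ comp i.succ = {node i}
  comp_disjoint : ∀ i j : Fin (d + 2), (i : ℕ) + 1 < j → Disjoint (comp i) (comp j)

/-- The component `Σ_j` of the singular locus of `X ⟶ T_S ⟶ S`: the connected component of the
singular locus which dominates `V(u_j)`, that is, whose image contains the generic point of
`V(u_j)`. -/
def singularComponent {X : Scheme.{u}} (φ : X ⟶ TS d K) (j : Fin (d + 1)) : Set X :=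
  {p | ∃ z ∈ singularLocus (φ ≫ projTS d K),
    IsGenericPointOfDivisor K j ((φ ≫ projTS d K) z) ∧
      p ∈ connectedComponentIn (singularLocus (φ ≫ projTS d K)) z}

end NodalBlowup

end

/-! Locally the iterated blowup has coordinates `v`, `w` with `x = b v`, `y = c w`, `v w = p`, where
`b`, `c`, `p` are the products of the `u_j` over three sets `B`, `D`, `P` that partition the indices
(`Block`, `ChartRing`). On `T_S` itself `P` is everything. Where `y` is invertible all the blowups
are isomorphisms, so the strict transform of `V(x, u_A)` is the closure of the generic points of the
`V(x, u_j)` with `j ∈ A`. In a chart these give `u_j = 0` for `j ∈ B ∩ A` and `v = u_j = 0` for `j ∈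
P ∩ A`. The intersection of the corresponding primes is `u_{B ∩ A} (v, u_{P ∩ A})`, so the next
blowup is that of `(v, u_{P ∩ A})`. Its two standard charts have the same shape: either `P` shrinks
to `P ∩ A` and `P \ A` moves to `D`, or `P` shrinks to `P \ A` and `P ∩ A` moves to `B`. By
induction (`HasCharts.concat`) the charts correspond to the classes `P` of indices not yet separated
by `𝒜`, with the smaller indices in `B` and the larger ones in `D` (`Block.ofCollection`).

When the order is the total order given by `η`, every class is a single index. Chart `i` then has `v
w = u_{η(i)}`, with the earlier variables in `b` and the later ones in `c`, and its special fibre is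
the pair of branches `v = 0`, `w = 0`. The next chart is glued along `v' = 1 / w`, which joins the
branch `v = 0` of chart `i` to the branch `w' = 0` of chart `i + 1`. The result is a chain from `w =
0` in the first chart, the branch `y = 0`, to `v = 0` in the last one, the branch `x = 0`; its nodes
are the origins of the charts (`IsChain.chainPoint_specializes`). Its first component and its
adjacencies determine the numbering (`IsChain.comp_eq`).

In chart `i` the strict transform of `V(x, u_{η(k)})` is `u_{η(k)} = 0` for `k < i`, `v = u_{η(i)} =
0` for `k = i`, and empty for `k > i`; for `y` the order is reversed. Assertions 2 and 3 follow. For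
assertion 1, at the node and at the generic point of `v = w = u_{η(i)} = 0` the local ring of the
fibre has maximal ideal `(v, w)` with `v w = 0` and `v`, `w` nonzero, which no regular local ring
allows (`not_isRegularAlgebra`). The second point lies over the generic point of `V(u_{η(i)})` and
specializes to the node, so both lie in one connected component of the singular locus.

Two technical inputs carry this. Ideals of a chart are shown to be prime, and the `u_j` to be
nonzerodivisors, by adjoining the relations one at a time, each linear in a new variable
(`isPrime_map_C_sup_linear`, `IsRegularMod.swap`). And since a blowup is given only by its universal
property, its standard charts have to be recognised as open immersions (`IsBlowup.exists_chart`). -/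

noncomputable section

/-! ### Prime ideals generated by a linear polynomial, and regular elements modulo an ideal -/

namespace NodalBlowup

-- The ideal is the kernel of evaluation at `y / c` in the fraction field: the hypothesis on `y`
-- lets the top coefficient of a polynomial in the kernel be divided by `c`, so subtracting a
-- multiple of the generator lowers the degree.
open Polynomial in
theorem isPrime_span_linear {D : Type*} [CommRing D] [IsDomain D] {c y : D} (hc : c ≠ 0)
    (h : ∀ g, c ∣ y * g → c ∣ g) : (Ideal.span {C c * X - C y} : Ideal D[X]).IsPrime := by
  let φ : D[X] →+* FractionRing D :=
    eval₂RingHom (algebraMap D _) (algebraMap D _ y / algebraMap D _ c)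
  have hc' : algebraMap D (FractionRing D) c ≠ 0 := by simpa using hc
  have hpow : ∀ (n : ℕ) g, c ∣ y ^ n * g → c ∣ g := by
    intro n
    induction n with
    | zero => intro g hg; simpa using hg
    | succ n ih => intro g hg; exact h g (ih _ (by rwa [pow_succ, mul_assoc] at hg))
  have key : ∀ (n : ℕ) (f : D[X]), f.natDegree ≤ n → φ f = 0 →
      f ∈ (Ideal.span {C c * X - C y} : Ideal D[X]) := by
    intro n
    induction n with
    | zero =>
      intro f hf h0
      rw [eq_C_of_natDegree_le_zero hf] at h0 ⊢
      have : f.coeff 0 = 0 := by simpa [φ] using h0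
      simp [this]
    | succ n ih =>
      intro f hf h0
      -- Denominators are cleared in `f(y / c) = 0`. Every term but the top one keeps a positive
      -- power of `c`, so `c` divides `y ^ (n + 1)` times the coefficient of degree `n + 1`.
      have e : ∑ i ∈ Finset.range (n + 2), f.coeff i * y ^ i * c ^ (n + 1 - i) = 0 := by
        apply IsFractionRing.injective D (FractionRing D)
        rw [map_zero, ← zero_mul (algebraMap D (FractionRing D) c ^ (n + 1)), ← h0, map_sum]
        simp only [φ, coe_eval₂RingHom]
        rw [eval₂_eq_sum_range' _ (show f.natDegree < n + 2 by omega), Finset.sum_mul]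
        refine Finset.sum_congr rfl fun i hi ↦ ?_
        have hi' : i ≤ n + 1 := by simp at hi; omega
        rw [map_mul, map_mul, map_pow, map_pow, div_pow, mul_assoc, mul_assoc,
          div_mul_eq_mul_div, mul_div_assoc, pow_sub₀ _ hc' hi', div_eq_mul_inv]
      rw [Finset.sum_range_succ, Nat.sub_self, pow_zero, mul_one] at e
      have hdvd : c ∣ y ^ (n + 1) * f.coeff (n + 1) := by
        rw [mul_comm, eq_neg_of_add_eq_zero_right e, dvd_neg]
        refine Finset.dvd_sum fun i hi ↦ ?_
        have : n + 1 - i ≠ 0 := by simp at hi; omega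
        exact (dvd_pow_self c this).mul_left _
      obtain ⟨a, ha⟩ := hpow _ _ hdvd
      have hmem : f - C a * X ^ n * (C c * X - C y) ∈
          (Ideal.span {C c * X - C y} : Ideal D[X]) := by
        apply ih
        · rw [natDegree_le_iff_coeff_eq_zero] at hf ⊢
          intro N hN
          obtain ⟨N, rfl⟩ : ∃ k, N = k + 1 := ⟨N - 1, by omega⟩
          have e1 : C a * X ^ n * (C c * X - C y) =
              C (c * a) * X ^ (n + 1) - C (a * y) * X ^ n := by
            simp only [C_mul]; ring
          rw [e1, coeff_sub, coeff_sub, coeff_C_mul_X_pow, coeff_C_mul_X_pow]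
          by_cases hNn : N = n
          · subst hNn; simp [ha]
          · rw [hf (N + 1) (by omega), if_neg (by omega), if_neg (by omega)]; simp
        · rw [map_sub, h0, map_mul, map_sub]
          simp [φ, mul_div_cancel₀ _ hc']
      have := Ideal.add_mem _ hmem
        (Ideal.mul_mem_left _ (C a * X ^ n) (Ideal.mem_span_singleton_self (C c * X - C y)))
      simpa using this
  have : (Ideal.span {C c * X - C y} : Ideal D[X]) = RingHom.ker φ := by
    apply le_antisymm
    · rw [Ideal.span_singleton_le_iff_mem, RingHom.mem_ker]
      simp [φ, mul_div_cancel₀ _ hc']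
    · intro f hf
      exact key _ f le_rfl hf
  rw [this]
  exact RingHom.ker_isPrime φ

open Polynomial in
/-- If `y` is a nonzerodivisor modulo `I + (c)`, then `I` and `c X - y` generate a prime ideal. -/
theorem isPrime_map_C_sup_linear {Q : Type*} [CommRing Q] {I : Ideal Q} [hI : I.IsPrime] {c y : Q}
    (hc : c ∉ I) (h : ∀ g, y * g ∈ I ⊔ Ideal.span {c} → g ∈ I ⊔ Ideal.span {c}) :
    (I.map C ⊔ Ideal.span {C c * X - C y} : Ideal Q[X]).IsPrime := by
  have hmem : ∀ g : Q, g ∈ I ⊔ Ideal.span {c} ↔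
      Ideal.Quotient.mk I c ∣ Ideal.Quotient.mk I g := by
    intro g
    rw [← Ideal.mem_span_singleton, ← Set.image_singleton, ← Ideal.map_span, ← Ideal.mem_comap,
      Ideal.comap_map_of_surjective _ Ideal.Quotient.mk_surjective, sup_comm,
      ← RingHom.ker_eq_comap_bot, Ideal.mk_ker]
  let f : Q[X] →+* (Q ⧸ I)[X] := mapRingHom (Ideal.Quotient.mk I)
  have hf : Function.Surjective f := map_surjective _ Ideal.Quotient.mk_surjective
  have hk : RingHom.ker f = I.map C := by
    rw [ker_mapRingHom, Ideal.mk_ker]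
  have hp : (Ideal.span {C (Ideal.Quotient.mk I c) * X - C (Ideal.Quotient.mk I y)} :
      Ideal (Q ⧸ I)[X]).IsPrime := by
    apply isPrime_span_linear
    · rwa [Ne, Ideal.Quotient.eq_zero_iff_mem]
    · intro g hg
      obtain ⟨g, rfl⟩ := Ideal.Quotient.mk_surjective g
      rw [← map_mul, ← hmem] at hg
      rw [← hmem]; exact h g hg
  have e : (I.map C ⊔ Ideal.span {C c * X - C y} : Ideal Q[X]) =
      Ideal.comap f (Ideal.span {C (Ideal.Quotient.mk I c) * X - C (Ideal.Quotient.mk I y)}) := by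
    have : (Ideal.span {C (Ideal.Quotient.mk I c) * X - C (Ideal.Quotient.mk I y)} :
        Ideal (Q ⧸ I)[X]) = Ideal.map f (Ideal.span {C c * X - C y}) := by
      rw [Ideal.map_span]; simp [f]
    rw [this, Ideal.comap_map_of_surjective f hf, sup_comm, ← hk]; rfl
  rw [e]
  infer_instance

/-- `a` is a nonzerodivisor modulo the ideal `I`. -/
def IsRegularMod {Q : Type*} [CommRing Q] (I : Ideal Q) (a : Q) : Prop :=
  ∀ g, a * g ∈ I → g ∈ I

theorem IsRegularMod.of_isPrime {Q : Type*} [CommRing Q] {I : Ideal Q} (hI : I.IsPrime) {a : Q}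
    (ha : a ∉ I) : IsRegularMod I a := fun _ hg ↦ (hI.mem_or_mem hg).resolve_left ha

/-- The half of the permutability of regular sequences that needs neither a local nor a Noetherian
hypothesis. It keeps `u` a nonzerodivisor while relations `a` are adjoined to `I` one at a time. -/
theorem IsRegularMod.swap {Q : Type*} [CommRing Q] {I : Ideal Q} {u a : Q} (hu : IsRegularMod I u)
    (ha : IsRegularMod (I ⊔ Ideal.span {u}) a) : IsRegularMod (I ⊔ Ideal.span {a}) u := by
  intro g hg
  obtain ⟨i, hi, h, hh, e⟩ := Submodule.mem_sup.mp hg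
  obtain ⟨h, rfl⟩ := Ideal.mem_span_singleton'.mp hh
  have h1 : a * h ∈ I ⊔ Ideal.span {u} := by
    have : a * h = -i + g * u := by linear_combination e
    rw [this]
    exact Ideal.add_mem _ (Ideal.mem_sup_left (neg_mem hi))
      (Ideal.mem_sup_right (Ideal.mul_mem_left _ _ (Ideal.mem_span_singleton_self u)))
  obtain ⟨i', hi', k, hk, e'⟩ := Submodule.mem_sup.mp (ha h h1)
  obtain ⟨k, rfl⟩ := Ideal.mem_span_singleton'.mp hk
  have h2 : u * (g - a * k) ∈ I := by
    have : u * (g - a * k) = i + a * i' := by linear_combination (-e) - a * e'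
    rw [this]
    exact Ideal.add_mem _ hi (Ideal.mul_mem_left _ _ hi')
  have h3 := hu _ h2
  have : g = (g - a * k) + k * a := by ring
  rw [this]
  exact Ideal.add_mem _ (Ideal.mem_sup_left h3)
    (Ideal.mem_sup_right (Ideal.mul_mem_left _ _ (Ideal.mem_span_singleton_self a)))

/-! ### Ideals generated by variables of a power series ring -/

section VarIdeal

variable {σ : Type*} {K : Type*} [Field K]

/-- The ideal generated by the variables with index in `Z`. -/
def varIdeal (K : Type*) [Field K] (Z : Finset σ) : Ideal (MvPowerSeries σ K) :=
  Ideal.span (MvPowerSeries.X '' (Z : Set σ))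

/-- Induction on `Z`: the part of `f` made of the monomials without the variable `i` falls under the
induction hypothesis, and the rest is divisible by that variable. -/
theorem mem_varIdeal_of_coeff [DecidableEq σ] (Z : Finset σ) (f : MvPowerSeries σ K)
    (hf : ∀ n : σ →₀ ℕ, (∀ i ∈ Z, n i = 0) → MvPowerSeries.coeff n f = 0) :
    f ∈ varIdeal K Z := by
  induction Z using Finset.induction_on generalizing f with
  | empty =>
    have : f = 0 := by ext n; simpa using hf n (by simp)
    simp [this]
  | insert i Z hi ih =>
    let g : MvPowerSeries σ K := fun n ↦ if n i = 0 then MvPowerSeries.coeff n f else 0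
    have hg : ∀ n, MvPowerSeries.coeff n g = if n i = 0 then MvPowerSeries.coeff n f else 0 :=
      fun n ↦ rfl
    have h1 : g ∈ varIdeal K Z := by
      apply ih
      intro n hn
      rw [hg]
      split_ifs with h
      · exact hf n (by simpa [h] using hn)
      · rfl
    obtain ⟨h, hh⟩ : (MvPowerSeries.X i : MvPowerSeries σ K) ∣ f - g := by
      rw [MvPowerSeries.X_dvd_iff]
      intro m hm
      rw [map_sub, hg, if_pos hm, sub_self]
    have : f = g + MvPowerSeries.X i * h := by rw [← hh]; ring
    rw [this]
    refine Ideal.add_mem _ (Ideal.span_mono (Set.image_mono (by simp)) h1)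
      (Ideal.mul_mem_right _ _ (Ideal.subset_span ⟨i, by simp, rfl⟩))

/-- Realises the quotient inside the power series in the remaining variables, a domain; primality of
`varIdeal` comes from this. -/
theorem varIdeal_eq_ker (Z : Finset σ) : varIdeal K Z = RingHom.ker
    (MvPowerSeries.killCompl (R := K) (Function.Embedding.subtype (· ∉ Z))) := by
  classical
  apply le_antisymm
  · rw [varIdeal, Ideal.span_le]
    rintro _ ⟨i, hi, rfl⟩
    exact MvPowerSeries.killCompl_X_eq_zero (by simpa using hi)
  · intro f hf
    apply mem_varIdeal_of_coeff
    intro n hn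
    have hr : n ∈ Set.range (Finsupp.embDomain (Function.Embedding.subtype (· ∉ Z))) := by
      rw [Finsupp.mem_range_embDomain_iff]
      intro i hi
      simp only [Finset.mem_coe, Finsupp.mem_support_iff] at hi
      simpa using fun h ↦ hi (hn i h)
    obtain ⟨m, rfl⟩ := hr
    rw [← MvPowerSeries.coeff_killCompl, (RingHom.mem_ker).mp hf, map_zero]

instance (Z : Finset σ) : (varIdeal K Z).IsPrime := by
  have : IsDomain (MvPowerSeries {i // i ∉ Z} K) := NoZeroDivisors.to_isDomain _
  rw [varIdeal_eq_ker]
  exact RingHom.ker_isPrime _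

theorem X_mem_varIdeal {Z : Finset σ} {i : σ} :
    (MvPowerSeries.X i : MvPowerSeries σ K) ∈ varIdeal K Z ↔ i ∈ Z := by
  refine ⟨fun h ↦ ?_, fun h ↦ Ideal.subset_span ⟨i, h, rfl⟩⟩
  by_contra hi
  rw [varIdeal_eq_ker, RingHom.mem_ker] at h
  have := MvPowerSeries.killCompl_X (R := K) (e := Function.Embedding.subtype (· ∉ Z)) ⟨i, hi⟩
  rw [Function.Embedding.subtype_apply] at this
  rw [this] at h
  classical
  have := congr_arg (MvPowerSeries.coeff (Finsupp.single ⟨i, hi⟩ 1)) h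
  simp [MvPowerSeries.coeff_X] at this

theorem prod_mem_varIdeal {Z A : Finset σ} :
    (∏ i ∈ A, MvPowerSeries.X i : MvPowerSeries σ K) ∈ varIdeal K Z ↔ ∃ i ∈ A, i ∈ Z := by
  rw [Ideal.IsPrime.prod_mem_iff]
  simp [X_mem_varIdeal]

theorem varIdeal_insert [DecidableEq σ] (Z : Finset σ) (i : σ) :
    varIdeal K (insert i Z) = varIdeal K Z ⊔ Ideal.span {MvPowerSeries.X i} := by
  rw [varIdeal, Finset.coe_insert, Set.image_insert_eq, Ideal.span_insert, sup_comm, varIdeal]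

end VarIdeal

/-! ### The coordinate ring of a chart -/

section ChartRing

open Polynomial

variable {M : Type*} [CommRing M]

/-- The relations `c w = y`, `b v = x`, `v w = p` in `M[w][v]`. -/
def chartIdeal (x y b c p : M) : Ideal M[X][X] :=
  Ideal.span {C (C c * X - C y), C (C b) * X - C (C x), C X * X - C (C p)}

/-- The ring `M[v, w] / (x - b v, y - c w, v w - p)`. -/
def ChartRing (x y b c p : M) : Type _ := M[X][X] ⧸ chartIdeal x y b c p

namespace ChartRing

variable (x y b c p : M)

instance : CommRing (ChartRing x y b c p) := inferInstanceAs (CommRing (_ ⧸ _))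

/-- The quotient map. -/
def mk : M[X][X] →+* ChartRing x y b c p := Ideal.Quotient.mk _

/-- The structure map. -/
def of : M →+* ChartRing x y b c p := (mk x y b c p).comp (C.comp C)

/-- The coordinate `v = x / b`. -/
def v : ChartRing x y b c p := mk x y b c p X

/-- The coordinate `w = y / c`. -/
def w : ChartRing x y b c p := mk x y b c p (C X)

theorem mk_surjective : Function.Surjective (mk x y b c p) := Ideal.Quotient.mk_surjective

theorem ker_mk : RingHom.ker (mk x y b c p) = chartIdeal x y b c p := Ideal.mk_ker

theorem of_apply (a : M) : of x y b c p a = mk x y b c p (C (C a)) := rfl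

variable {x y b c p}

theorem of_x : of x y b c p x = v x y b c p * of x y b c p b := by
  have : mk x y b c p (C (C b) * X - C (C x)) = 0 :=
    Ideal.Quotient.eq_zero_iff_mem.mpr (Ideal.subset_span (by simp))
  rw [map_sub, map_mul, sub_eq_zero] at this
  rw [of_apply, ← this, mul_comm]; rfl

theorem of_y : of x y b c p y = w x y b c p * of x y b c p c := by
  have : mk x y b c p (C (C c * X - C y)) = 0 :=
    Ideal.Quotient.eq_zero_iff_mem.mpr (Ideal.subset_span (by simp))
  rw [map_sub, map_mul, map_sub, map_mul, sub_eq_zero] at this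
  rw [of_apply, ← this, mul_comm]; rfl

theorem v_mul_w : v x y b c p * w x y b c p = of x y b c p p := by
  have : mk x y b c p (C X * X - C (C p)) = 0 :=
    Ideal.Quotient.eq_zero_iff_mem.mpr (Ideal.subset_span (by simp))
  rw [map_sub, map_mul, sub_eq_zero] at this
  rw [of_apply, ← this, mul_comm]; rfl

/-- The universal property of the chart ring. -/
def lift {A : Type*} [CommRing A] (f : M →+* A) (s t : A) (hx : f x = s * f b)
    (hy : f y = t * f c) (hp : s * t = f p) : ChartRing x y b c p →+* A :=
  Ideal.Quotient.lift _ (eval₂RingHom (eval₂RingHom f t) s) fun a ha ↦ by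
    have : chartIdeal x y b c p ≤ RingHom.ker (eval₂RingHom (eval₂RingHom f t) s) := by
      rw [chartIdeal, Ideal.span_le]
      rintro _ (rfl | rfl | rfl) <;> rw [SetLike.mem_coe, RingHom.mem_ker]
      · simp [hy, mul_comm t]
      · simp [hx, mul_comm s]
      · simp [mul_comm t, hp]
    exact this ha

section

variable {A : Type*} [CommRing A] (f : M →+* A) (s t : A) (hx : f x = s * f b)
    (hy : f y = t * f c) (hp : s * t = f p)

@[simp] theorem lift_of (a : M) : lift f s t hx hy hp (of x y b c p a) = f a := by
  change eval₂RingHom (eval₂RingHom f t) s (C (C a)) = f a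
  simp

@[simp] theorem lift_v : lift f s t hx hy hp (v x y b c p) = s := by
  change eval₂RingHom (eval₂RingHom f t) s X = s
  simp

@[simp] theorem lift_w : lift f s t hx hy hp (w x y b c p) = t := by
  change eval₂RingHom (eval₂RingHom f t) s (C X) = t
  simp

end

theorem hom_ext {A : Type*} [CommRing A] {f g : ChartRing x y b c p →+* A}
    (h : ∀ a, f (of x y b c p a) = g (of x y b c p a)) (hv : f (v x y b c p) = g (v x y b c p))
    (hw : f (w x y b c p) = g (w x y b c p)) : f = g := by
  apply Ideal.Quotient.ringHom_ext
  apply Polynomial.ringHom_ext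
  · intro q
    exact congrFun (congrArg DFunLike.coe (Polynomial.ringHom_ext (f := (f.comp (mk x y b c p)).comp C)
      (g := (g.comp (mk x y b c p)).comp C) h hw)) q
  · exact hv

/-- Modulo `v` and `w` every element comes from `M`; this serves to identify the residue field at
the origin of a chart. -/
theorem exists_eq (a : ChartRing x y b c p) : ∃ m s t,
    a = of x y b c p m + v x y b c p * s + w x y b c p * t := by
  obtain ⟨a, rfl⟩ := mk_surjective x y b c p a
  refine ⟨(a.coeff 0).coeff 0, mk x y b c p a.divX, mk x y b c p (C (a.coeff 0).divX), ?_⟩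
  rw [of_apply, v, w, ← map_mul, ← map_mul, ← map_add, ← map_add]
  congr 1
  conv_lhs => rw [← X_mul_divX_add a, ← X_mul_divX_add (a.coeff 0)]
  simp only [C_add, C_mul]
  ring

variable (x y b c p) in
/-- The chart ring is symmetric. -/
def swap : ChartRing x y b c p ≃+* ChartRing y x c b p :=
  RingEquiv.ofRingHom
    (lift (of y x c b p) (w y x c b p) (v y x c b p) of_y of_x (by rw [mul_comm, v_mul_w]))
    (lift (of x y b c p) (w x y b c p) (v x y b c p) of_y of_x (by rw [mul_comm, v_mul_w]))
    (hom_ext (by simp) (by simp) (by simp)) (hom_ext (by simp) (by simp) (by simp))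

@[simp] theorem swap_of (a : M) : swap x y b c p (of x y b c p a) = of y x c b p a :=
  lift_of (of y x c b p) (w y x c b p) (v y x c b p) of_y of_x (by rw [mul_comm, v_mul_w]) a

@[simp] theorem swap_v : swap x y b c p (v x y b c p) = w y x c b p :=
  lift_v (of y x c b p) (w y x c b p) (v y x c b p) of_y of_x (by rw [mul_comm, v_mul_w])

@[simp] theorem swap_w : swap x y b c p (w x y b c p) = v y x c b p :=
  lift_w (of y x c b p) (w y x c b p) (v y x c b p) of_y of_x (by rw [mul_comm, v_mul_w])

theorem mk_mem_map {J : Ideal M[X][X]} (hJ : chartIdeal x y b c p ≤ J) {a : M[X][X]} :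
    mk x y b c p a ∈ J.map (mk x y b c p) ↔ a ∈ J := by
  rw [← Ideal.mem_comap, Ideal.comap_map_of_surjective _ (mk_surjective _ _ _ _ _),
    ← RingHom.ker_eq_comap_bot, ker_mk, sup_eq_left.mpr hJ]

theorem isPrime_map {J : Ideal M[X][X]} (hJ : chartIdeal x y b c p ≤ J) [J.IsPrime] :
    (J.map (mk x y b c p)).IsPrime :=
  Ideal.map_isPrime_of_surjective (mk_surjective _ _ _ _ _) (by rwa [ker_mk])

end ChartRing

/-- Evaluation of `X` at `y / c` in the fraction field of `Q ⧸ I` kills the whole ideal, and on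
constants its kernel is `I`. -/
theorem C_mem_of_linear {Q : Type*} [CommRing Q] {I : Ideal Q} [hI : I.IsPrime] {c y : Q}
    (hc : c ∉ I) :
    (∀ f, C f ∈ I.map C ⊔ Ideal.span {C c * X - C y} → f ∈ I) ∧
    (X ∈ I.map C ⊔ Ideal.span {C c * X - C y} → y ∈ I) := by
  have hc' : algebraMap (Q ⧸ I) (FractionRing (Q ⧸ I)) (Ideal.Quotient.mk I c) ≠ 0 := by
    rwa [Ne, FaithfulSMul.algebraMap_eq_zero_iff, Ideal.Quotient.eq_zero_iff_mem]
  let g : Q →+* FractionRing (Q ⧸ I) := (algebraMap _ _).comp (Ideal.Quotient.mk I)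
  have hg : ∀ a, g a = 0 ↔ a ∈ I := by
    intro a
    simp [g, FaithfulSMul.algebraMap_eq_zero_iff, Ideal.Quotient.eq_zero_iff_mem]
  let φ := eval₂RingHom g (g y / g c)
  have hφ : I.map C ⊔ Ideal.span {C c * X - C y} ≤ RingHom.ker φ := by
    rw [sup_le_iff, Ideal.map_le_iff_le_comap, Ideal.span_singleton_le_iff_mem]
    constructor
    · intro a ha
      simpa [φ] using (hg a).mpr ha
    · rw [RingHom.mem_ker]
      have : g c ≠ 0 := hc'
      simp [φ, mul_div_cancel₀ _ this]
  refine ⟨fun f hf ↦ ?_, fun h ↦ ?_⟩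
  · simpa [φ, hg] using hφ hf
  · have := hφ h
    have h0 : g c ≠ 0 := hc'
    simpa [φ, hg, hc] using this

theorem isPrime_map_C_sup_X {Q : Type*} [CommRing Q] (I : Ideal Q) [hI : I.IsPrime] :
    (I.map C ⊔ Ideal.span {X} : Ideal Q[X]).IsPrime := by
  have h1 : (1 : Q) ∉ I := fun h ↦ hI.ne_top ((Ideal.eq_top_iff_one _).mpr h)
  have := isPrime_map_C_sup_linear (I := I) (c := 1) (y := 0) h1 (fun g _ ↦ by simp)
  simpa using this

theorem C_mem_of_map_C_sup_X {Q : Type*} [CommRing Q] {I : Ideal Q} [hI : I.IsPrime] {f : Q}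
    (hf : C f ∈ (I.map C ⊔ Ideal.span {X} : Ideal Q[X])) : f ∈ I := by
  have h1 : (1 : Q) ∉ I := fun h ↦ hI.ne_top ((Ideal.eq_top_iff_one _).mpr h)
  exact (C_mem_of_linear (y := 0) h1).1 f (by simpa using hf)

end ChartRing

/-! ### Prime ideals of a chart whose data are products of variables -/

section MonChart

set_option linter.unusedSectionVars false

open Polynomial

variable {σ : Type*} [DecidableEq σ] {K : Type*} [Field K]

/-- A product of variables. -/
abbrev prodX (K : Type*) [Field K] (A : Finset σ) : MvPowerSeries σ K :=
  ∏ i ∈ A, MvPowerSeries.X i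

/-- The variables `i`, `k` and the variables in `B`, `D`, `P` are all distinct. -/
structure Separated (i k : σ) (B D P : Finset σ) : Prop where
  ne : i ≠ k
  iB : i ∉ B
  iD : i ∉ D
  iP : i ∉ P
  kB : k ∉ B
  kD : k ∉ D
  kP : k ∉ P
  BD : Disjoint B D
  BP : Disjoint B P
  DP : Disjoint D P

theorem Separated.symm {i k : σ} {B D P : Finset σ} (h : Separated i k B D P) :
    Separated k i D B P :=
  ⟨h.ne.symm, h.kD, h.kB, h.kP, h.iD, h.iB, h.iP, h.BD.symm, h.DP, h.BP⟩

/-- The chart with `x` and `y` the variables `i` and `k`, and `b`, `c`, `p` products of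
variables. -/
abbrev MonChart (K : Type*) [Field K] (i k : σ) (B D P : Finset σ) : Type _ :=
  ChartRing (MvPowerSeries.X i : MvPowerSeries σ K) (MvPowerSeries.X k) (prodX K B) (prodX K D)
    (prodX K P)

/-- The ideal of `K[[σ]][w]` generated by the variables in `Z` and by `c w - y`. -/
def yIdeal (K : Type*) [Field K] (Z D : Finset σ) (k : σ) : Ideal (MvPowerSeries σ K)[X] :=
  (varIdeal K Z).map C ⊔ Ideal.span {C (prodX K D) * X - C (MvPowerSeries.X k)}

variable {i k j : σ} {B D P Z U : Finset σ}

theorem prodX_notMem (h : Disjoint D Z) : prodX K D ∉ varIdeal K Z := by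
  rw [prod_mem_varIdeal]
  rintro ⟨i, h1, h2⟩
  exact Finset.disjoint_left.mp h h1 h2

theorem prodX_mem (h : j ∈ D) (hj : j ∈ Z) : prodX K D ∈ varIdeal K Z :=
  prod_mem_varIdeal.mpr ⟨j, h, hj⟩

/-- The linear criterion needs `y` regular modulo `Z` and `c`, an ideal that need not be prime. By
`IsRegularMod.swap` it is enough that `c` is regular modulo `Z` and `y`, and those are variables
generating a prime. -/
theorem yIdeal_isPrime (hk : k ∉ Z) (hkD : k ∉ D) (h : Disjoint D Z) :
    (yIdeal K Z D k).IsPrime := by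
  apply isPrime_map_C_sup_linear (prodX_notMem h)
  refine IsRegularMod.swap (.of_isPrime inferInstance (by rwa [X_mem_varIdeal]))
    (.of_isPrime (I := varIdeal K Z ⊔ _) ?_ ?_)
  · rw [← varIdeal_insert]; infer_instance
  · rw [← varIdeal_insert]
    exact prodX_notMem (by simp [hkD, h])

theorem C_mem_yIdeal (h : Disjoint D Z) {f : MvPowerSeries σ K} :
    C f ∈ yIdeal K Z D k ↔ f ∈ varIdeal K Z :=
  ⟨(C_mem_of_linear (prodX_notMem h)).1 f, fun hf ↦ Ideal.mem_sup_left (Ideal.mem_map_of_mem _ hf)⟩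

theorem X_notMem_yIdeal (hk : k ∉ Z) (h : Disjoint D Z) : X ∉ yIdeal K Z D k := fun hX ↦
  hk (X_mem_varIdeal.mp ((C_mem_of_linear (prodX_notMem h)).2 hX))

theorem chartIdeal_le {M : Type*} [CommRing M] {x y b c p : M} {J : Ideal M[X][X]}
    (h1 : C (C c * X - C y) ∈ J) (h2 : C (C b) * X - C (C x) ∈ J)
    (h3 : C X * X - C (C p) ∈ J) : chartIdeal x y b c p ≤ J := by
  rw [chartIdeal, Ideal.span_le]
  rintro _ (rfl | rfl | rfl) <;> assumption

theorem linear_mem_yIdeal : C (prodX K D) * X - C (MvPowerSeries.X k) ∈ yIdeal K Z D k :=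
  Ideal.mem_sup_right (Ideal.mem_span_singleton_self _)

theorem C_mem_yIdeal_of_mem {f : MvPowerSeries σ K} (hf : f ∈ varIdeal K Z) :
    C f ∈ yIdeal K Z D k := Ideal.mem_sup_left (Ideal.mem_map_of_mem _ hf)

theorem yIdeal_le {J : Ideal (MvPowerSeries σ K)[X]} :
    yIdeal K Z D k ≤ J ↔ (∀ l ∈ Z, C (MvPowerSeries.X l) ∈ J) ∧
      C (prodX K D) * X - C (MvPowerSeries.X k) ∈ J := by
  rw [yIdeal, sup_le_iff, Ideal.span_singleton_le_iff_mem, Ideal.map_le_iff_le_comap, varIdeal,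
    Ideal.span_le, Set.image_subset_iff]
  rfl

namespace MonChart

variable (K i k B D P) in
/-- The image of a power series in the chart. -/
abbrev of : MvPowerSeries σ K →+* MonChart K i k B D P := ChartRing.of _ _ _ _ _

variable (K i k B D P) in
/-- The coordinate `x / b`. -/
abbrev v : MonChart K i k B D P := ChartRing.v _ _ _ _ _

variable (K i k B D P) in
/-- The coordinate `y / c`. -/
abbrev w : MonChart K i k B D P := ChartRing.w _ _ _ _ _

variable (K i k B D P) in
/-- The image of a variable in the chart. -/
abbrev var (j : σ) : MonChart K i k B D P := of K i k B D P (MvPowerSeries.X j)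

theorem var_x : var K i k B D P i = v K i k B D P * of K i k B D P (prodX K B) := ChartRing.of_x

theorem var_y : var K i k B D P k = w K i k B D P * of K i k B D P (prodX K D) := ChartRing.of_y

theorem v_mul_w : v K i k B D P * w K i k B D P = of K i k B D P (prodX K P) :=
  ChartRing.v_mul_w

theorem of_prodX (A : Finset σ) :
    of K i k B D P (prodX K A) = ∏ l ∈ A, var K i k B D P l := map_prod _ _ _

/-- The ideal `(u_j)` is prime if `u_j` divides `b`; its intersection with `K[[σ]]` is generated
by `u_j` and `x`. -/
theorem span_var_isPrime_of_mem_left (h : Separated i k B D P) (hj : j ∈ B) :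
    (Ideal.span {var K i k B D P j}).IsPrime ∧
    ∀ f, of K i k B D P f ∈ Ideal.span {var K i k B D P j} → f ∈ varIdeal K {j, i} := by
  have hjk : j ≠ k := fun e ↦ h.kB (e ▸ hj)
  have hkZ : k ∉ ({j, i} : Finset σ) := by simp [hjk.symm, h.ne.symm]
  have hDZ : Disjoint D {j, i} := by
    simp [h.iD, Finset.disjoint_left.mp h.BD hj]
  have := yIdeal_isPrime (K := K) hkZ h.kD hDZ
  -- Modulo `w` the relation `c w = y` becomes `y = 0`, so the ideal is generated by independent
  -- variables and is prime. None of these variables occurs in `p`.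
  have hreg : ∀ g, C (prodX K P) * g ∈ yIdeal K {j, i} D k ⊔ Ideal.span {X} →
      g ∈ yIdeal K {j, i} D k ⊔ Ideal.span {X} := by
    have e : yIdeal K {j, i} D k ⊔ Ideal.span {X} =
        (varIdeal K (insert k {j, i})).map C ⊔ Ideal.span {X} := by
      apply le_antisymm
      · rw [sup_le_iff, yIdeal_le]
        refine ⟨⟨fun l hl ↦ Ideal.mem_sup_left (Ideal.mem_map_of_mem _ (X_mem_varIdeal.mpr
          (Finset.mem_insert_of_mem hl))), ?_⟩, le_sup_right⟩
        refine sub_mem (Ideal.mem_sup_right (Ideal.mul_mem_left _ _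
          (Ideal.mem_span_singleton_self X))) (Ideal.mem_sup_left (Ideal.mem_map_of_mem _
          (X_mem_varIdeal.mpr (Finset.mem_insert_self _ _))))
      · rw [sup_le_iff]
        refine ⟨?_, le_sup_right⟩
        rw [varIdeal_insert, Ideal.map_sup, sup_le_iff, Ideal.map_span, Set.image_singleton,
          Ideal.span_singleton_le_iff_mem]
        refine ⟨le_sup_left.trans le_sup_left, ?_⟩
        rw [← sub_sub_self (C (prodX K D) * X) (C (MvPowerSeries.X k))]
        exact sub_mem (Ideal.mem_sup_right (Ideal.mul_mem_left _ _
          (Ideal.mem_span_singleton_self X))) (Ideal.mem_sup_left linear_mem_yIdeal)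
    rw [e]
    refine IsRegularMod.of_isPrime (isPrime_map_C_sup_X _) fun hp ↦ ?_
    refine prodX_notMem ?_ (C_mem_of_map_C_sup_X hp)
    simp [h.kP, h.iP, Finset.disjoint_left.mp h.BP hj]
  have hX := X_notMem_yIdeal (K := K) hkZ hDZ
  have hprime := isPrime_map_C_sup_linear hX hreg
  -- Since `u_j` divides `b`, the relation `b v = x` reduces to `x = 0`; this is why `i` accompanies
  -- `j` in the ideal.
  have hle : chartIdeal (MvPowerSeries.X i : MvPowerSeries σ K) (MvPowerSeries.X k) (prodX K B)
      (prodX K D) (prodX K P) ≤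
      (yIdeal K {j, i} D k).map C ⊔ Ideal.span {C X * X - C (C (prodX K P))} := by
    apply chartIdeal_le
    · exact Ideal.mem_sup_left (Ideal.mem_map_of_mem _ linear_mem_yIdeal)
    · refine Ideal.mem_sup_left (sub_mem (Ideal.mul_mem_right _ _ ?_) ?_) <;>
        refine Ideal.mem_map_of_mem _ (C_mem_yIdeal_of_mem ?_)
      · exact prodX_mem hj (by simp)
      · exact X_mem_varIdeal.mpr (by simp)
    · exact Ideal.mem_sup_right (Ideal.mem_span_singleton_self _)
  have e : Ideal.map (ChartRing.mk _ _ _ _ _) ((yIdeal K {j, i} D k).map C ⊔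
      Ideal.span {C X * X - C (C (prodX K P))}) = Ideal.span {var K i k B D P j} := by
    apply le_antisymm
    · rw [Ideal.map_le_iff_le_comap, sup_le_iff, Ideal.map_le_iff_le_comap, yIdeal_le,
        Ideal.span_singleton_le_iff_mem]
      have hzero : ∀ a ∈ chartIdeal (MvPowerSeries.X i : MvPowerSeries σ K) (MvPowerSeries.X k)
          (prodX K B) (prodX K D) (prodX K P), ChartRing.mk _ _ _ _ _ a ∈
            Ideal.span {var K i k B D P j} := by
        intro a ha
        rw [← ChartRing.ker_mk, RingHom.mem_ker] at ha
        rw [ha]; exact zero_mem _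
      refine ⟨⟨?_, hzero _ (Ideal.subset_span (by simp))⟩, hzero _ (Ideal.subset_span (by simp))⟩
      intro l hl
      have hjm := Ideal.mem_span_singleton_self (var K i k B D P j)
      obtain rfl | rfl : l = j ∨ l = i := by simpa using hl
      · exact hjm
      · change var K l k B D P l ∈ Ideal.span {var K l k B D P j}
        rw [var_x, of_prodX]
        exact Ideal.mul_mem_left _ _ (Ideal.mem_of_dvd _ (Finset.dvd_prod_of_mem _ hj) hjm)
    · rw [Ideal.span_singleton_le_iff_mem]
      exact Ideal.mem_map_of_mem _ (Ideal.mem_sup_left (Ideal.mem_map_of_mem _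
        (C_mem_yIdeal_of_mem (X_mem_varIdeal.mpr (by simp)))))
  rw [← e]
  refine ⟨ChartRing.isPrime_map hle, fun f hf ↦ ?_⟩
  exact (C_mem_yIdeal hDZ).mp ((C_mem_of_linear hX).1 _ ((ChartRing.mk_mem_map hle).mp hf))

theorem isPrime_of_comap {I : Ideal (MonChart K i k B D P)}
    {J : Ideal (MvPowerSeries σ K)[X][X]} (hJ : J.IsPrime)
    (h1 : chartIdeal (MvPowerSeries.X i : MvPowerSeries σ K) (MvPowerSeries.X k) (prodX K B)
      (prodX K D) (prodX K P) ≤ J)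
    (h2 : J ≤ I.comap (ChartRing.mk _ _ _ _ _)) (h3 : I ≤ J.map (ChartRing.mk _ _ _ _ _)) :
    I.IsPrime ∧ ∀ a, ChartRing.mk _ _ _ _ _ a ∈ I → a ∈ J := by
  have : J.map (ChartRing.mk _ _ _ _ _) = I := le_antisymm (Ideal.map_le_iff_le_comap.mpr h2) h3
  subst this
  exact ⟨ChartRing.isPrime_map h1, fun a ↦ (ChartRing.mk_mem_map h1).mp⟩

theorem linear_mem_comap (I : Ideal (MonChart K i k B D P)) :
    C (C (prodX K D) * X - C (MvPowerSeries.X k)) ∈ I.comap (ChartRing.mk _ _ _ _ _) := by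
  rw [Ideal.mem_comap]
  convert I.zero_mem
  exact Ideal.Quotient.eq_zero_iff_mem.mpr (Ideal.subset_span (by simp))

variable (K i k B D P) in
/-- The ideal generated by `v` and the variables in `Z`. -/
def vIdeal (Z : Finset σ) : Ideal (MonChart K i k B D P) :=
  Ideal.span (insert (v K i k B D P) (var K i k B D P '' Z))

variable (K i k B D P) in
/-- The ideal generated by `w` and the variables in `Z`. -/
def wIdeal (Z : Finset σ) : Ideal (MonChart K i k B D P) :=
  Ideal.span (insert (w K i k B D P) (var K i k B D P '' Z))

variable (K i k B D P) in
/-- The ideal generated by `v`, `w` and the variables in `Z`. -/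
def vwIdeal (Z : Finset σ) : Ideal (MonChart K i k B D P) :=
  Ideal.span (insert (v K i k B D P) (insert (w K i k B D P) (var K i k B D P '' Z)))

theorem v_mem_vIdeal : v K i k B D P ∈ vIdeal K i k B D P Z := Ideal.subset_span (by simp)

theorem var_mem_vIdeal (hj : j ∈ Z) : var K i k B D P j ∈ vIdeal K i k B D P Z :=
  Ideal.subset_span (Set.mem_insert_of_mem _ ⟨j, hj, rfl⟩)

theorem x_mem_vIdeal : var K i k B D P i ∈ vIdeal K i k B D P Z := by
  rw [var_x]
  exact Ideal.mul_mem_right _ _ v_mem_vIdeal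

theorem vIdeal_le {J : Ideal (MonChart K i k B D P)} :
    vIdeal K i k B D P Z ≤ J ↔ v K i k B D P ∈ J ∧ ∀ l ∈ Z, var K i k B D P l ∈ J := by
  rw [vIdeal, Ideal.span_le, Set.insert_subset_iff, Set.image_subset_iff]
  rfl

theorem wIdeal_le {J : Ideal (MonChart K i k B D P)} :
    wIdeal K i k B D P Z ≤ J ↔ w K i k B D P ∈ J ∧ ∀ l ∈ Z, var K i k B D P l ∈ J := by
  rw [wIdeal, Ideal.span_le, Set.insert_subset_iff, Set.image_subset_iff]
  rfl

theorem vwIdeal_le {J : Ideal (MonChart K i k B D P)} :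
    vwIdeal K i k B D P Z ≤ J ↔ v K i k B D P ∈ J ∧ w K i k B D P ∈ J ∧
      ∀ l ∈ Z, var K i k B D P l ∈ J := by
  rw [vwIdeal, Ideal.span_le, Set.insert_subset_iff, Set.insert_subset_iff, Set.image_subset_iff]
  rfl

/-- Modulo `v` and `Z` the relation `v w = p` is vacuous because `Z` meets `P`, and `x = b v` gives
`x = 0`. Only `c w = y` is left, over the power series modulo `Z` and `x`, and `yIdeal` covers it.
-/
theorem vIdeal_isPrime (h : Separated i k B D P) (hP : ∃ l ∈ P, l ∈ Z) (hD : Disjoint D Z)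
    (hk : k ∉ Z) : (vIdeal K i k B D P Z).IsPrime ∧
      (∀ f, of K i k B D P f ∈ vIdeal K i k B D P Z → f ∈ varIdeal K (insert i Z)) ∧
      w K i k B D P ∉ vIdeal K i k B D P Z := by
  have hk' : k ∉ insert i Z := by simp [h.ne.symm, hk]
  have hD' : Disjoint D (insert i Z) := by simp [hD, h.iD]
  have := yIdeal_isPrime (K := K) hk' h.kD hD'
  obtain ⟨l, hl, hlZ⟩ := hP
  have := isPrime_of_comap (i := i) (B := B) (P := P) (I := vIdeal K i k B D P Z)
    (isPrime_map_C_sup_X (yIdeal K (insert i Z) D k)) ?_ ?_ ?_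
  · refine ⟨this.1, fun f hf ↦ ?_, fun hw ↦ ?_⟩
    · exact (C_mem_yIdeal hD').mp (C_mem_of_map_C_sup_X (this.2 _ hf))
    · exact X_notMem_yIdeal hk' hD' (C_mem_of_map_C_sup_X (this.2 _ hw))
  · apply chartIdeal_le
    · exact Ideal.mem_sup_left (Ideal.mem_map_of_mem _ linear_mem_yIdeal)
    · exact sub_mem (Ideal.mem_sup_right (Ideal.mul_mem_left _ _
        (Ideal.mem_span_singleton_self _))) (Ideal.mem_sup_left (Ideal.mem_map_of_mem _
        (C_mem_yIdeal_of_mem (X_mem_varIdeal.mpr (by simp)))))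
    · exact sub_mem (Ideal.mem_sup_right (Ideal.mul_mem_left _ _
        (Ideal.mem_span_singleton_self _))) (Ideal.mem_sup_left (Ideal.mem_map_of_mem _
        (C_mem_yIdeal_of_mem (prodX_mem hl (by simp [hlZ])))))
  · rw [sup_le_iff, Ideal.map_le_iff_le_comap, yIdeal_le, Ideal.span_singleton_le_iff_mem]
    refine ⟨⟨fun l hl ↦ ?_, linear_mem_comap (vIdeal K i k B D P Z)⟩,
      v_mem_vIdeal⟩
    rcases Finset.mem_insert.mp hl with rfl | hl
    · exact x_mem_vIdeal
    · exact var_mem_vIdeal hl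
  · rw [vIdeal_le]
    refine ⟨Ideal.mem_map_of_mem _ (Ideal.mem_sup_right (Ideal.mem_span_singleton_self _)),
      fun l hl ↦ Ideal.mem_map_of_mem _ (Ideal.mem_sup_left (Ideal.mem_map_of_mem _
        (C_mem_yIdeal_of_mem (X_mem_varIdeal.mpr (by simp [hl])))))⟩

/-- If `Z` also meets `D`, then `c` vanishes and `y` with it, so that `w` becomes a free variable
over a power series ring. -/
theorem vIdeal_isPrime' (h : Separated i k B D P) (hP : ∃ l ∈ P, l ∈ Z) (hD : ∃ l ∈ D, l ∈ Z) :
    (vIdeal K i k B D P Z).IsPrime ∧ w K i k B D P ∉ vIdeal K i k B D P Z := by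
  let J : Ideal (MvPowerSeries σ K)[X] := (varIdeal K (insert k (insert i Z))).map C
  have hJ : J.IsPrime := Ideal.isPrime_map_C_of_isPrime
  have hmem : ∀ f ∈ varIdeal K (insert k (insert i Z)),
      C (C f) ∈ (J.map C ⊔ Ideal.span {X} : Ideal (MvPowerSeries σ K)[X][X]) := fun f hf ↦
    Ideal.mem_sup_left (Ideal.mem_map_of_mem _ (Ideal.mem_map_of_mem _ hf))
  obtain ⟨l, hl, hlZ⟩ := hP
  obtain ⟨m, hm, hmZ⟩ := hD
  have := isPrime_of_comap (i := i) (B := B) (P := P) (D := D) (k := k)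
    (I := vIdeal K i k B D P Z) (isPrime_map_C_sup_X J) ?_ ?_ ?_
  · refine ⟨this.1, fun hw ↦ ?_⟩
    have h1 : X ∈ J := C_mem_of_map_C_sup_X (this.2 _ hw)
    have h2 := Ideal.mem_map_C_iff.mp h1 1
    rw [coeff_X_one] at h2
    exact (inferInstance : (varIdeal K (insert k (insert i Z))).IsPrime).ne_top
      ((Ideal.eq_top_iff_one _).mpr h2)
  · apply chartIdeal_le
    · rw [C_sub, C_mul]
      exact sub_mem (Ideal.mul_mem_right _ _ (hmem _ (prodX_mem hm (by simp [hmZ]))))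
        (hmem _ (X_mem_varIdeal.mpr (by simp)))
    · exact sub_mem (Ideal.mem_sup_right (Ideal.mul_mem_left _ _
        (Ideal.mem_span_singleton_self _))) (hmem _ (X_mem_varIdeal.mpr (by simp)))
    · exact sub_mem (Ideal.mem_sup_right (Ideal.mul_mem_left _ _
        (Ideal.mem_span_singleton_self _))) (hmem _ (prodX_mem hl (by simp [hlZ])))
  · rw [sup_le_iff, Ideal.map_le_iff_le_comap, Ideal.map_le_iff_le_comap, varIdeal, Ideal.span_le,
      Ideal.span_singleton_le_iff_mem]
    refine ⟨?_, v_mem_vIdeal⟩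
    rintro _ ⟨l, hl, rfl⟩
    change var K i k B D P l ∈ vIdeal K i k B D P Z
    obtain rfl | rfl | hl : l = k ∨ l = i ∨ l ∈ Z := by simpa using hl
    · rw [var_y, of_prodX]
      exact Ideal.mul_mem_left _ _ (Ideal.mem_of_dvd _ (Finset.dvd_prod_of_mem _ hm)
        (var_mem_vIdeal hmZ))
    · exact x_mem_vIdeal
    · exact var_mem_vIdeal hl
  · rw [vIdeal_le]
    exact ⟨Ideal.mem_map_of_mem _ (Ideal.mem_sup_right (Ideal.mem_span_singleton_self _)),
      fun l hl ↦ Ideal.mem_map_of_mem _ (hmem _ (X_mem_varIdeal.mpr (by simp [hl])))⟩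

/-- All three relations collapse and the quotient is the power series ring in the variables other
than `x`, `y` and those in `Z`. -/
theorem vwIdeal_isPrime (hP : ∃ l ∈ P, l ∈ Z) :
    (vwIdeal K i k B D P Z).IsPrime ∧
      ∀ f, of K i k B D P f ∈ vwIdeal K i k B D P Z → f ∈ varIdeal K (insert k (insert i Z)) := by
  let J : Ideal (MvPowerSeries σ K)[X] :=
    (varIdeal K (insert k (insert i Z))).map C ⊔ Ideal.span {X}
  have hJ : J.IsPrime := isPrime_map_C_sup_X _
  have hmem : ∀ f ∈ varIdeal K (insert k (insert i Z)),
      C (C f) ∈ (J.map C ⊔ Ideal.span {X} : Ideal (MvPowerSeries σ K)[X][X]) := fun f hf ↦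
    Ideal.mem_sup_left (Ideal.mem_map_of_mem _ (Ideal.mem_sup_left (Ideal.mem_map_of_mem _ hf)))
  have hX : C X ∈ (J.map C ⊔ Ideal.span {X} : Ideal (MvPowerSeries σ K)[X][X]) :=
    Ideal.mem_sup_left (Ideal.mem_map_of_mem _ (Ideal.mem_sup_right
      (Ideal.mem_span_singleton_self _)))
  have hX' : X ∈ (J.map C ⊔ Ideal.span {X} : Ideal (MvPowerSeries σ K)[X][X]) :=
    Ideal.mem_sup_right (Ideal.mem_span_singleton_self _)
  obtain ⟨l, hl, hlZ⟩ := hP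
  have hv : v K i k B D P ∈ vwIdeal K i k B D P Z := Ideal.subset_span (by simp)
  have hw : w K i k B D P ∈ vwIdeal K i k B D P Z := Ideal.subset_span (by simp)
  have := isPrime_of_comap (i := i) (B := B) (P := P) (D := D) (k := k)
    (I := vwIdeal K i k B D P Z) (isPrime_map_C_sup_X J) ?_ ?_ ?_
  · exact ⟨this.1, fun f hf ↦ C_mem_of_map_C_sup_X (C_mem_of_map_C_sup_X (this.2 _ hf))⟩
  · apply chartIdeal_le
    · rw [C_sub, C_mul]
      exact sub_mem (Ideal.mul_mem_left _ _ hX) (hmem _ (X_mem_varIdeal.mpr (by simp)))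
    · exact sub_mem (Ideal.mul_mem_left _ _ hX') (hmem _ (X_mem_varIdeal.mpr (by simp)))
    · exact sub_mem (Ideal.mul_mem_left _ _ hX') (hmem _ (prodX_mem hl (by simp [hlZ])))
  · rw [sup_le_iff, Ideal.map_le_iff_le_comap, sup_le_iff, Ideal.map_le_iff_le_comap, varIdeal,
      Ideal.span_le, Ideal.span_singleton_le_iff_mem, Ideal.span_singleton_le_iff_mem]
    refine ⟨⟨?_, hw⟩, hv⟩
    rintro _ ⟨l, hl, rfl⟩
    change var K i k B D P l ∈ vwIdeal K i k B D P Z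
    obtain rfl | rfl | hl : l = k ∨ l = i ∨ l ∈ Z := by simpa using hl
    · rw [var_y]
      exact Ideal.mul_mem_right _ _ hw
    · rw [var_x]
      exact Ideal.mul_mem_right _ _ hv
    · exact (vwIdeal_le.mp le_rfl).2.2 _ hl
  · rw [vwIdeal_le]
    exact ⟨Ideal.mem_map_of_mem _ hX', Ideal.mem_map_of_mem _ hX,
      fun l hl ↦ Ideal.mem_map_of_mem _ (hmem _ (X_mem_varIdeal.mpr (by simp [hl])))⟩

theorem mem_varIdeal_univ {σ : Type*} [Fintype σ] (f : MvPowerSeries σ K)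
    (hf : MvPowerSeries.constantCoeff f = 0) : f ∈ varIdeal K (Finset.univ : Finset σ) := by
  classical
  refine mem_varIdeal_of_coeff _ _ fun n hn ↦ ?_
  have : n = 0 := by ext i; exact hn i (Finset.mem_univ i)
  rw [this]; simpa using hf

/-- The ideal is the kernel of the map onto `K` that takes constant coefficients and sends `v` and
`w` to zero. -/
theorem vwIdeal_isMaximal [Fintype σ] (hP : P.Nonempty) (hZ : insert k (insert i Z) = Finset.univ)
    : (vwIdeal K i k B D P Z).IsMaximal := by
  have hprod : MvPowerSeries.constantCoeff (prodX K P) = 0 := by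
    obtain ⟨l, hl⟩ := hP
    rw [map_prod]
    exact Finset.prod_eq_zero hl (by simp)
  let κ : MonChart K i k B D P →+* K := ChartRing.lift MvPowerSeries.constantCoeff 0 0
    (by simp) (by simp) (by rw [hprod, mul_zero])
  have hκ : Function.Surjective κ := fun a ↦ ⟨of K i k B D P (MvPowerSeries.C a), by
    simp [κ, of]⟩
  have := RingHom.ker_isMaximal_of_surjective κ hκ
  have hle : vwIdeal K i k B D P Z ≤ RingHom.ker κ := by
    rw [vwIdeal_le]
    refine ⟨by simp [κ, v], by simp [κ, w], fun l _ ↦ by simp [κ, var, of]⟩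
  have hge : RingHom.ker κ ≤ vwIdeal K i k B D P Z := by
    intro a ha
    obtain ⟨hv, hw, hz⟩ := vwIdeal_le.mp (le_refl (vwIdeal K i k B D P Z))
    obtain ⟨m, s, t, rfl⟩ := ChartRing.exists_eq a
    have hm : m ∈ varIdeal K (Finset.univ : Finset σ) := by
      apply mem_varIdeal_univ
      simpa [κ] using ha
    refine add_mem (add_mem ?_ (Ideal.mul_mem_right _ _ hv)) (Ideal.mul_mem_right _ _ hw)
    have : varIdeal K (Finset.univ : Finset σ) ≤
        (vwIdeal K i k B D P Z).comap (of K i k B D P) := by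
      rw [varIdeal, Ideal.span_le]
      rintro _ ⟨l, -, rfl⟩
      change var K i k B D P l ∈ vwIdeal K i k B D P Z
      obtain rfl | rfl | hl : l = k ∨ l = i ∨ l ∈ Z := by
        have := Finset.mem_univ l
        rw [← hZ] at this
        simpa using this
      · rw [var_y]
        exact Ideal.mul_mem_right _ _ hw
      · rw [var_x]
        exact Ideal.mul_mem_right _ _ hv
      · exact hz _ hl
    exact this hm
  rwa [le_antisymm hle hge]

end MonChart

end MonChart

/-! ### Exchange of `x` and `y`, and nonzerodivisors of a chart -/

section MonChart

set_option linter.unusedSectionVars false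

open Polynomial

variable {σ : Type*} [DecidableEq σ] {K : Type*} [Field K]
variable {i k j : σ} {B D P Z U : Finset σ}

namespace MonChart

theorem swap_wIdeal : (wIdeal K i k B D P Z) =
    (vIdeal K k i D B P Z).comap (ChartRing.swap _ _ _ _ _ : MonChart K i k B D P ≃+* _) := by
  rw [← Ideal.map_symm, vIdeal, Ideal.map_span, wIdeal, Set.image_insert_eq, Set.image_image]
  have h1 : (ChartRing.swap _ _ _ _ _ : MonChart K i k B D P ≃+* _).symm (v K k i D B P) =
      w K i k B D P := by rw [RingEquiv.symm_apply_eq]; exact ChartRing.swap_w.symm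
  have h2 : ∀ l, (ChartRing.swap _ _ _ _ _ : MonChart K i k B D P ≃+* _).symm (var K k i D B P l) =
      var K i k B D P l := fun l ↦ by
    rw [RingEquiv.symm_apply_eq]; exact (ChartRing.swap_of _).symm
  simp only [h1, h2]

theorem swap_span_var : Ideal.span {var K i k B D P j} = (Ideal.span {var K k i D B P j}).comap
    (ChartRing.swap _ _ _ _ _ : MonChart K i k B D P ≃+* _) := by
  rw [← Ideal.map_symm, Ideal.map_span, Set.image_singleton]
  congr 2
  rw [RingEquiv.eq_symm_apply]
  exact ChartRing.swap_of _

theorem wIdeal_isPrime (h : Separated i k B D P) (hP : ∃ l ∈ P, l ∈ Z) (hB : Disjoint B Z)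
    (hi : i ∉ Z) : (wIdeal K i k B D P Z).IsPrime ∧
      (∀ f, of K i k B D P f ∈ wIdeal K i k B D P Z → f ∈ varIdeal K (insert k Z)) ∧
      v K i k B D P ∉ wIdeal K i k B D P Z := by
  obtain ⟨h1, h2, h3⟩ := vIdeal_isPrime (K := K) h.symm hP hB hi
  rw [swap_wIdeal]
  refine ⟨inferInstance, fun f hf ↦ h2 f ?_, fun hv ↦ h3 ?_⟩
  · rwa [Ideal.mem_comap, of, ChartRing.swap_of] at hf
  · rwa [Ideal.mem_comap, v, ChartRing.swap_v] at hv

theorem wIdeal_isPrime' (h : Separated i k B D P) (hP : ∃ l ∈ P, l ∈ Z) (hB : ∃ l ∈ B, l ∈ Z) :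
    (wIdeal K i k B D P Z).IsPrime ∧ v K i k B D P ∉ wIdeal K i k B D P Z := by
  obtain ⟨h1, h3⟩ := vIdeal_isPrime' (K := K) h.symm hP hB
  rw [swap_wIdeal]
  refine ⟨inferInstance, fun hv ↦ h3 ?_⟩
  rwa [Ideal.mem_comap, v, ChartRing.swap_v] at hv

theorem span_var_isPrime_of_mem_right (h : Separated i k B D P) (hj : j ∈ D) :
    (Ideal.span {var K i k B D P j}).IsPrime ∧
    ∀ f, of K i k B D P f ∈ Ideal.span {var K i k B D P j} → f ∈ varIdeal K {j, k} := by
  obtain ⟨h1, h2⟩ := span_var_isPrime_of_mem_left (K := K) h.symm hj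
  rw [swap_span_var]
  refine ⟨inferInstance, fun f hf ↦ h2 f ?_⟩
  rwa [Ideal.mem_comap, of, ChartRing.swap_of] at hf

theorem sup_span_mul_sub {R : Type*} [CommRing R] {I : Ideal R} {b : R} (hb : b ∈ I) (s t : R) :
    I ⊔ Ideal.span {b * s - t} = I ⊔ Ideal.span {t} := by
  apply le_antisymm <;> rw [sup_le_iff, Ideal.span_singleton_le_iff_mem] <;>
    refine ⟨le_sup_left, ?_⟩
  · exact sub_mem (Ideal.mem_sup_left (Ideal.mul_mem_right _ _ hb))
      (Ideal.mem_sup_right (Ideal.mem_span_singleton_self _))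
  · have : b * s - (b * s - t) ∈ I ⊔ Ideal.span {b * s - t} :=
      sub_mem (Ideal.mem_sup_left (Ideal.mul_mem_right _ _ hb))
        (Ideal.mem_sup_right (Ideal.mem_span_singleton_self _))
    rwa [sub_sub_self] at this

/-- The three relations are adjoined in turn. Each is regular modulo `u_j` and the earlier ones, so
by `IsRegularMod.swap` the variable `u_j` remains regular after it. -/
theorem isRegularMod_chartIdeal (h : Separated i k B D P) (hji : j ≠ i) (hjk : j ≠ k)
    (hjD : j ∉ D) (hj : j ∈ B ∨ j ∈ P) :
    IsRegularMod (chartIdeal (MvPowerSeries.X i : MvPowerSeries σ K) (MvPowerSeries.X k)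
      (prodX K B) (prodX K D) (prodX K P)) (C (C (MvPowerSeries.X j))) := by
  have hkZ : k ∉ ({j} : Finset σ) := by simp [hjk.symm]
  have hDZ : Disjoint D {j} := by simp [hjD]
  have hJ := yIdeal_isPrime (K := K) hkZ h.kD hDZ
  have hkZ' : k ∉ ({j, i} : Finset σ) := by simp [hjk.symm, h.ne.symm]
  have hDZ' : Disjoint D {j, i} := by simp [hjD, h.iD]
  have hJ' := yIdeal_isPrime (K := K) hkZ' h.kD hDZ'
  have exy : ∀ Z : Finset σ, yIdeal K (insert i Z) D k =
      yIdeal K Z D k ⊔ Ideal.span {C (MvPowerSeries.X i)} := by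
    intro Z
    rw [yIdeal, varIdeal_insert, Ideal.map_sup, Ideal.map_span, Set.image_singleton, sup_right_comm]
    rfl
  have ej : varIdeal K ({j} : Finset σ) = Ideal.span {MvPowerSeries.X j} := by simp [varIdeal]
  have ej' : yIdeal K {j} D k = Ideal.span {C (MvPowerSeries.X j)} ⊔
      Ideal.span {C (prodX K D) * X - C (MvPowerSeries.X k)} := by
    rw [yIdeal, ej, Ideal.map_span, Set.image_singleton]
  have hvj : (varIdeal K ({j} : Finset σ)).IsPrime := inferInstance
  have hvj1 : ((varIdeal K ({j} : Finset σ)).map (C : _ →+* (MvPowerSeries σ K)[X])).IsPrime :=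
    Ideal.isPrime_map_C_of_isPrime
  have hvj2 : (((varIdeal K ({j} : Finset σ)).map (C : _ →+* (MvPowerSeries σ K)[X])).map
    (C : _ →+* (MvPowerSeries σ K)[X][X])).IsPrime := Ideal.isPrime_map_C_of_isPrime
  set a1 : (MvPowerSeries σ K)[X][X] := C (C (prodX K B)) * X - C (C (MvPowerSeries.X i)) with ha1
  set a2 : (MvPowerSeries σ K)[X] := C (prodX K D) * X - C (MvPowerSeries.X k) with ha2
  set a3 : (MvPowerSeries σ K)[X][X] := C X * X - C (C (prodX K P)) with ha3
  set U : (MvPowerSeries σ K)[X][X] := C (C (MvPowerSeries.X j)) with hU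
  have s0 : IsRegularMod ⊥ U := by
    intro g hg
    have hU0 : U ≠ 0 := by
      intro h0
      rw [hU, C_eq_zero, C_eq_zero] at h0
      have : (MvPowerSeries.X j : MvPowerSeries σ K) ∈ varIdeal K (∅ : Finset σ) := by
        rw [h0]; exact zero_mem _
      simp [X_mem_varIdeal] at this
    rw [Ideal.mem_bot] at hg ⊢
    exact (mul_eq_zero.mp hg).resolve_left hU0
  have s1 : IsRegularMod (⊥ ⊔ Ideal.span {C a2}) U := by
    refine s0.swap ?_
    have : (⊥ ⊔ Ideal.span {U} : Ideal (MvPowerSeries σ K)[X][X]) =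
        ((varIdeal K ({j} : Finset σ)).map C).map C := by
      rw [bot_sup_eq, ej, Ideal.map_span, Ideal.map_span, Set.image_singleton, Set.image_singleton]
    rw [this]
    refine .of_isPrime hvj2 fun h2 ↦ ?_
    have h3 := Ideal.mem_map_C_iff.mp (Ideal.mem_map_C_iff.mp h2 0) 0
    rw [coeff_C_zero] at h3
    simp [ha2, X_mem_varIdeal, hjk.symm] at h3
  have e2 : ((⊥ ⊔ Ideal.span {C a2}) ⊔ Ideal.span {U} : Ideal (MvPowerSeries σ K)[X][X]) =
      (yIdeal K {j} D k).map C := by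
    rw [bot_sup_eq, ej', Ideal.map_sup, Ideal.map_span, Ideal.map_span, Set.image_singleton,
      Set.image_singleton, sup_comm]
  have s2 : IsRegularMod ((⊥ ⊔ Ideal.span {C a2}) ⊔ Ideal.span {a1}) U := by
    refine s1.swap ?_
    rw [e2]
    refine .of_isPrime Ideal.isPrime_map_C_of_isPrime fun h2 ↦ ?_
    have h3 := Ideal.mem_map_C_iff.mp h2 0
    simp only [ha1, coeff_sub, mul_coeff_zero, coeff_X_zero, mul_zero, coeff_C_zero, zero_sub,
      neg_mem_iff, C_mem_yIdeal hDZ, X_mem_varIdeal] at h3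
    simp [hji.symm] at h3
  have s3 : IsRegularMod (((⊥ ⊔ Ideal.span {C a2}) ⊔ Ideal.span {a1}) ⊔ Ideal.span {a3}) U := by
    refine s2.swap ?_
    rw [sup_right_comm, e2]
    -- If `u_j` divides `b`, the relation `b v - x` may be replaced by `x`, and the coefficient `w`
    -- of `v` in the last relation avoids the resulting prime. Otherwise `u_j` divides `p`, the last
    -- relation reduces to `v w`, and neither factor lies in the prime of the first two relations.
    by_cases hjB : j ∈ B
    · have e3 : (yIdeal K {j} D k).map C ⊔ Ideal.span {a1} = (yIdeal K {j, i} D k).map C := by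
        rw [Finset.pair_comm, exy, Ideal.map_sup, Ideal.map_span, Set.image_singleton]
        have hb : C (prodX K B) ∈ yIdeal K {j} D k :=
          C_mem_yIdeal_of_mem (prodX_mem hjB (Finset.mem_singleton_self j))
        exact sup_span_mul_sub (Ideal.mem_map_of_mem (C : _ →+* (MvPowerSeries σ K)[X][X]) hb) _ _
      rw [e3]
      refine .of_isPrime Ideal.isPrime_map_C_of_isPrime fun h2 ↦ ?_
      have h3 := Ideal.mem_map_C_iff.mp h2 1
      simp only [ha3, coeff_sub, coeff_C_mul, coeff_X_one, mul_one,
        coeff_C_succ, sub_zero] at h3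
      exact X_notMem_yIdeal hkZ' hDZ' h3
    · have hjP : j ∈ P := hj.resolve_left hjB
      have hbn : C (prodX K B) ∉ yIdeal K {j} D k := by
        rw [C_mem_yIdeal hDZ]
        exact prodX_notMem (by simp [hjB])
      have hxn : C (MvPowerSeries.X i) ∉ yIdeal K {j} D k := by
        rw [C_mem_yIdeal hDZ, X_mem_varIdeal]
        simp [hji.symm]
      have hreg : IsRegularMod (yIdeal K {j} D k ⊔ Ideal.span {C (prodX K B)})
          (C (MvPowerSeries.X i)) := by
        refine (IsRegularMod.of_isPrime hJ hxn).swap ?_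
        rw [← exy, Finset.pair_comm]
        refine .of_isPrime hJ' ?_
        rw [C_mem_yIdeal hDZ']
        exact prodX_notMem (by simp [hjB, h.iB])
      have hprime := isPrime_map_C_sup_linear hbn hreg
      refine .of_isPrime hprime fun h2 ↦ ?_
      have h3 : C (C (prodX K P)) ∈ (yIdeal K {j} D k).map C ⊔ Ideal.span {a1} :=
        Ideal.mem_sup_left (Ideal.mem_map_of_mem _ (C_mem_yIdeal_of_mem
          (prodX_mem hjP (by simp))))
      have h4 : C X * X ∈ (yIdeal K {j} D k).map C ⊔ Ideal.span {a1} := by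
        rw [← sub_add_cancel (C X * X) (C (C (prodX K P)))]
        exact add_mem h2 h3
      rcases hprime.mem_or_mem h4 with h5 | h5
      · exact X_notMem_yIdeal hkZ hDZ ((C_mem_of_linear hbn).1 _ h5)
      · exact hxn ((C_mem_of_linear hbn).2 h5)
  have : chartIdeal (MvPowerSeries.X i : MvPowerSeries σ K) (MvPowerSeries.X k)
      (prodX K B) (prodX K D) (prodX K P) =
      ((⊥ ⊔ Ideal.span {C a2}) ⊔ Ideal.span {a1}) ⊔ Ideal.span {a3} := by
    rw [chartIdeal, Ideal.span_insert, Ideal.span_insert, bot_sup_eq, sup_assoc]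
  rwa [this]

theorem var_mem_nonZeroDivisors (h : Separated i k B D P) (hj : j ∈ B ∨ j ∈ D ∨ j ∈ P) :
    var K i k B D P j ∈ nonZeroDivisors (MonChart K i k B D P) := by
  have main : ∀ {i k : σ} {B D P : Finset σ}, Separated i k B D P → j ∉ D → (j ∈ B ∨ j ∈ P) →
      ∀ a, var K i k B D P j * a = 0 → a = 0 := by
    intro i k B D P h hjD hj a ha
    have hji : j ≠ i := by rintro rfl; exact hj.elim h.iB h.iP
    have hjk : j ≠ k := by rintro rfl; exact hj.elim h.kB h.kP
    obtain ⟨a, rfl⟩ := ChartRing.mk_surjective _ _ _ _ _ a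
    rw [var, of, ChartRing.of_apply, ← map_mul, ← RingHom.mem_ker, ChartRing.ker_mk] at ha
    rw [← RingHom.mem_ker, ChartRing.ker_mk]
    exact isRegularMod_chartIdeal h hji hjk hjD hj a ha
  rw [mem_nonZeroDivisors_iff_right]
  intro a ha
  rw [mul_comm] at ha
  -- Exchanging `x` and `y` turns `D` into `B`, which settles the case left out of `main`.
  by_cases hjD : j ∈ D
  · have := main h.symm (Finset.disjoint_right.mp h.BD hjD) (Or.inl hjD)
      (ChartRing.swap _ _ _ _ _ a) (by
        have := congrArg (ChartRing.swap _ _ _ _ _) ha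
        rwa [map_mul, map_zero, var, of, ChartRing.swap_of] at this)
    simpa using this
  · exact main h hjD (by tauto) a ha

theorem of_prodX_mem_nonZeroDivisors (h : Separated i k B D P) {A : Finset σ}
    (hA : A ⊆ B ∪ D ∪ P) : of K i k B D P (prodX K A) ∈ nonZeroDivisors (MonChart K i k B D P) := by
  rw [of_prodX]
  refine Submonoid.prod_mem _ fun j hj ↦ var_mem_nonZeroDivisors h ?_
  simpa [or_assoc] using hA hj

/-- A divisor of the nonzerodivisor `p = v w`. -/
theorem v_mem_nonZeroDivisors (h : Separated i k B D P) :
    v K i k B D P ∈ nonZeroDivisors (MonChart K i k B D P) := by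
  have := of_prodX_mem_nonZeroDivisors (K := K) h (A := P)
    Finset.subset_union_right
  rw [← v_mul_w] at this
  exact (mul_mem_nonZeroDivisors.mp this).1

end MonChart

end MonChart

/-! ### Ideal sheaves on affine charts -/

/-- The ideal of `B` defined by the pullback of an ideal sheaf along `Spec B ⟶ X`. -/
def pullIdeal {X : Scheme.{u}} (I : X.IdealSheafData) {B : CommRingCat.{u}} (g : Spec B ⟶ X) :
    Ideal B :=
  ((I.comap g).ideal ⟨⊤, isAffineOpen_top _⟩).map (Scheme.ΓSpecIso B).hom.hom

/-- Both sides are values of lower adjoints, `comap` of `map` for ideal sheaves and `Ideal.map` of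
`Ideal.comap` for ideals; comparing the upper adjoints shows that they lie below the same ideals. -/
theorem ideal_comap_affine {X Y : Scheme.{u}} [IsAffine X] [IsAffine Y] (f : X ⟶ Y)
    (I : Y.IdealSheafData) : (I.comap f).ideal ⟨⊤, isAffineOpen_top _⟩ =
      (I.ideal ⟨⊤, isAffineOpen_top _⟩).map f.appTop.hom := by
  apply eq_of_forall_ge_iff
  intro L
  have h1 : ∀ (J : X.IdealSheafData), (I.comap f).ideal ⟨⊤, isAffineOpen_top _⟩ ≤
      J.ideal ⟨⊤, isAffineOpen_top _⟩ ↔ (I.ideal ⟨⊤, isAffineOpen_top _⟩).map f.appTop.hom ≤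
      J.ideal ⟨⊤, isAffineOpen_top _⟩ := by
    intro J
    rw [Ideal.map_le_iff_le_comap]
    have e := Scheme.IdealSheafData.ideal_map_of_isAffineHom J f ⟨⊤, isAffineOpen_top _⟩
    constructor
    · intro h
      have h2 := Scheme.IdealSheafData.le_map_iff_comap_le.mpr
        (Scheme.IdealSheafData.le_of_isAffine h)
      exact (h2 _).trans e.le
    · intro h
      have h2 : I ≤ J.map f := Scheme.IdealSheafData.le_of_isAffine (h.trans e.ge)
      exact Scheme.IdealSheafData.le_map_iff_comap_le.mp h2 _
  have := h1 (Scheme.IdealSheafData.equivOfIsAffine.symm L)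
  rwa [← Scheme.IdealSheafData.equivOfIsAffine_apply, ← Scheme.IdealSheafData.equivOfIsAffine_apply,
    OrderRingIso.apply_symm_apply] at this

theorem pullIdeal_comp {X : Scheme.{u}} (I : X.IdealSheafData) {A B : CommRingCat.{u}}
    (ψ : A ⟶ B) (g : Spec A ⟶ X) : pullIdeal I (Spec.map ψ ≫ g) = (pullIdeal I g).map ψ.hom := by
  rw [pullIdeal, Scheme.IdealSheafData.comap_comp, ideal_comap_affine, Ideal.map_map, pullIdeal,
    Ideal.map_map, ← CommRingCat.hom_comp, ← CommRingCat.hom_comp, Scheme.ΓSpecIso_naturality]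

theorem pullIdeal_comap {X Y : Scheme.{u}} (I : X.IdealSheafData) {A : CommRingCat.{u}}
    (f : Y ⟶ X) (g : Spec A ⟶ Y) : pullIdeal (I.comap f) g = pullIdeal I (g ≫ f) := by
  rw [pullIdeal, pullIdeal, Scheme.IdealSheafData.comap_comp]

/-- The sections over the image of an open immersion from an affine scheme. -/
def imageIso {X : Scheme.{u}} {B : CommRingCat.{u}} (g : Spec B ⟶ X) [IsOpenImmersion g] :
    Γ(X, g ''ᵁ ⊤) ≅ B :=
  g.appIso ⊤ ≪≫ Scheme.ΓSpecIso B

theorem pullIdeal_eq_map {X : Scheme.{u}} (I : X.IdealSheafData) {B : CommRingCat.{u}}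
    (g : Spec B ⟶ X) [IsOpenImmersion g] : pullIdeal I g =
      (I.ideal ⟨g ''ᵁ ⊤, (isAffineOpen_top _).image_of_isOpenImmersion g⟩).map
        (imageIso g).hom.hom := by
  rw [pullIdeal, Scheme.IdealSheafData.ideal_comap_of_isOpenImmersion I g
    ⟨⊤, isAffineOpen_top _⟩]
  have : Ideal.comap (g.appIso ⊤).inv.hom
      (I.ideal ⟨g ''ᵁ ⊤, (isAffineOpen_top _).image_of_isOpenImmersion g⟩) =
      Ideal.map (g.appIso ⊤).hom.hom
      (I.ideal ⟨g ''ᵁ ⊤, (isAffineOpen_top _).image_of_isOpenImmersion g⟩) :=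
    Ideal.comap_symm (g.appIso ⊤).commRingCatIsoToRingEquiv
  rw [this, Ideal.map_map, imageIso, Iso.trans_hom, CommRingCat.hom_comp]

theorem ringEquiv_mem_nonZeroDivisors {R R' : Type*} [CommRing R] [CommRing R'] (e : R ≃+* R')
    {a : R} (ha : a ∈ nonZeroDivisors R) : e a ∈ nonZeroDivisors R' := by
  rw [mem_nonZeroDivisors_iff_right] at ha ⊢
  intro z hz
  have := ha (e.symm z) (e.injective (by simpa using hz))
  simpa using this

/-- Trades affine opens for open immersions from spectra, the form in which the charts of a blowup
are given. -/
theorem isEffectiveCartier_iff {X : Scheme.{u}} {I : X.IdealSheafData} :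
    IsEffectiveCartier I ↔ ∀ p : X, ∃ (B : CommRingCat.{u}) (g : Spec B ⟶ X),
      IsOpenImmersion g ∧ p ∈ Set.range g ∧ ∃ a ∈ nonZeroDivisors B, pullIdeal I g = .span {a} := by
  refine forall_congr' fun p ↦ ⟨?_, ?_⟩
  · rintro ⟨U, hp, h⟩
    have := U.2.isOpenImmersion_fromSpec
    refine ⟨_, U.2.fromSpec, inferInstance, by rwa [U.2.range_fromSpec], ?_⟩
    have e : U = ⟨U.2.fromSpec ''ᵁ ⊤, (isAffineOpen_top _).image_of_isOpenImmersion _⟩ :=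
      Subtype.ext (by simpa using U.2.opensRange_fromSpec.symm)
    have key : ∀ U' : X.affineOpens, U = U' → ∃ a ∈ nonZeroDivisors Γ(X, U'.1),
        I.ideal U' = Ideal.span {a} := by
      rintro _ rfl; exact h
    obtain ⟨a, ha, h'⟩ := key _ e
    refine ⟨(imageIso U.2.fromSpec).hom.hom a, ?_, ?_⟩
    · exact ringEquiv_mem_nonZeroDivisors (imageIso U.2.fromSpec).commRingCatIsoToRingEquiv ha
    · rw [pullIdeal_eq_map, h', Ideal.map_span, Set.image_singleton]
  · rintro ⟨B, g, hg, hp, a, ha, h⟩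
    refine ⟨⟨g ''ᵁ ⊤, (isAffineOpen_top _).image_of_isOpenImmersion g⟩, by simpa using hp,
      (imageIso g).inv.hom a, ?_, ?_⟩
    · exact ringEquiv_mem_nonZeroDivisors (imageIso g).symm.commRingCatIsoToRingEquiv ha
    · rw [pullIdeal_eq_map] at h
      have := congrArg (Ideal.map (imageIso g).inv.hom) h
      rwa [Ideal.map_map, ← CommRingCat.hom_comp, Iso.hom_inv_id, CommRingCat.hom_id, Ideal.map_id,
        Ideal.map_span, Set.image_singleton] at this

/-- The pulled back ideal is radical and its zero locus is the trace of `Z`, so it is the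
intersection of the primes in that trace. -/
theorem mem_pullIdeal_vanishingIdeal {X : Scheme.{u}} (Z : TopologicalSpace.Closeds X)
    {B : CommRingCat.{u}} (g : Spec B ⟶ X) [IsOpenImmersion g] (a : B) :
    a ∈ pullIdeal (Scheme.IdealSheafData.vanishingIdeal Z) g ↔
      ∀ q : Spec B, g q ∈ Z → a ∈ PrimeSpectrum.asIdeal q := by
  have hrad : (pullIdeal (Scheme.IdealSheafData.vanishingIdeal Z) g).IsRadical := by
    rw [pullIdeal_eq_map, Scheme.IdealSheafData.vanishingIdeal_ideal]
    have := Ideal.comap_symm (imageIso g).commRingCatIsoToRingEquiv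
      (I := PrimeSpectrum.vanishingIdeal (((isAffineOpen_top _).image_of_isOpenImmersion
        g).fromSpec ⁻¹' (Z : Set X)))
    exact this ▸ (PrimeSpectrum.isRadical_vanishingIdeal _).comap _
  have hz : ∀ q : Spec B, g q ∈ Z ↔
      pullIdeal (Scheme.IdealSheafData.vanishingIdeal Z) g ≤ PrimeSpectrum.asIdeal q := by
    intro q
    have h1 : q ∈ ((Scheme.IdealSheafData.vanishingIdeal Z).comap g).support ↔ g q ∈ Z := by
      rw [Scheme.IdealSheafData.support_comap]
      change g q ∈ (Scheme.IdealSheafData.vanishingIdeal Z).support ↔ _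
      rw [← SetLike.mem_coe, Scheme.IdealSheafData.coe_support_vanishingIdeal]
      rfl
    rw [← h1, Scheme.IdealSheafData.mem_support_iff_of_mem (U := ⟨⊤, isAffineOpen_top _⟩)
      (Set.mem_univ q), Spec_zeroLocus, pullIdeal,
      show Ideal.map (Scheme.ΓSpecIso B).hom.hom _ = Ideal.comap (Scheme.ΓSpecIso B).inv.hom _ from
        (Ideal.comap_symm (Scheme.ΓSpecIso B).commRingCatIsoToRingEquiv).symm]
    rfl
  rw [← hrad.radical, ← PrimeSpectrum.vanishingIdeal_zeroLocus_eq_radical,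
    PrimeSpectrum.mem_vanishingIdeal]
  exact forall_congr' fun q ↦ imp_congr_left (hz q).symm

theorem localization_mem_nonZeroDivisors {R : Type*} [CommRing R] (f : R) {a : R}
    (ha : a ∈ nonZeroDivisors R) :
    algebraMap R (Localization.Away f) a ∈ nonZeroDivisors (Localization.Away f) :=
  IsLocalization.map_nonZeroDivisors_le (Submonoid.powers f) _ ⟨a, ha, rfl⟩

theorem SpecMap_apply_asIdeal {A B : CommRingCat.{u}} (f : A ⟶ B) (q : Spec B) :
    PrimeSpectrum.asIdeal (Spec.map f q) = (PrimeSpectrum.asIdeal q).comap f.hom := rfl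

theorem range_SpecMap_away {A : CommRingCat.{u}} (f : A) :
    Set.range (Spec.map (CommRingCat.ofHom (algebraMap A (Localization.Away f)))) =
      {q : Spec A | f ∉ PrimeSpectrum.asIdeal q} :=
  PrimeSpectrum.localization_away_comap_range (Localization.Away f) f

/-- Every point of an open subset of an affine scheme has a basic open neighbourhood. -/
theorem exists_away {A : CommRingCat.{u}} (q : Spec A) (U : Set (Spec A)) (hU : IsOpen U)
    (hq : q ∈ U) : ∃ f : A, f ∉ PrimeSpectrum.asIdeal q ∧
      ∀ q' : Spec A, f ∉ PrimeSpectrum.asIdeal q' → q' ∈ U := by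
  obtain ⟨_, ⟨f, rfl⟩, h1, h2⟩ :=
    PrimeSpectrum.isTopologicalBasis_basic_opens.exists_subset_of_mem_open hq hU
  exact ⟨f, h1, fun q' h ↦ h2 h⟩

/-- The inclusion of a basic open subset. -/
abbrev awayMap {A : CommRingCat.{u}} (f : A) : A ⟶ CommRingCat.of (Localization.Away f) :=
  CommRingCat.ofHom (algebraMap A (Localization.Away f))

instance {A : CommRingCat.{u}} (f : A) : IsOpenImmersion (Spec.map (awayMap f)) :=
  IsOpenImmersion.of_isLocalization f

theorem exists_affine_chart {X' X : Scheme.{u}} (b : X' ⟶ X) {I : X.IdealSheafData}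
    (hI : IsEffectiveCartier (I.comap b)) {A : CommRingCat.{u}} (ι : Spec A ⟶ X)
    [IsOpenImmersion ι] (p : X') (hp : b p ∈ Set.range ι) :
    ∃ (C : CommRingCat.{u}) (θ : A ⟶ C) (w : Spec C ⟶ X'), IsOpenImmersion w ∧ p ∈ Set.range w ∧
      w ≫ b = Spec.map θ ≫ ι ∧ ∃ a ∈ nonZeroDivisors C, (pullIdeal I ι).map θ.hom = .span {a} := by
  obtain ⟨B, g, hg, ⟨q, rfl⟩, a, ha, h⟩ := isEffectiveCartier_iff.mp hI p
  obtain ⟨f, hf, hfU⟩ := exists_away q ((g ≫ b) ⁻¹' Set.range ι)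
    (ι.isOpenEmbedding.isOpen_range.preimage (g ≫ b).continuous) (by simpa using hp)
  have hr : Set.range ((Spec.map (awayMap f) ≫ g) ≫ b) ⊆ Set.range ι := by
    rintro _ ⟨z, rfl⟩
    have h1 : Spec.map (awayMap f) z ∈ Set.range (Spec.map (awayMap f)) := ⟨z, rfl⟩
    rw [range_SpecMap_away] at h1
    simpa using hfU _ h1
  obtain ⟨θ, hθ⟩ := Spec.map_surjective (IsOpenImmersion.lift ι _ hr)
  have e : (Spec.map (awayMap f) ≫ g) ≫ b = Spec.map θ ≫ ι := by
    rw [hθ, IsOpenImmersion.lift_fac]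
  refine ⟨_, θ, Spec.map (awayMap f) ≫ g, inferInstance, ?_, e, _,
    localization_mem_nonZeroDivisors f ha, ?_⟩
  · have : q ∈ Set.range (Spec.map (awayMap f)) := by rw [range_SpecMap_away]; exact hf
    obtain ⟨z, rfl⟩ := this
    exact ⟨z, by simp⟩
  · rw [← pullIdeal_comp, ← e, Category.assoc, pullIdeal_comp, ← pullIdeal_comap, h, Ideal.map_span,
      Set.image_singleton]
    rfl

/-- If `(s, t) = (a)` with `a` a nonzerodivisor, `s = s' a` and `t = t' a`, then `s'` and `t'`
generate the unit ideal, so one of them is invertible near the given point. This is the affine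
source of the two standard charts. -/
theorem exists_affine_chart_of_pair {X' X : Scheme.{u}} (b : X' ⟶ X) {I : X.IdealSheafData}
    (hI : IsEffectiveCartier (I.comap b)) {A : CommRingCat.{u}} (ι : Spec A ⟶ X)
    [IsOpenImmersion ι] {s t : A} (hst : pullIdeal I ι = .span {s, t}) (p : X')
    (hp : b p ∈ Set.range ι) :
    ∃ (C : CommRingCat.{u}) (θ : A ⟶ C) (w : Spec C ⟶ X'), IsOpenImmersion w ∧ p ∈ Set.range w ∧
      w ≫ b = Spec.map θ ≫ ι ∧ ((θ.hom s ∈ nonZeroDivisors C ∧ θ.hom s ∣ θ.hom t) ∨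
        (θ.hom t ∈ nonZeroDivisors C ∧ θ.hom t ∣ θ.hom s)) := by
  obtain ⟨C, θ, w, hw, ⟨z, rfl⟩, e, a, ha, h⟩ := exists_affine_chart b hI ι p hp
  rw [hst, Ideal.map_span, Set.image_pair] at h
  have hs : θ.hom s ∈ Ideal.span {a} := h ▸ Ideal.subset_span (by simp)
  have ht : θ.hom t ∈ Ideal.span {a} := h ▸ Ideal.subset_span (by simp)
  have ha' : a ∈ Ideal.span {θ.hom s, θ.hom t} := h ▸ Ideal.mem_span_singleton_self a
  obtain ⟨s', hs'⟩ := Ideal.mem_span_singleton'.mp hs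
  obtain ⟨t', ht'⟩ := Ideal.mem_span_singleton'.mp ht
  obtain ⟨α, β, hαβ⟩ := Ideal.mem_span_pair.mp ha'
  have h1 : α * s' + β * t' = 1 := by
    rw [mem_nonZeroDivisors_iff_right] at ha
    refine sub_eq_zero.mp (ha _ ?_)
    rw [← hs', ← ht'] at hαβ
    linear_combination hαβ
  have key : ∀ c : C, c ∉ PrimeSpectrum.asIdeal z → ∃ z', (Spec.map (awayMap c) ≫ w) z' = w z := by
    intro c hc
    have : z ∈ Set.range (Spec.map (awayMap c)) := by rw [range_SpecMap_away]; exact hc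
    obtain ⟨z', rfl⟩ := this
    exact ⟨z', by simp⟩
  have key2 : ∀ {s t s' t' : C}, s' * a = s → t' * a = t →
      (awayMap s').hom s ∈ nonZeroDivisors _ ∧ (awayMap s').hom s ∣ (awayMap s').hom t := by
    rintro _ _ s' t' rfl rfl
    have hu : IsUnit ((awayMap s').hom s') := IsLocalization.Away.algebraMap_isUnit s'
    constructor
    · rw [map_mul]
      exact mul_mem hu.mem_nonZeroDivisors (localization_mem_nonZeroDivisors _ ha)
    · rw [map_mul, map_mul, hu.mul_left_dvd]
      exact dvd_mul_left _ _
  by_cases hz : s' ∈ PrimeSpectrum.asIdeal z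
  · have hz' : t' ∉ PrimeSpectrum.asIdeal z := fun hz' ↦
      (PrimeSpectrum.isPrime z).ne_top ((Ideal.eq_top_iff_one _).mpr
        (h1 ▸ add_mem (Ideal.mul_mem_left _ _ hz) (Ideal.mul_mem_left _ _ hz')))
    refine ⟨_, θ ≫ awayMap t', Spec.map (awayMap t') ≫ w, inferInstance, key _ hz', ?_, .inr ?_⟩
    · rw [Category.assoc, e, Spec.map_comp, Category.assoc]
    · exact key2 ht' hs'
  · refine ⟨_, θ ≫ awayMap s', Spec.map (awayMap s') ≫ w, inferInstance, key _ hz, ?_, .inl ?_⟩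
    · rw [Category.assoc, e, Spec.map_comp, Category.assoc]
    · exact key2 hs' ht'

/-! ### Affine charts of a blowup, from its universal property -/

theorem isEffectiveCartier_comap_of_pullIdeal {X : Scheme.{u}} {I : X.IdealSheafData}
    {C : CommRingCat.{u}} (g : Spec C ⟶ X) {a : C} (ha : a ∈ nonZeroDivisors C)
    (h : pullIdeal I g = .span {a}) : IsEffectiveCartier (I.comap g) :=
  isEffectiveCartier_iff.mpr fun p ↦ ⟨C, 𝟙 _, inferInstance, ⟨p, rfl⟩, a, ha, by
    rw [pullIdeal_comap, Category.id_comp, h]⟩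

theorem nonZeroDivisors_of_isOpenImmersion {A B : CommRingCat.{u}} (f : A ⟶ B)
    [IsOpenImmersion (Spec.map f)] {a : A} (ha : a ∈ nonZeroDivisors A) :
    f.hom a ∈ nonZeroDivisors B := by
  have hf : Flat (Spec.map f) := inferInstance
  rw [Flat.SpecMap_iff] at hf
  algebraize [f.hom]
  rw [mem_nonZeroDivisors_iff_right] at ha ⊢
  intro z hz
  have h1 : IsSMulRegular A a := fun x y hxy ↦ by
    refine sub_eq_zero.mp (ha _ ?_)
    simp only [smul_eq_mul] at hxy
    linear_combination hxy
  have h2 : IsSMulRegular B (algebraMap A B a) := h1.of_flat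
  refine h2 (?_ : _ • z = _ • 0)
  rw [smul_zero, smul_eq_mul, mul_comm]; exact hz

/-- `ψ : A ⟶ A'` is a chart of the blowup of the ideal `(s, t)`: the one where `s` generates. -/
structure IsBlowupChart {A A' : CommRingCat.{u}} (ψ : A ⟶ A') (s t : A) : Prop where
  mem : ψ.hom s ∈ nonZeroDivisors A'
  dvd : ψ.hom s ∣ ψ.hom t
  exists_lift : ∀ ⦃C : CommRingCat.{u}⦄ (θ : A ⟶ C), θ.hom s ∈ nonZeroDivisors C →
    θ.hom s ∣ θ.hom t → ∃ θ' : A' ⟶ C, ψ ≫ θ' = θ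
  hom_ext : ∀ ⦃C : CommRingCat.{u}⦄ (θ₁ θ₂ : A' ⟶ C), θ₁.hom (ψ.hom s) ∈ nonZeroDivisors C →
    ψ ≫ θ₁ = ψ ≫ θ₂ → θ₁ = θ₂

theorem span_pair_eq_of_dvd {R : Type*} [CommRing R] {s t : R} (h : s ∣ t) :
    Ideal.span {s, t} = Ideal.span {s} := by
  rw [Ideal.span_insert, sup_eq_left, Ideal.span_singleton_le_span_singleton]
  exact h

theorem hom_ext_of_affine {Y Z : Scheme.{u}} {f g : Y ⟶ Z}
    (h : ∀ (E : CommRingCat.{u}) (k : Spec E ⟶ Y), IsOpenImmersion k → k ≫ f = k ≫ g) : f = g :=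
  Scheme.Cover.hom_ext Y.affineCover _ _ fun i ↦ h _ _ (Y.affineCover.map_prop i)

section Chart

variable {X' X : Scheme.{u}} {b : X' ⟶ X} {I : X.IdealSheafData} {A A' : CommRingCat.{u}}
  {ι : Spec A ⟶ X} {s t : A} {ψ : A ⟶ A'} {ι' : Spec A' ⟶ X'}

theorem pullIdeal_chart (hst : pullIdeal I ι = .span {s, t}) {C : CommRingCat.{u}} (θ : A ⟶ C)
    (hd : θ.hom s ∣ θ.hom t) : pullIdeal I (Spec.map θ ≫ ι) = .span {θ.hom s} := by
  rw [pullIdeal_comp, hst, Ideal.map_span, Set.image_pair, span_pair_eq_of_dvd hd]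

theorem IsBlowup.hom_ext (hb : IsBlowup b I) {C : CommRingCat.{u}} {h₁ h₂ : Spec C ⟶ X'}
    (e : h₁ ≫ b = h₂ ≫ b) {a : C} (ha : a ∈ nonZeroDivisors C)
    (h : pullIdeal I (h₁ ≫ b) = .span {a}) : h₁ = h₂ :=
  (hb.2 _ (isEffectiveCartier_comap_of_pullIdeal _ ha h)).unique rfl e.symm

theorem IsBlowup.exists_factor (hb : IsBlowup b I) (hst : pullIdeal I ι = .span {s, t})
    (hψ : IsBlowupChart ψ s t) (hι' : ι' ≫ b = Spec.map ψ ≫ ι) {C : CommRingCat.{u}} {θ : A ⟶ C}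
    {w : Spec C ⟶ X'} (hw : w ≫ b = Spec.map θ ≫ ι) (hs : θ.hom s ∈ nonZeroDivisors C)
    (hd : θ.hom s ∣ θ.hom t) : ∃ θ' : A' ⟶ C, ψ ≫ θ' = θ ∧ Spec.map θ' ≫ ι' = w := by
  obtain ⟨θ', rfl⟩ := hψ.exists_lift θ hs hd
  refine ⟨θ', rfl, (hb.hom_ext ?_ hs ?_).symm⟩
  · rw [hw, Category.assoc, hι', Spec.map_comp, Category.assoc]
  · rw [hw, pullIdeal_chart hst _ hd]

/-- The universal property yields `ι'` but not its openness. An open piece `w` of the blowup on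
which `s` generates factors through `ι'`; over that piece the factorization is inverse to the lift
of `ι'` to `w`, so there `ι'` is `w` up to isomorphism. -/
theorem IsBlowup.isOpenImmersion_preimage (hb : IsBlowup b I) [IsOpenImmersion ι]
    (hst : pullIdeal I ι = .span {s, t})
    (hψ : IsBlowupChart ψ s t) (hι' : ι' ≫ b = Spec.map ψ ≫ ι) {C : CommRingCat.{u}} {θ : A ⟶ C}
    {w : Spec C ⟶ X'} [IsOpenImmersion w] (hw : w ≫ b = Spec.map θ ≫ ι)
    (hs : θ.hom s ∈ nonZeroDivisors C) (hd : θ.hom s ∣ θ.hom t) :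
    IsOpenImmersion ((ι' ⁻¹ᵁ w.opensRange).ι ≫ ι') := by
  obtain ⟨θ', rfl, rfl⟩ := hb.exists_factor hst hψ hι' hw hs hd
  set G := ι' ⁻¹ᵁ (Spec.map θ' ≫ ι').opensRange with hG
  have hr : Set.range (G.ι ≫ ι') ⊆ Set.range (Spec.map θ' ≫ ι') := by
    rintro _ ⟨z, rfl⟩
    exact z.2
  have hr' : Set.range (Spec.map θ') ⊆ Set.range G.ι := by
    rintro _ ⟨z, rfl⟩
    rw [Scheme.Opens.range_ι]
    exact ⟨z, rfl⟩
  let l : G.toScheme ⟶ Spec C := IsOpenImmersion.lift (Spec.map θ' ≫ ι') (G.ι ≫ ι') hr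
  let m : Spec C ⟶ G.toScheme := IsOpenImmersion.lift G.ι (Spec.map θ') hr'
  have hl : l ≫ Spec.map θ' ≫ ι' = G.ι ≫ ι' := IsOpenImmersion.lift_fac _ _ _
  have hm : m ≫ G.ι = Spec.map θ' := IsOpenImmersion.lift_fac _ _ _
  have hlG : l ≫ Spec.map θ' = G.ι := by
    refine hom_ext_of_affine fun E f hf ↦ ?_
    obtain ⟨ρ₁, hρ₁⟩ := Spec.map_surjective (f ≫ l ≫ Spec.map θ')
    obtain ⟨ρ₂, hρ₂⟩ := Spec.map_surjective (f ≫ G.ι)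
    rw [← hρ₁, ← hρ₂]
    -- By flatness `s` stays a nonzerodivisor after `ρ₂`, as the uniqueness clause `hψ.hom_ext`
    -- requires.
    have : IsOpenImmersion (Spec.map ρ₂) := hρ₂ ▸ inferInstance
    have e : ψ ≫ ρ₂ = ψ ≫ ρ₁ := by
      apply Spec.map_injective
      rw [← cancel_mono ι, Spec.map_comp, Spec.map_comp, Category.assoc, Category.assoc, ← hι',
        hρ₁, hρ₂]
      simp only [Category.assoc]
      rw [← reassoc_of% hl]
    rw [hψ.hom_ext ρ₂ ρ₁ (nonZeroDivisors_of_isOpenImmersion ρ₂ hψ.mem) e]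
  have hml : m ≫ l = 𝟙 _ := by
    rw [← cancel_mono (Spec.map θ' ≫ ι'), Category.assoc, hl, reassoc_of% hm, Category.id_comp]
  have hlm : l ≫ m = 𝟙 _ := by
    rw [← cancel_mono G.ι, Category.assoc, hm, hlG, Category.id_comp]
  have : IsIso l := ⟨m, hlm, hml⟩
  rw [← hl]
  infer_instance

/-- A piece around `ι' q` on which `t` generates has `s = t s'`, while `s` divides `t` on the chart
`A'`. So `s'` is invertible at `q`, and the piece can be shrunk to one on which `s` generates. -/
theorem IsBlowup.exists_chart_at (hb : IsBlowup b I) [IsOpenImmersion ι]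
    (hst : pullIdeal I ι = .span {s, t})
    (hψ : IsBlowupChart ψ s t) (hι' : ι' ≫ b = Spec.map ψ ≫ ι) (q : Spec A') :
    ∃ (C : CommRingCat.{u}) (θ : A ⟶ C) (w : Spec C ⟶ X'), IsOpenImmersion w ∧
      ι' q ∈ Set.range w ∧ w ≫ b = Spec.map θ ≫ ι ∧
      θ.hom s ∈ nonZeroDivisors C ∧ θ.hom s ∣ θ.hom t := by
  have hq : b (ι' q) ∈ Set.range ι := by
    rw [← Scheme.Hom.comp_apply, hι']
    exact ⟨Spec.map ψ q, by simp⟩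
  obtain ⟨C, θ, w, hw, ⟨z, hz⟩, e, ⟨h1, h2⟩ | ⟨h1, h2⟩⟩ :=
    exists_affine_chart_of_pair b hb.1 ι hst (ι' q) hq
  · exact ⟨C, θ, w, hw, ⟨z, hz⟩, e, h1, h2⟩
  obtain ⟨s', hs'⟩ := h2
  obtain ⟨f, hf, hfU⟩ := exists_away q (ι' ⁻¹' Set.range w)
    (w.isOpenEmbedding.isOpen_range.preimage ι'.continuous) ⟨z, hz⟩
  obtain ⟨q', hq'⟩ : q ∈ Set.range (Spec.map (awayMap f)) := by
    rw [range_SpecMap_away]; exact hf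
  have hr : Set.range (Spec.map (awayMap f) ≫ ι') ⊆ Set.range w := by
    rintro _ ⟨z, rfl⟩
    have h1 : Spec.map (awayMap f) z ∈ Set.range (Spec.map (awayMap f)) := ⟨z, rfl⟩
    rw [range_SpecMap_away] at h1
    simpa using hfU _ h1
  obtain ⟨l, hl⟩ := Spec.map_surjective (IsOpenImmersion.lift w _ hr)
  have hl' : Spec.map l ≫ w = Spec.map (awayMap f) ≫ ι' := by
    rw [hl, IsOpenImmersion.lift_fac]
  have hz' : Spec.map l q' = z := by
    apply w.isOpenEmbedding.injective
    rw [hz, ← hq', ← Scheme.Hom.comp_apply, hl', Scheme.Hom.comp_apply]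
  have hlθ : θ ≫ l = ψ ≫ awayMap f := by
    apply Spec.map_injective
    rw [← cancel_mono ι, Spec.map_comp, Spec.map_comp, Category.assoc, Category.assoc, ← e,
      ← hι', reassoc_of% hl']
  have hsn : (ψ ≫ awayMap f).hom s ∈ nonZeroDivisors _ :=
    localization_mem_nonZeroDivisors f hψ.mem
  obtain ⟨r, hr⟩ := hψ.dvd
  -- On the overlap `t = s r` and `s = t s'`; cancelling `s` gives `r s' = 1`.
  have h3 : IsUnit (l.hom s') := by
    have e1 : l.hom (θ.hom s) = (ψ ≫ awayMap f).hom s := by rw [← hlθ]; rfl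
    have e2 : l.hom (θ.hom t) = (ψ ≫ awayMap f).hom s * (awayMap f).hom r := by
      have : l.hom (θ.hom t) = (ψ ≫ awayMap f).hom t := by rw [← hlθ]; rfl
      rw [this, CommRingCat.hom_comp, RingHom.comp_apply, hr, map_mul]; rfl
    have e3 := congrArg l.hom hs'
    rw [map_mul, e2, e1] at e3
    refine IsUnit.of_mul_eq_one ((awayMap f).hom r) (sub_eq_zero.mp ?_)
    rw [mem_nonZeroDivisors_iff_right] at hsn
    apply hsn
    linear_combination -e3
  have hs'z : s' ∉ PrimeSpectrum.asIdeal z := by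
    rw [← hz', SpecMap_apply_asIdeal]
    exact fun h ↦ (PrimeSpectrum.isPrime q').ne_top (Ideal.eq_top_of_isUnit_mem _ h h3)
  obtain ⟨z', rfl⟩ : z ∈ Set.range (Spec.map (awayMap s')) := by
    rw [range_SpecMap_away]; exact hs'z
  have hu : IsUnit ((awayMap s').hom s') := IsLocalization.Away.algebraMap_isUnit s'
  refine ⟨_, θ ≫ awayMap s', Spec.map (awayMap s') ≫ w, inferInstance, ⟨z', by simpa using hz⟩,
    ?_, ?_, ?_⟩
  · rw [Category.assoc, e, Spec.map_comp, Category.assoc]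
  · rw [CommRingCat.hom_comp, RingHom.comp_apply, hs', map_mul]
    exact mul_mem (localization_mem_nonZeroDivisors _ h1) hu.mem_nonZeroDivisors
  · rw [CommRingCat.hom_comp, RingHom.comp_apply, hs', map_mul, hu.mul_right_dvd]
    rfl

/-- The last clause, which puts every piece where `s` generates inside the chart, is what later
shows that the charts cover the blowup. -/
theorem IsBlowup.exists_chart (hb : IsBlowup b I) [IsOpenImmersion ι]
    (hst : pullIdeal I ι = .span {s, t}) (hψ : IsBlowupChart ψ s t) :
    ∃ ι' : Spec A' ⟶ X', IsOpenImmersion ι' ∧ ι' ≫ b = Spec.map ψ ≫ ι ∧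
      ∀ (C : CommRingCat.{u}) (θ : A ⟶ C) (w : Spec C ⟶ X'), w ≫ b = Spec.map θ ≫ ι →
        θ.hom s ∈ nonZeroDivisors C → θ.hom s ∣ θ.hom t → Set.range w ⊆ Set.range ι' := by
  obtain ⟨ι', hι', -⟩ := hb.2 (Spec.map ψ ≫ ι) (isEffectiveCartier_comap_of_pullIdeal _ hψ.mem
    (pullIdeal_chart hst _ hψ.dvd))
  refine ⟨ι', ?_, hι', fun C θ w hw hs hd ↦ ?_⟩
  · apply IsOpenImmersion.of_forall_source_exists
    · intro q₁ q₂ h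
      obtain ⟨C, θ, w, hw, hq, e, hs, hd⟩ := hb.exists_chart_at hst hψ hι' q₁
      have := hb.isOpenImmersion_preimage hst hψ hι' e hs hd
      have hinj := ((ι' ⁻¹ᵁ w.opensRange).ι ≫ ι').isOpenEmbedding.injective
      have h1 : q₁ ∈ ι' ⁻¹ᵁ w.opensRange := hq
      have h2 : q₂ ∈ ι' ⁻¹ᵁ w.opensRange := by
        change ι' q₂ ∈ Set.range w
        rwa [← h]
      exact congrArg Subtype.val (@hinj ⟨q₁, h1⟩ ⟨q₂, h2⟩ h)
    · intro q
      obtain ⟨C, θ, w, hw, hq, e, hs, hd⟩ := hb.exists_chart_at hst hψ hι' q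
      exact ⟨_, (ι' ⁻¹ᵁ w.opensRange).ι, inferInstance, by simpa using hq,
        hb.isOpenImmersion_preimage hst hψ hι' e hs hd⟩
  · obtain ⟨θ', -, rfl⟩ := hb.exists_factor hst hψ hι' hw hs hd
    rintro _ ⟨z, rfl⟩
    exact ⟨Spec.map θ' z, by simp⟩

end Chart

theorem IsEffectiveCartier.comap {X Y : Scheme.{u}} {I : X.IdealSheafData}
    (hI : IsEffectiveCartier I) (j : Y ⟶ X) [IsOpenImmersion j] :
    IsEffectiveCartier (I.comap j) := by
  rw [isEffectiveCartier_iff] at hI ⊢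
  intro p
  obtain ⟨B, g, hg, ⟨q, hq⟩, a, ha, h⟩ := hI (j p)
  obtain ⟨f, hf, hfU⟩ := exists_away q (g ⁻¹' Set.range j)
    (j.isOpenEmbedding.isOpen_range.preimage g.continuous) ⟨p, hq.symm⟩
  have hr : Set.range (Spec.map (awayMap f) ≫ g) ⊆ Set.range j := by
    rintro _ ⟨z, rfl⟩
    have h1 : Spec.map (awayMap f) z ∈ Set.range (Spec.map (awayMap f)) := ⟨z, rfl⟩
    rw [range_SpecMap_away] at h1
    simpa using hfU _ h1
  have hl := IsOpenImmersion.lift_fac j _ hr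
  have hl' : IsOpenImmersion (IsOpenImmersion.lift j _ hr) := by
    have : IsOpenImmersion (IsOpenImmersion.lift j _ hr ≫ j) := by
        rw [hl]; infer_instance
    exact IsOpenImmersion.of_comp _ j
  refine ⟨_, IsOpenImmersion.lift j _ hr, hl', ?_, _, localization_mem_nonZeroDivisors f ha, ?_⟩
  · obtain ⟨z, rfl⟩ : q ∈ Set.range (Spec.map (awayMap f)) := by
      rw [range_SpecMap_away]; exact hf
    refine ⟨z, j.isOpenEmbedding.injective ?_⟩
    rw [← hq, ← Scheme.Hom.comp_apply, hl, Scheme.Hom.comp_apply]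
  · rw [pullIdeal_comap, hl, pullIdeal_comp, h, Ideal.map_span, Set.image_singleton]
    rfl

/-- Where the centre is already Cartier the inclusion of `W` lifts to the blowup, and uniqueness
makes this lift a two-sided inverse. -/
theorem IsBlowup.isIso_morphismRestrict {X' X : Scheme.{u}} {b : X' ⟶ X} {I : X.IdealSheafData}
    (hb : IsBlowup b I) (W : X.Opens)
    (hW : ∀ p ∈ W, ∃ (B : CommRingCat.{u}) (g : Spec B ⟶ X), IsOpenImmersion g ∧
      p ∈ Set.range g ∧ Set.range g ⊆ W ∧ ∃ a ∈ nonZeroDivisors B, pullIdeal I g = .span {a}) :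
    IsIso (b ∣_ W) := by
  have hC : IsEffectiveCartier (I.comap W.ι) := by
    rw [isEffectiveCartier_iff]
    intro p
    obtain ⟨B, g, hg, ⟨q, hq⟩, hr, a, ha, h⟩ := hW p.1 p.2
    have hr' : Set.range g ⊆ Set.range W.ι := by rwa [Scheme.Opens.range_ι]
    have hl := IsOpenImmersion.lift_fac W.ι g hr'
    have hl' : IsOpenImmersion (IsOpenImmersion.lift W.ι g hr') := by
      have : IsOpenImmersion (IsOpenImmersion.lift W.ι g hr' ≫ W.ι) := by
        rw [hl]; infer_instance
      exact IsOpenImmersion.of_comp _ W.ι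
    refine ⟨_, IsOpenImmersion.lift W.ι g hr', hl', ⟨q, W.ι.isOpenEmbedding.injective ?_⟩, a, ha, ?_⟩
    · rw [← Scheme.Hom.comp_apply, hl, hq]; rfl
    · rw [pullIdeal_comap, hl, h]
  obtain ⟨h, hh, -⟩ := hb.2 W.ι hC
  have hr : Set.range h ⊆ Set.range (b ⁻¹ᵁ W).ι := by
    rw [Scheme.Opens.range_ι]
    rintro _ ⟨z, rfl⟩
    change b (h z) ∈ W
    rw [← Scheme.Hom.comp_apply, hh]
    exact z.2
  have hm := IsOpenImmersion.lift_fac (b ⁻¹ᵁ W).ι h hr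
  set m := IsOpenImmersion.lift (b ⁻¹ᵁ W).ι h hr
  refine ⟨m, ?_, ?_⟩
  · rw [← cancel_mono (b ⁻¹ᵁ W).ι, Category.assoc, hm, Category.id_comp]
    have hC' : IsEffectiveCartier (I.comap ((b ⁻¹ᵁ W).ι ≫ b)) := by
      rw [Scheme.IdealSheafData.comap_comp]
      exact hb.1.comap _
    refine (hb.2 _ hC').unique ?_ rfl
    rw [Category.assoc, hh, morphismRestrict_ι]
  · rw [← cancel_mono W.ι, Category.assoc, morphismRestrict_ι, reassoc_of% hm, hh,
      Category.id_comp]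

/-! ### The centre of a blowup in a chart, and the two charts above it -/

section MonChart

set_option linter.unusedSectionVars false

variable {σ : Type} [DecidableEq σ] {K : Type u} [Field K]
variable {i k j : σ} {B D P P₁ P₂ E : Finset σ}

theorem prodX_union {A A' : Finset σ} (h : Disjoint A A') :
    prodX K (A ∪ A') = prodX K A * prodX K A' := Finset.prod_union h

namespace MonChart

theorem of_prodX_union {A A' : Finset σ} (h : Disjoint A A') : of K i k B D P (prodX K (A ∪ A')) =
    of K i k B D P (prodX K A) * of K i k B D P (prodX K A') := by
  rw [prodX_union h, map_mul]

theorem of_prodX_insert {A : Finset σ} (h : j ∉ A) : of K i k B D P (prodX K (insert j A)) =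
    var K i k B D P j * of K i k B D P (prodX K A) := by
  have : prodX K (insert j A) = MvPowerSeries.X j * prodX K A := Finset.prod_insert h
  rw [this, map_mul]

/-- Each `u_j` with `j ∈ B` is a prime element, and by the description of the trace of `(u_j)` on
power series it does not divide a product of the others; so the divisors can be collected one by
one. -/
theorem dvd_of_forall_dvd_var (h : Separated i k B D P) {a : MonChart K i k B D P} (hE : E ⊆ B)
    (ha : ∀ j ∈ E, var K i k B D P j ∣ a) : of K i k B D P (prodX K E) ∣ a := by
  induction E using Finset.induction_on with
  | empty => simp
  | insert j E hj ih =>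
    obtain ⟨c, hc⟩ := ih ((Finset.subset_insert _ _).trans hE)
      fun l hl ↦ ha l (Finset.mem_insert_of_mem hl)
    obtain ⟨h1, h2⟩ := span_var_isPrime_of_mem_left (K := K) h
      (hE (Finset.mem_insert_self j E))
    have h3 := Ideal.mem_span_singleton.mpr (ha j (Finset.mem_insert_self j E))
    rw [hc] at h3
    obtain h3 | h3 := h1.mem_or_mem h3
    · obtain ⟨l, hl, hl'⟩ := prod_mem_varIdeal.mp (h2 (prodX K _) h3)
      rw [Finset.mem_insert, Finset.mem_singleton] at hl'
      obtain rfl | rfl := hl'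
      · exact absurd hl hj
      · exact absurd (hE (Finset.mem_insert_of_mem hl)) h.iB
    · obtain ⟨c', rfl⟩ := Ideal.mem_span_singleton.mp h3
      refine ⟨c', ?_⟩
      rw [hc, of_prodX_insert hj]
      ring

theorem vIdeal_singleton_isPrime (h : Separated i k B D P) (hj : j ∈ P) :
    (vIdeal K i k B D P {j}).IsPrime ∧
      ∀ f, of K i k B D P f ∈ vIdeal K i k B D P {j} → f ∈ varIdeal K {i, j} := by
  obtain ⟨h1, h2, -⟩ := vIdeal_isPrime (K := K) (Z := {j}) h ⟨j, hj, by simp⟩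
    (Finset.disjoint_singleton_right.mpr (Finset.disjoint_right.mp h.DP hj))
    (by rintro hk; rw [Finset.mem_singleton] at hk; subst hk; exact h.kP hj)
  exact ⟨h1, h2⟩

theorem wIdeal_singleton_isPrime (h : Separated i k B D P) (hj : j ∈ P) :
    (wIdeal K i k B D P {j}).IsPrime ∧
      ∀ f, of K i k B D P f ∈ wIdeal K i k B D P {j} → f ∈ varIdeal K {k, j} := by
  obtain ⟨h1, h2, -⟩ := wIdeal_isPrime (K := K) (Z := {j}) h ⟨j, hj, by simp⟩
    (Finset.disjoint_singleton_right.mpr (Finset.disjoint_right.mp h.BP hj))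
    (by rintro hk; rw [Finset.mem_singleton] at hk; subst hk; exact h.iP hj)
  exact ⟨h1, h2⟩

theorem mem_vIdeal_singleton {a : MonChart K i k B D P} :
    a ∈ vIdeal K i k B D P {j} ↔ ∃ α β, a = α * v K i k B D P + β * var K i k B D P j := by
  rw [vIdeal, Finset.coe_singleton, Set.image_singleton, Ideal.mem_span_pair]
  simp only [eq_comm]

/-- Modulo `v` the induction is the one for divisibility: a product of the other variables lies
outside the prime `(v, u_j)`, so the cofactor lies inside it. -/
theorem exists_of_forall_mem_vIdeal (h : Separated i k B D P) {a : MonChart K i k B D P}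
    (hE : E ⊆ P) (ha : ∀ j ∈ E, a ∈ vIdeal K i k B D P {j}) :
    ∃ α β, a = α * v K i k B D P + β * of K i k B D P (prodX K E) := by
  induction E using Finset.induction_on with
  | empty => exact ⟨0, a, by simp⟩
  | insert j E hj ih =>
    obtain ⟨α, β, hc⟩ := ih ((Finset.subset_insert _ _).trans hE)
      fun l hl ↦ ha l (Finset.mem_insert_of_mem hl)
    have hjP := hE (Finset.mem_insert_self j E)
    obtain ⟨h1, h2⟩ := vIdeal_singleton_isPrime (K := K) h hjP
    have h3 := ha j (Finset.mem_insert_self j E)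
    rw [hc, Ideal.add_mem_iff_right _ (Ideal.mul_mem_left _ _ v_mem_vIdeal)] at h3
    obtain h3 | h3 := h1.mem_or_mem h3
    · obtain ⟨γ, δ, rfl⟩ := mem_vIdeal_singleton.mp h3
      refine ⟨α + γ * of K i k B D P (prodX K E), δ, ?_⟩
      rw [hc, of_prodX_insert hj]
      ring
    · obtain ⟨l, hl, hl'⟩ := prod_mem_varIdeal.mp (h2 (prodX K _) h3)
      rw [Finset.mem_insert, Finset.mem_singleton] at hl'
      obtain rfl | rfl := hl'
      · exact absurd (hE (Finset.mem_insert_of_mem hl)) h.iP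
      · exact absurd hl hj

/-- The ideal of a union of components of `V(x, u)` in a chart. -/
theorem mem_span_pair_iff (h : Separated i k B D P) {E₁ E₂ : Finset σ} {a : MonChart K i k B D P}
    (h₁ : E₁ ⊆ B) (h₂ : E₂ ⊆ P) :
    a ∈ Ideal.span {of K i k B D P (prodX K E₁) * v K i k B D P,
      of K i k B D P (prodX K E₁) * of K i k B D P (prodX K E₂)} ↔
    (∀ j ∈ E₁, a ∈ Ideal.span {var K i k B D P j}) ∧ ∀ j ∈ E₂, a ∈ vIdeal K i k B D P {j} := by
  constructor
  · intro ha
    obtain ⟨α, β, rfl⟩ := Ideal.mem_span_pair.mp ha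
    constructor
    · intro j hj
      have : of K i k B D P (prodX K E₁) ∈ Ideal.span {var K i k B D P j} := by
        rw [of_prodX]
        exact Ideal.mem_span_singleton.mpr (Finset.dvd_prod_of_mem _ hj)
      exact add_mem (Ideal.mul_mem_left _ _ (Ideal.mul_mem_right _ _ this))
        (Ideal.mul_mem_left _ _ (Ideal.mul_mem_right _ _ this))
    · intro j hj
      have : of K i k B D P (prodX K E₂) ∈ vIdeal K i k B D P {j} := by
        rw [of_prodX]
        exact Ideal.mem_of_dvd _ (Finset.dvd_prod_of_mem _ hj) (var_mem_vIdeal (by simp))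
      exact add_mem (Ideal.mul_mem_left _ _ (Ideal.mul_mem_left _ _ v_mem_vIdeal))
        (Ideal.mul_mem_left _ _ (Ideal.mul_mem_left _ _ this))
  · rintro ⟨ha, hb⟩
    obtain ⟨c, rfl⟩ := dvd_of_forall_dvd_var h h₁ fun j hj ↦ Ideal.mem_span_singleton.mp (ha j hj)
    obtain ⟨α, β, rfl⟩ := exists_of_forall_mem_vIdeal h (a := c) h₂ fun j hj ↦ by
      obtain ⟨h1, h2⟩ := vIdeal_singleton_isPrime (K := K) h (h₂ hj)
      refine (h1.mem_or_mem (hb j hj)).resolve_left fun h3 ↦ ?_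
      obtain ⟨l, hl, hl'⟩ := prod_mem_varIdeal.mp (h2 (prodX K _) h3)
      rw [Finset.mem_insert, Finset.mem_singleton] at hl'
      obtain rfl | rfl := hl'
      · exact h.iB (h₁ hl)
      · exact Finset.disjoint_left.mp h.BP (h₁ hl) (h₂ hj)
    exact Ideal.mem_span_pair.mpr ⟨α, β, by ring⟩

/-- The chart of the blowup of `V(x, u)` in which `x / b` generates the ideal. -/
def leftMap (h : Disjoint P₁ P₂) (hD : Disjoint D P₂) :
    MonChart K i k B D (P₁ ∪ P₂) →+* MonChart K i k B (D ∪ P₂) P₁ :=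
  ChartRing.lift (of K i k B (D ∪ P₂) P₁) (v K i k B (D ∪ P₂) P₁)
    (w K i k B (D ∪ P₂) P₁ * of K i k B (D ∪ P₂) P₁ (prodX K P₂)) var_x
    (by rw [ChartRing.of_y, of_prodX_union hD]; ring)
    (by rw [← mul_assoc, v_mul_w, of_prodX_union h])

/-- The chart of the blowup of `V(x, u)` in which `u` generates the ideal. -/
def rightMap (h : Disjoint P₁ P₂) (hB : Disjoint B P₁) :
    MonChart K i k B D (P₁ ∪ P₂) →+* MonChart K i k (B ∪ P₁) D P₂ :=
  ChartRing.lift (of K i k (B ∪ P₁) D P₂)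
    (v K i k (B ∪ P₁) D P₂ * of K i k (B ∪ P₁) D P₂ (prodX K P₁)) (w K i k (B ∪ P₁) D P₂)
    (by rw [ChartRing.of_x, of_prodX_union hB]; ring) var_y
    (by rw [mul_right_comm, v_mul_w, of_prodX_union h, mul_comm])

theorem leftMap_of (h : Disjoint P₁ P₂) (hD : Disjoint D P₂) (f : MvPowerSeries σ K) :
    leftMap h hD (of K i k B D (P₁ ∪ P₂) f) = of K i k B (D ∪ P₂) P₁ f := ChartRing.lift_of ..

theorem leftMap_v (h : Disjoint P₁ P₂) (hD : Disjoint D P₂) :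
    leftMap h hD (v K i k B D (P₁ ∪ P₂)) = v K i k B (D ∪ P₂) P₁ := ChartRing.lift_v ..

theorem leftMap_w (h : Disjoint P₁ P₂) (hD : Disjoint D P₂) :
    leftMap h hD (w K i k B D (P₁ ∪ P₂)) =
      w K i k B (D ∪ P₂) P₁ * of K i k B (D ∪ P₂) P₁ (prodX K P₂) := ChartRing.lift_w ..

theorem rightMap_of (h : Disjoint P₁ P₂) (hB : Disjoint B P₁) (f : MvPowerSeries σ K) :
    rightMap h hB (of K i k B D (P₁ ∪ P₂) f) = of K i k (B ∪ P₁) D P₂ f := ChartRing.lift_of ..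

theorem rightMap_v (h : Disjoint P₁ P₂) (hB : Disjoint B P₁) :
    rightMap h hB (v K i k B D (P₁ ∪ P₂)) =
      v K i k (B ∪ P₁) D P₂ * of K i k (B ∪ P₁) D P₂ (prodX K P₁) := ChartRing.lift_v ..

theorem rightMap_w (h : Disjoint P₁ P₂) (hB : Disjoint B P₁) :
    rightMap h hB (w K i k B D (P₁ ∪ P₂)) = w K i k (B ∪ P₁) D P₂ := ChartRing.lift_w ..

theorem mul_left_cancel_of_mem {R : Type*} [CommRing R] {a b c : R}
    (h : a ∈ nonZeroDivisors R) (e : a * b = a * c) : b = c :=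
  (mul_cancel_left_mem_nonZeroDivisors h).mp e

/-- Apart from the common factor the centre is `(v, p₁)`, where `p = p₁ p₂`. If `p₁ = r v` with `v`
a nonzerodivisor, then `v w = p₁ p₂` gives `w = r p₂`: the coordinate `r` replaces `w`, and `p₂`
moves from `p` to `c`. -/
theorem isBlowupChart_leftMap (hs' : Separated i k B (D ∪ P₂) P₁)
    (h : Disjoint P₁ P₂) (hD : Disjoint D P₂) (hE : E ⊆ B) :
    IsBlowupChart (A := .of (MonChart K i k B D (P₁ ∪ P₂)))
      (A' := .of (MonChart K i k B (D ∪ P₂) P₁)) (CommRingCat.ofHom (leftMap h hD))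
      (of K i k B D (P₁ ∪ P₂) (prodX K E) * v K i k B D (P₁ ∪ P₂))
      (of K i k B D (P₁ ∪ P₂) (prodX K E) * of K i k B D (P₁ ∪ P₂) (prodX K P₁)) where
  mem := by
    simp only [CommRingCat.hom_ofHom]
    rw [map_mul, leftMap_of, leftMap_v]
    exact mul_mem (of_prodX_mem_nonZeroDivisors hs'
      (hE.trans (Finset.subset_union_left.trans Finset.subset_union_left)))
      (v_mem_nonZeroDivisors hs')
  dvd := by
    simp only [CommRingCat.hom_ofHom]
    rw [map_mul, map_mul, leftMap_of, leftMap_v, leftMap_of]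
    exact mul_dvd_mul_left _ ⟨_, v_mul_w.symm⟩
  exists_lift := by
    intro C θ h1 ⟨r, h2⟩
    rw [map_mul] at h1
    have he := (mul_mem_nonZeroDivisors.mp h1).1
    have hv := (mul_mem_nonZeroDivisors.mp h1).2
    rw [map_mul, map_mul, mul_assoc] at h2
    replace h2 := mul_left_cancel_of_mem he h2
    have h3 : θ.hom (w K i k B D (P₁ ∪ P₂)) = r * θ.hom (of K i k B D (P₁ ∪ P₂) (prodX K P₂)) := by
      refine mul_left_cancel_of_mem hv ?_
      rw [← map_mul, v_mul_w, of_prodX_union h, map_mul, h2]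
      ring
    refine ⟨CommRingCat.ofHom (ChartRing.lift (θ.hom.comp (of K i k B D (P₁ ∪ P₂)))
      (θ.hom (v K i k B D (P₁ ∪ P₂))) r ?_ ?_ ?_), ?_⟩
    · rw [RingHom.comp_apply, ChartRing.of_x, map_mul]; rfl
    · rw [RingHom.comp_apply, ChartRing.of_y, map_mul, h3, RingHom.comp_apply, of_prodX_union hD]
      simp only [map_mul]
      ring
    · exact h2.symm
    · ext1
      refine ChartRing.hom_ext (fun a ↦ ?_) ?_ ?_
      · simp [leftMap_of]
      · simp [leftMap_v]
      · simp [leftMap_w, h3]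
  hom_ext := by
    intro C θ₁ θ₂ h1 h2
    have h2' : ∀ a, θ₁.hom (leftMap h hD a) = θ₂.hom (leftMap h hD a) := by
      intro a
      have := RingHom.congr_fun (congrArg CommRingCat.Hom.hom h2) a
      rwa [CommRingCat.hom_comp, CommRingCat.hom_comp, RingHom.comp_apply, RingHom.comp_apply,
        CommRingCat.hom_ofHom] at this
    have hof : ∀ a, θ₁.hom (of K i k B (D ∪ P₂) P₁ a) = θ₂.hom (of K i k B (D ∪ P₂) P₁ a) := by
      intro a
      rw [← leftMap_of h hD, h2']
    have hv : θ₁.hom (v K i k B (D ∪ P₂) P₁) = θ₂.hom (v K i k B (D ∪ P₂) P₁) := by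
      rw [← leftMap_v h hD, h2']
    ext1
    refine ChartRing.hom_ext hof hv ?_
    simp only [CommRingCat.hom_ofHom, map_mul, leftMap_of, leftMap_v] at h1
    refine mul_left_cancel_of_mem (mul_mem_nonZeroDivisors.mp h1).2 ?_
    rw [← map_mul]
    conv_rhs => rw [hv]
    rw [← map_mul, v_mul_w, hof]

/-- If `v = r p₁` with `p₁` a nonzerodivisor, then `v w = p₁ p₂` gives `r w = p₂`: the coordinate
`r` replaces `v`, and `p₁` moves from `p` to `b`. -/
theorem isBlowupChart_rightMap (hs' : Separated i k (B ∪ P₁) D P₂)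
    (h : Disjoint P₁ P₂) (hB : Disjoint B P₁) (hE : E ⊆ B) :
    IsBlowupChart (A := .of (MonChart K i k B D (P₁ ∪ P₂)))
      (A' := .of (MonChart K i k (B ∪ P₁) D P₂)) (CommRingCat.ofHom (rightMap h hB))
      (of K i k B D (P₁ ∪ P₂) (prodX K E) * of K i k B D (P₁ ∪ P₂) (prodX K P₁))
      (of K i k B D (P₁ ∪ P₂) (prodX K E) * v K i k B D (P₁ ∪ P₂)) where
  mem := by
    simp only [CommRingCat.hom_ofHom]
    rw [map_mul, rightMap_of, rightMap_of]
    refine mul_mem (of_prodX_mem_nonZeroDivisors hs' ?_) (of_prodX_mem_nonZeroDivisors hs' ?_)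
    · exact hE.trans (Finset.subset_union_left.trans
        (Finset.subset_union_left.trans Finset.subset_union_left))
    · exact Finset.subset_union_right.trans (Finset.subset_union_left.trans Finset.subset_union_left)
  dvd := by
    simp only [CommRingCat.hom_ofHom]
    rw [map_mul, map_mul, rightMap_of, rightMap_v, rightMap_of]
    exact mul_dvd_mul_left _ (dvd_mul_left _ _)
  exists_lift := by
    intro C θ h1 ⟨r, h2⟩
    rw [map_mul] at h1
    have he := (mul_mem_nonZeroDivisors.mp h1).1
    have hv := (mul_mem_nonZeroDivisors.mp h1).2
    rw [map_mul, map_mul, mul_assoc] at h2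
    replace h2 := mul_left_cancel_of_mem he h2
    refine ⟨CommRingCat.ofHom (ChartRing.lift (θ.hom.comp (of K i k B D (P₁ ∪ P₂))) r
      (θ.hom (w K i k B D (P₁ ∪ P₂))) ?_ ?_ ?_), ?_⟩
    · rw [RingHom.comp_apply, ChartRing.of_x, map_mul, h2, RingHom.comp_apply, of_prodX_union hB]
      simp only [map_mul]
      ring
    · rw [RingHom.comp_apply, ChartRing.of_y, map_mul]; rfl
    · refine mul_left_cancel_of_mem hv ?_
      rw [← mul_assoc, ← h2, ← map_mul, v_mul_w, of_prodX_union h, map_mul]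
      rfl
    · ext1
      refine ChartRing.hom_ext (fun a ↦ ?_) ?_ ?_
      · simp [rightMap_of]
      · simp [rightMap_v, h2, mul_comm]
      · simp [rightMap_w]
  hom_ext := by
    intro C θ₁ θ₂ h1 h2
    have h2' : ∀ a, θ₁.hom (rightMap h hB a) = θ₂.hom (rightMap h hB a) := by
      intro a
      have := RingHom.congr_fun (congrArg CommRingCat.Hom.hom h2) a
      rwa [CommRingCat.hom_comp, CommRingCat.hom_comp, RingHom.comp_apply, RingHom.comp_apply,
        CommRingCat.hom_ofHom] at this
    have hof : ∀ a, θ₁.hom (of K i k (B ∪ P₁) D P₂ a) = θ₂.hom (of K i k (B ∪ P₁) D P₂ a) := by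
      intro a
      rw [← rightMap_of h hB, h2']
    have hw : θ₁.hom (w K i k (B ∪ P₁) D P₂) = θ₂.hom (w K i k (B ∪ P₁) D P₂) := by
      rw [← rightMap_w h hB, h2']
    ext1
    refine ChartRing.hom_ext hof ?_ hw
    simp only [CommRingCat.hom_ofHom, map_mul, rightMap_of] at h1
    refine mul_left_cancel_of_mem (mul_mem_nonZeroDivisors.mp h1).2 ?_
    have h3 := h2' (v K i k B D (P₁ ∪ P₂))
    rw [rightMap_v, map_mul, map_mul, ← hof] at h3
    exact (mul_comm _ _).trans (h3.trans (mul_comm _ _))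

/-- The decompositions are hypotheses because the index sets of a block, mapped by `inlF`, are
unions only up to a propositional equality. -/
theorem exists_isBlowupChart_left {D' : Finset σ} (hs' : Separated i k B D' P₁)
    (hP : P = P₁ ∪ P₂) (hD' : D' = D ∪ P₂) (h : Disjoint P₁ P₂) (hD : Disjoint D P₂)
    (hE : E ⊆ B) :
    ∃ ψ : CommRingCat.of (MonChart K i k B D P) ⟶ CommRingCat.of (MonChart K i k B D' P₁),
      IsBlowupChart ψ (of K i k B D P (prodX K E) * v K i k B D P)
        (of K i k B D P (prodX K E) * of K i k B D P (prodX K P₁)) ∧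
      ∀ f, ψ.hom (of K i k B D P f) = of K i k B D' P₁ f := by
  subst hP hD'
  exact ⟨_, isBlowupChart_leftMap hs' h hD hE, leftMap_of h hD⟩

theorem exists_isBlowupChart_right {B' : Finset σ} (hs' : Separated i k B' D P₂)
    (hP : P = P₁ ∪ P₂) (hB' : B' = B ∪ P₁) (h : Disjoint P₁ P₂) (hB : Disjoint B P₁)
    (hE : E ⊆ B) :
    ∃ ψ : CommRingCat.of (MonChart K i k B D P) ⟶ CommRingCat.of (MonChart K i k B' D P₂),
      IsBlowupChart ψ (of K i k B D P (prodX K E) * of K i k B D P (prodX K P₁))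
        (of K i k B D P (prodX K E) * v K i k B D P) ∧
      ∀ f, ψ.hom (of K i k B D P f) = of K i k B' D P₂ f := by
  subst hP hB'
  exact ⟨_, isBlowupChart_rightMap hs' h hB hE, rightMap_of h hB⟩

end MonChart

end MonChart

/-! ### The ordering of a collection -/

section Collection

variable {F : Type*} {𝒜 : List (Finset F)} {A : Finset F} {l m n : F}

/-- No member of the collection separates `m` from `n`. -/
def CollectionEqv (𝒜 : List (Finset F)) (m n : F) : Prop := ∀ A ∈ 𝒜, (m ∈ A ↔ n ∈ A)

theorem CollectionEqv.refl : CollectionEqv 𝒜 m m := fun _ _ ↦ Iff.rfl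

theorem CollectionEqv.symm (h : CollectionEqv 𝒜 m n) : CollectionEqv 𝒜 n m :=
  fun A hA ↦ (h A hA).symm

theorem CollectionEqv.trans (h : CollectionEqv 𝒜 l m) (h' : CollectionEqv 𝒜 m n) :
    CollectionEqv 𝒜 l n := fun A hA ↦ (h A hA).trans (h' A hA)

theorem collectionEqv_concat : CollectionEqv (𝒜 ++ [A]) m n ↔
    CollectionEqv 𝒜 m n ∧ (m ∈ A ↔ n ∈ A) := by
  simp [CollectionEqv, or_imp, forall_and]

theorem CollectionLT.not_eqv (h : CollectionLT 𝒜 m n) : ¬ CollectionEqv 𝒜 m n := by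
  obtain ⟨pre, A, post, rfl, hm, hn, -⟩ := h
  exact fun h ↦ hn ((h A (by simp)).mp hm)

theorem CollectionLT.congr_right (h : CollectionEqv 𝒜 m n) (h' : CollectionLT 𝒜 l m) :
    CollectionLT 𝒜 l n := by
  obtain ⟨pre, A, post, rfl, hm, hn, hB⟩ := h'
  refine ⟨pre, A, post, rfl, hm, fun h1 ↦ hn ((h A (by simp)).mpr h1), fun B hB' ↦ ?_⟩
  rw [← h B (by simp [hB'])]
  exact hB B hB'

theorem CollectionLT.congr_left (h : CollectionEqv 𝒜 m n) (h' : CollectionLT 𝒜 m l) :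
    CollectionLT 𝒜 n l := by
  obtain ⟨pre, A, post, rfl, hm, hn, hB⟩ := h'
  refine ⟨pre, A, post, rfl, (h A (by simp)).mp hm, hn, fun B hB' ↦ ?_⟩
  rw [← h B (by simp [hB'])]
  exact hB B hB'

theorem not_collectionLT_nil : ¬ CollectionLT ([] : List (Finset F)) m n := by
  rintro ⟨pre, A, post, h, -⟩
  simp at h

/-- A new last member only splits classes of indices that the earlier members have not separated.
All inductions on the collection rest on this. -/
theorem collectionLT_concat : CollectionLT (𝒜 ++ [A]) m n ↔
    CollectionLT 𝒜 m n ∨ (CollectionEqv 𝒜 m n ∧ m ∈ A ∧ n ∉ A) := by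
  have key : ∀ pre : List (Finset F), (∀ B ∈ pre, (m ∈ B ∧ n ∈ B) ∨ (m ∉ B ∧ n ∉ B)) ↔
      CollectionEqv pre m n :=
    fun pre ↦ forall₂_congr fun B _ ↦ by tauto
  constructor
  · rintro ⟨pre, A', post, h, hm, hn, hB⟩
    obtain rfl | ⟨post, A'', rfl⟩ := List.eq_nil_or_concat post
    · obtain ⟨rfl, h⟩ := List.append_inj' h rfl
      obtain rfl : A = A' := by simpa using h
      exact .inr ⟨(key _).mp hB, hm, hn⟩
    · rw [List.concat_eq_append, ← List.cons_append, ← List.append_assoc] at h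
      obtain ⟨rfl, -⟩ := List.append_inj' h rfl
      exact .inl ⟨pre, A', post, rfl, hm, hn, hB⟩
  · rintro (⟨pre, A', post, rfl, hm, hn, hB⟩ | ⟨h, hm, hn⟩)
    · exact ⟨pre, A', post ++ [A], by simp, hm, hn, hB⟩
    · exact ⟨𝒜, A, [], rfl, hm, hn, (key _).mpr h⟩

theorem CollectionLT.asymm (h : CollectionLT 𝒜 m n) : ¬ CollectionLT 𝒜 n m := by
  induction 𝒜 using List.reverseRecOn with
  | nil => exact absurd h not_collectionLT_nil
  | append_singleton 𝒜 A ih =>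
    rw [collectionLT_concat] at h ⊢
    rintro (h' | ⟨h1, h2, h3⟩)
    · obtain h | ⟨h4, -, -⟩ := h
      · exact ih h h'
      · exact h'.not_eqv h4.symm
    · obtain h | ⟨-, h5, h6⟩ := h
      · exact h.not_eqv h1.symm
      · exact h3 h5

theorem collectionLT_trichotomy (𝒜 : List (Finset F)) (m n : F) :
    CollectionLT 𝒜 m n ∨ CollectionEqv 𝒜 m n ∨ CollectionLT 𝒜 n m := by
  induction 𝒜 using List.reverseRecOn with
  | nil => exact .inr (.inl fun A hA ↦ by simp at hA)
  | append_singleton 𝒜 A ih =>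
    rw [collectionLT_concat, collectionLT_concat, collectionEqv_concat]
    obtain h | h | h := ih
    · exact .inl (.inl h)
    · have := h.symm
      by_cases hm : m ∈ A <;> by_cases hn : n ∈ A <;> simp_all
    · exact .inr (.inr (.inl h))

end Collection

/-! ### Blocks -/

/-- A partition of the indices: those dividing `x`, those dividing the product `v w`, those
dividing `y`. -/
@[ext]
structure Block (d : ℕ) where
  B : Finset (Fin (d + 1))
  P : Finset (Fin (d + 1))
  D : Finset (Fin (d + 1))
  BP : Disjoint B P
  BD : Disjoint B D
  DP : Disjoint D P
  union : B ∪ D ∪ P = Finset.univ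

namespace Block

variable {d : ℕ}

/-- The block of the chart in which `v` generates the ideal of the centre. -/
def left (β : Block d) (A : Finset (Fin (d + 1))) : Block d where
  B := β.B
  P := β.P ∩ A
  D := β.D ∪ β.P \ A
  BP := β.BP.mono_right Finset.inter_subset_left
  BD := Finset.disjoint_union_right.mpr ⟨β.BD, β.BP.mono_right Finset.sdiff_subset⟩
  DP := Finset.disjoint_union_left.mpr ⟨β.DP.mono_right Finset.inter_subset_left,
    (Finset.disjoint_sdiff_inter _ _)⟩
  union := by
    rw [← β.union]
    ext m
    simp only [Finset.mem_union, Finset.mem_inter, Finset.mem_sdiff]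
    tauto

/-- The block of the chart in which the product of variables generates the ideal of the centre. -/
def right (β : Block d) (A : Finset (Fin (d + 1))) : Block d where
  B := β.B ∪ β.P ∩ A
  P := β.P \ A
  D := β.D
  BP := Finset.disjoint_union_left.mpr ⟨β.BP.mono_right Finset.sdiff_subset,
    (Finset.disjoint_sdiff_inter _ _).symm⟩
  BD := Finset.disjoint_union_left.mpr ⟨β.BD, (β.DP.mono_right Finset.inter_subset_left).symm⟩
  DP := β.DP.mono_right Finset.sdiff_subset
  union := by
    rw [← β.union]
    ext m
    simp only [Finset.mem_union, Finset.mem_inter, Finset.mem_sdiff]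
    tauto

open Classical in
/-- The block of an index with respect to a collection. -/
def ofCollection (𝒜 : List (Finset (Fin (d + 1)))) (j : Fin (d + 1)) : Block d where
  B := Finset.univ.filter fun m ↦ CollectionLT 𝒜 m j
  P := Finset.univ.filter fun m ↦ CollectionEqv 𝒜 m j
  D := Finset.univ.filter fun m ↦ CollectionLT 𝒜 j m
  BP := Finset.disjoint_filter.mpr fun _ _ h ↦ h.not_eqv
  BD := Finset.disjoint_filter.mpr fun _ _ h ↦ h.asymm
  DP := Finset.disjoint_filter.mpr fun _ _ h h' ↦ h.not_eqv h'.symm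
  union := by
    ext m
    have := collectionLT_trichotomy 𝒜 m j
    simp only [Finset.mem_union, Finset.mem_filter, Finset.mem_univ, true_and, iff_true]
    tauto

variable {𝒜 : List (Finset (Fin (d + 1)))} {A : Finset (Fin (d + 1))} {j l m : Fin (d + 1)}

@[simp] theorem mem_ofCollection_B : m ∈ (ofCollection 𝒜 j).B ↔ CollectionLT 𝒜 m j := by
  simp [ofCollection]

@[simp] theorem mem_ofCollection_P : m ∈ (ofCollection 𝒜 j).P ↔ CollectionEqv 𝒜 m j := by
  simp [ofCollection]

@[simp] theorem mem_ofCollection_D : m ∈ (ofCollection 𝒜 j).D ↔ CollectionLT 𝒜 j m := by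
  simp [ofCollection]

theorem self_mem_ofCollection_P : j ∈ (ofCollection 𝒜 j).P := by
  rw [mem_ofCollection_P]
  exact CollectionEqv.refl

/-- Indices of one class give the same block, so a family of charts indexed by `j` repeats each
chart once for every element of its class. -/
theorem ofCollection_eq (h : l ∈ (ofCollection 𝒜 j).P) : ofCollection 𝒜 l = ofCollection 𝒜 j := by
  rw [mem_ofCollection_P] at h
  ext m
  · simp only [mem_ofCollection_B]
    exact ⟨.congr_right h, .congr_right h.symm⟩
  · simp only [mem_ofCollection_P]
    exact ⟨fun h' ↦ h'.trans h, fun h' ↦ h'.trans h.symm⟩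
  · simp only [mem_ofCollection_D]
    exact ⟨.congr_left h, .congr_left h.symm⟩

/-- Here the order meets the geometry. Within a class the elements of `A` precede the others: seen
from `j ∈ A` the others join `D`, and seen from `j ∉ A` the elements of `A` join `B`. -/
theorem ofCollection_concat_of_mem (h : j ∈ A) :
    ofCollection (𝒜 ++ [A]) j = (ofCollection 𝒜 j).left A := by
  ext m
  · simp [left, collectionLT_concat, h]
  · simp [left, collectionEqv_concat, h]
  · simp only [left, mem_ofCollection_D, collectionLT_concat, Finset.mem_union, Finset.mem_sdiff,
      mem_ofCollection_P, h, true_and]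
    exact or_congr_right (and_congr_left fun _ ↦ ⟨.symm, .symm⟩)

theorem ofCollection_concat_of_notMem (h : j ∉ A) :
    ofCollection (𝒜 ++ [A]) j = (ofCollection 𝒜 j).right A := by
  ext m
  · simp [right, collectionLT_concat, h]
  · simp [right, collectionEqv_concat, h]
  · simp [right, collectionLT_concat, h]

end Block

/-! ### The charts over `T_S` -/

section ChartsOverT

variable {d : ℕ} {K : Type u} [Field K]

/-- The indices of `u`-variables. -/
abbrev inlF (A : Finset (Fin (d + 1))) : Finset (Fin (d + 1) ⊕ Fin 2) :=
  A.map Function.Embedding.inl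

theorem inl_mem_inlF {A : Finset (Fin (d + 1))} {j : Fin (d + 1)} :
    (Sum.inl j : Fin (d + 1) ⊕ Fin 2) ∈ inlF A ↔ j ∈ A := by simp

theorem inr_notMem_inlF {A : Finset (Fin (d + 1))} {t : Fin 2} :
    (Sum.inr t : Fin (d + 1) ⊕ Fin 2) ∉ inlF A := by simp

theorem Block.separated (β : Block d) :
    Separated (Sum.inr 0 : Fin (d + 1) ⊕ Fin 2) (Sum.inr 1) (inlF β.B) (inlF β.D) (inlF β.P) where
  ne := by simp
  iB := inr_notMem_inlF
  iD := inr_notMem_inlF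
  iP := inr_notMem_inlF
  kB := inr_notMem_inlF
  kD := inr_notMem_inlF
  kP := inr_notMem_inlF
  BD := (Finset.disjoint_map _).mpr β.BD
  BP := (Finset.disjoint_map _).mpr β.BP
  DP := (Finset.disjoint_map _).mpr β.DP

variable (K) in
/-- The coordinate ring of the chart of a block. -/
abbrev Ch (β : Block d) : Type u :=
  MonChart K (Sum.inr 0 : Fin (d + 1) ⊕ Fin 2) (Sum.inr 1) (inlF β.B) (inlF β.D) (inlF β.P)

namespace Ch

variable (K) (β : Block d)

/-- The image of a power series. -/
abbrev of : RingP d K →+* Ch K β := MonChart.of K _ _ _ _ _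

/-- The coordinate dividing `x`. -/
abbrev v : Ch K β := MonChart.v K _ _ _ _ _

/-- The coordinate dividing `y`. -/
abbrev w : Ch K β := MonChart.w K _ _ _ _ _

/-- The variable `u_j`. -/
abbrev u (j : Fin (d + 1)) : Ch K β := MonChart.var K _ _ _ _ _ (Sum.inl j)

/-- The product of the variables `u_j` with `j ∈ A`. -/
abbrev uprod (A : Finset (Fin (d + 1))) : Ch K β := of K β (prodX K (inlF A))

variable {K β}

theorem of_x : of K β (MvPowerSeries.X (Sum.inr 0)) = v K β * uprod K β β.B := ChartRing.of_x

theorem of_y : of K β (MvPowerSeries.X (Sum.inr 1)) = w K β * uprod K β β.D := ChartRing.of_y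

theorem v_mul_w : v K β * w K β = uprod K β β.P := ChartRing.v_mul_w

theorem uprod_eq (A : Finset (Fin (d + 1))) : uprod K β A = ∏ j ∈ A, u K β j := by
  rw [uprod, MonChart.of_prodX, Finset.prod_map]
  rfl

theorem uprod_mem_iff {I : Ideal (Ch K β)} [hI : I.IsPrime] {A : Finset (Fin (d + 1))} :
    uprod K β A ∈ I ↔ ∃ j ∈ A, u K β j ∈ I := by
  rw [uprod_eq, hI.prod_mem_iff]

theorem u_mem_nonZeroDivisors (j : Fin (d + 1)) : u K β j ∈ nonZeroDivisors (Ch K β) := by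
  refine MonChart.var_mem_nonZeroDivisors β.separated ?_
  have : j ∈ β.B ∪ β.D ∪ β.P := β.union ▸ Finset.mem_univ j
  simpa [or_assoc] using this

theorem uprod_mem_nonZeroDivisors (A : Finset (Fin (d + 1))) :
    uprod K β A ∈ nonZeroDivisors (Ch K β) := by
  rw [uprod_eq]
  exact prod_mem fun j _ ↦ u_mem_nonZeroDivisors j

theorem v_mem_nonZeroDivisors : v K β ∈ nonZeroDivisors (Ch K β) :=
  MonChart.v_mem_nonZeroDivisors β.separated

variable (K β)

/-- The structure map of a chart. -/
def structureMap : RingT d K →+* Ch K β :=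
  Ideal.Quotient.lift _ (of K β) fun a ha ↦ by
    rw [← RingHom.mem_ker]
    refine (Ideal.span_singleton_le_iff_mem _).mpr ?_ ha
    -- As `B`, `D`, `P` partition the indices, the product of all the `u_j` is `b c p`, which equals
    -- `(v b) (w c)` in the chart.
    have h1 : (∏ j, MvPowerSeries.X (Sum.inl j) : RingP d K) =
        prodX K (inlF β.B) * prodX K (inlF β.D) * prodX K (inlF β.P) := by
      rw [← prodX_union β.separated.BD, ← prodX_union (Finset.disjoint_union_left.mpr
        ⟨β.separated.BP, β.separated.DP⟩), ← Finset.map_union, ← Finset.map_union, β.union, prodX,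
        Finset.prod_map]
      rfl
    rw [RingHom.mem_ker, map_sub, map_mul, of_x, of_y, h1, map_mul, map_mul]
    have h2 := v_mul_w (K := K) (β := β)
    linear_combination (uprod K β β.B * uprod K β β.D) * h2

variable {K β}

theorem structureMap_mk (f : RingP d K) :
    structureMap K β (Ideal.Quotient.mk _ f) = of K β f := Ideal.Quotient.lift_mk ..

theorem structureMap_x : structureMap K β (xT d K) = v K β * uprod K β β.B := by
  rw [xT, structureMap_mk, of_x]

theorem structureMap_y : structureMap K β (yT d K) = w K β * uprod K β β.D := by
  rw [yT, structureMap_mk, of_y]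

theorem structureMap_u (j : Fin (d + 1)) : structureMap K β (uT d K j) = u K β j := by
  rw [uT, structureMap_mk]

theorem structureMap_prod (A : Finset (Fin (d + 1))) :
    structureMap K β (∏ j ∈ A, uT d K j) = uprod K β A := by
  rw [map_prod, uprod_eq]
  exact Finset.prod_congr rfl fun j _ ↦ structureMap_u j

theorem comp_structureMap {β' : Block d} {C : Type*} [CommRing C] {f : Ch K β →+* C}
    {g : Ch K β' →+* C} (h : ∀ a, f (of K β a) = g (of K β' a)) :
    f.comp (structureMap K β) = g.comp (structureMap K β') :=
  Ideal.Quotient.ringHom_ext (RingHom.ext fun a ↦ by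
    simpa [structureMap_mk] using h a)

variable (K β)

/-- The chart of a block as a scheme over `T_S`. -/
def toTS : Spec (.of (Ch K β)) ⟶ TS d K := Spec.map (CommRingCat.ofHom (structureMap K β))

variable {K β}

theorem toTS_asIdeal (q : Spec (.of (Ch K β))) :
    PrimeSpectrum.asIdeal (toTS K β q) = (PrimeSpectrum.asIdeal q).comap (structureMap K β) := rfl

/-- The ideal of a branch of `V(x, u_j)` with `j ∈ P`. -/
theorem span_v_u_isPrime {j : Fin (d + 1)} (hj : j ∈ β.P) :
    (Ideal.span {v K β, u K β j}).IsPrime ∧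
      ∀ f, of K β f ∈ Ideal.span {v K β, u K β j} → f ∈ varIdeal K {Sum.inr 0, Sum.inl j} := by
  have := MonChart.vIdeal_singleton_isPrime (K := K) β.separated (inl_mem_inlF.mpr hj)
  rwa [MonChart.vIdeal, Finset.coe_singleton, Set.image_singleton] at this

theorem span_w_u_isPrime {j : Fin (d + 1)} (hj : j ∈ β.P) :
    (Ideal.span {w K β, u K β j}).IsPrime ∧
      ∀ f, of K β f ∈ Ideal.span {w K β, u K β j} → f ∈ varIdeal K {Sum.inr 1, Sum.inl j} := by
  have := MonChart.wIdeal_singleton_isPrime (K := K) β.separated (inl_mem_inlF.mpr hj)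
  rwa [MonChart.wIdeal, Finset.coe_singleton, Set.image_singleton] at this

theorem span_u_isPrime_of_mem_B {j : Fin (d + 1)} (hj : j ∈ β.B) :
    (Ideal.span {u K β j}).IsPrime ∧
      ∀ f, of K β f ∈ Ideal.span {u K β j} → f ∈ varIdeal K {Sum.inl j, Sum.inr 0} :=
  MonChart.span_var_isPrime_of_mem_left β.separated (inl_mem_inlF.mpr hj)

theorem span_u_isPrime_of_mem_D {j : Fin (d + 1)} (hj : j ∈ β.D) :
    (Ideal.span {u K β j}).IsPrime ∧
      ∀ f, of K β f ∈ Ideal.span {u K β j} → f ∈ varIdeal K {Sum.inl j, Sum.inr 1} :=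
  MonChart.span_var_isPrime_of_mem_right β.separated (inl_mem_inlF.mpr hj)

theorem mem_span_pair_iff {A : Finset (Fin (d + 1))} {a : Ch K β} :
    a ∈ Ideal.span {uprod K β (β.B ∩ A) * v K β,
      uprod K β (β.B ∩ A) * uprod K β (β.P ∩ A)} ↔
    (∀ j ∈ β.B ∩ A, a ∈ Ideal.span {u K β j}) ∧
      ∀ j ∈ β.P ∩ A, a ∈ Ideal.span {v K β, u K β j} := by
  rw [MonChart.mem_span_pair_iff β.separated (Finset.map_subset_map.mpr Finset.inter_subset_left)
    (Finset.map_subset_map.mpr Finset.inter_subset_left)]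
  simp only [Finset.forall_mem_map]
  refine and_congr Iff.rfl (forall₂_congr fun j hj ↦ ?_)
  rw [MonChart.vIdeal, Finset.coe_singleton, Set.image_singleton]
  rfl

theorem exists_isBlowupChart_left (β : Block d) (A : Finset (Fin (d + 1))) :
    ∃ ψ : CommRingCat.of (Ch K β) ⟶ CommRingCat.of (Ch K (β.left A)),
      IsBlowupChart ψ (uprod K β (β.B ∩ A) * v K β)
        (uprod K β (β.B ∩ A) * uprod K β (β.P ∩ A)) ∧
      Spec.map ψ ≫ toTS K β = toTS K (β.left A) := by
  obtain ⟨ψ, h1, h2⟩ : ∃ ψ : CommRingCat.of (Ch K β) ⟶ CommRingCat.of (Ch K (β.left A)),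
      IsBlowupChart ψ (uprod K β (β.B ∩ A) * v K β) (uprod K β (β.B ∩ A) * uprod K β (β.P ∩ A)) ∧
      ∀ f, ψ.hom (of K β f) = of K (β.left A) f := MonChart.exists_isBlowupChart_left (K := K) (B := inlF β.B) (D := inlF β.D)
    (P := inlF β.P) (P₁ := inlF (β.P ∩ A)) (P₂ := inlF (β.P \ A)) (E := inlF (β.B ∩ A))
    (β.left A).separated
    (by rw [← Finset.map_union, Finset.union_comm, Finset.sdiff_union_inter])
    (by rw [← Finset.map_union]; rfl)
    ((Finset.disjoint_map _).mpr (Finset.disjoint_sdiff_inter _ _).symm)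
    ((Finset.disjoint_map _).mpr (β.DP.mono_right Finset.sdiff_subset))
    (Finset.map_subset_map.mpr Finset.inter_subset_left)
  refine ⟨ψ, h1, ?_⟩
  rw [toTS, toTS, ← Spec.map_comp]
  congr 1
  ext1
  exact comp_structureMap (g := RingHom.id _) h2

theorem exists_isBlowupChart_right (β : Block d) (A : Finset (Fin (d + 1))) :
    ∃ ψ : CommRingCat.of (Ch K β) ⟶ CommRingCat.of (Ch K (β.right A)),
      IsBlowupChart ψ (uprod K β (β.B ∩ A) * uprod K β (β.P ∩ A))
        (uprod K β (β.B ∩ A) * v K β) ∧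
      Spec.map ψ ≫ toTS K β = toTS K (β.right A) := by
  obtain ⟨ψ, h1, h2⟩ : ∃ ψ : CommRingCat.of (Ch K β) ⟶ CommRingCat.of (Ch K (β.right A)),
      IsBlowupChart ψ (uprod K β (β.B ∩ A) * uprod K β (β.P ∩ A)) (uprod K β (β.B ∩ A) * v K β) ∧
      ∀ f, ψ.hom (of K β f) = of K (β.right A) f := MonChart.exists_isBlowupChart_right (K := K) (B := inlF β.B) (D := inlF β.D)
    (P := inlF β.P) (P₁ := inlF (β.P ∩ A)) (P₂ := inlF (β.P \ A)) (E := inlF (β.B ∩ A))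
    (β.right A).separated
    (by rw [← Finset.map_union, Finset.union_comm, Finset.sdiff_union_inter])
    (by rw [← Finset.map_union]; rfl)
    ((Finset.disjoint_map _).mpr (Finset.disjoint_sdiff_inter _ _).symm)
    ((Finset.disjoint_map _).mpr (β.BP.mono_right Finset.inter_subset_left))
    (Finset.map_subset_map.mpr Finset.inter_subset_left)
  refine ⟨ψ, h1, ?_⟩
  rw [toTS, toTS, ← Spec.map_comp]
  congr 1
  ext1
  exact comp_structureMap (g := RingHom.id _) h2

end Ch

/-! ### Points of `T_S` -/

theorem specializes_iff_asIdeal_le {R : CommRingCat.{u}} {p q : Spec R} :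
    p ⤳ q ↔ PrimeSpectrum.asIdeal p ≤ PrimeSpectrum.asIdeal q :=
  (PrimeSpectrum.le_iff_specializes (R := R) p q).symm

/-- The generic point of the locus where the variables in `Z`, and `x` or `y`, vanish. -/
theorem exists_generic (t : Fin 2) {Z : Finset (Fin (d + 1))} (hZ : Z.Nonempty) :
    ∃ ξ : TS d K, ∀ f, (Ideal.Quotient.mk _ f : RingT d K) ∈ PrimeSpectrum.asIdeal ξ ↔
      f ∈ varIdeal K (insert (Sum.inr t) (inlF Z)) := by
  have hle : Ideal.span {(MvPowerSeries.X (Sum.inr 0) * MvPowerSeries.X (Sum.inr 1) -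
      ∏ j : Fin (d + 1), MvPowerSeries.X (Sum.inl j) : RingP d K)} ≤
      varIdeal K (insert (Sum.inr t) (inlF Z)) := by
    rw [Ideal.span_singleton_le_iff_mem]
    refine sub_mem ?_ ?_
    · fin_cases t
      · exact Ideal.mul_mem_right _ _ (X_mem_varIdeal.mpr (by simp))
      · exact Ideal.mul_mem_left _ _ (X_mem_varIdeal.mpr (by simp))
    · obtain ⟨j, hj⟩ := hZ
      exact Ideal.mem_of_dvd _ (Finset.dvd_prod_of_mem _ (Finset.mem_univ j))
        (X_mem_varIdeal.mpr (by simp [hj]))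
  refine ⟨⟨(varIdeal K (insert (Sum.inr t) (inlF Z))).map (Ideal.Quotient.mk _),
    Ideal.map_isPrime_of_surjective Ideal.Quotient.mk_surjective (by rwa [Ideal.mk_ker])⟩,
    fun f ↦ ?_⟩
  rw [Ideal.mem_quotient_iff_mem_sup, sup_eq_left.mpr hle]

variable (K) in
/-- The generic point of the locus where the variables in `Z`, and `x` or `y`, vanish. -/
def genericT (t : Fin 2) {Z : Finset (Fin (d + 1))} (hZ : Z.Nonempty) : TS d K :=
  (exists_generic t hZ).choose

theorem mk_mem_genericT {t : Fin 2} {Z : Finset (Fin (d + 1))} {hZ : Z.Nonempty} {f : RingP d K} :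
    (Ideal.Quotient.mk _ f : RingT d K) ∈ PrimeSpectrum.asIdeal (genericT K t hZ) ↔
      f ∈ varIdeal K (insert (Sum.inr t) (inlF Z)) := (exists_generic t hZ).choose_spec f

theorem genericT_specializes {t : Fin 2} {Z : Finset (Fin (d + 1))} {hZ : Z.Nonempty}
    {p : TS d K} : genericT K t hZ ⤳ p ↔
      Ideal.Quotient.mk _ (MvPowerSeries.X (Sum.inr t)) ∈ PrimeSpectrum.asIdeal p ∧
        ∀ j ∈ Z, uT d K j ∈ PrimeSpectrum.asIdeal p := by
  rw [specializes_iff_asIdeal_le]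
  constructor
  · intro h
    exact ⟨h (mk_mem_genericT.mpr (X_mem_varIdeal.mpr (by simp))),
      fun j hj ↦ h (mk_mem_genericT.mpr (X_mem_varIdeal.mpr (by simp [hj])))⟩
  · rintro ⟨h1, h2⟩ a ha
    obtain ⟨f, rfl⟩ := Ideal.Quotient.mk_surjective a
    rw [mk_mem_genericT] at ha
    have : varIdeal K (insert (Sum.inr t) (inlF Z)) ≤
        (PrimeSpectrum.asIdeal p).comap (Ideal.Quotient.mk _) := by
      rw [varIdeal, Ideal.span_le]
      rintro _ ⟨l, hl, rfl⟩
      rw [Finset.coe_insert, Set.mem_insert_iff] at hl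
      obtain rfl | hl := hl
      · exact h1
      · rw [Finset.mem_coe, Finset.mem_map] at hl
        obtain ⟨j, hj, rfl⟩ := hl
        exact h2 j hj
    exact this ha

theorem yT_notMem_genericT {Z : Finset (Fin (d + 1))} {hZ : Z.Nonempty} :
    yT d K ∉ PrimeSpectrum.asIdeal (genericT K 0 hZ) := by
  rw [yT, mk_mem_genericT, X_mem_varIdeal]
  simp

theorem xT_notMem_genericT {Z : Finset (Fin (d + 1))} {hZ : Z.Nonempty} :
    xT d K ∉ PrimeSpectrum.asIdeal (genericT K 1 hZ) := by
  rw [xT, mk_mem_genericT, X_mem_varIdeal]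
  simp

theorem mem_divX {A : Finset (Fin (d + 1))} {p : TS d K} : p ∈ divX K A ↔
    xT d K ∈ PrimeSpectrum.asIdeal p ∧ ∃ j ∈ A, uT d K j ∈ PrimeSpectrum.asIdeal p := by
  change ({xT d K, ∏ j ∈ A, uT d K j} : Set (RingT d K)) ⊆ PrimeSpectrum.asIdeal p ↔ _
  rw [Set.pair_subset_iff]
  exact and_congr_right fun _ ↦ (PrimeSpectrum.isPrime p).prod_mem_iff

theorem mem_divY {A : Finset (Fin (d + 1))} {p : TS d K} : p ∈ divY K A ↔
    yT d K ∈ PrimeSpectrum.asIdeal p ∧ ∃ j ∈ A, uT d K j ∈ PrimeSpectrum.asIdeal p := by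
  change ({yT d K, ∏ j ∈ A, uT d K j} : Set (RingT d K)) ⊆ PrimeSpectrum.asIdeal p ↔ _
  rw [Set.pair_subset_iff]
  exact and_congr_right fun _ ↦ (PrimeSpectrum.isPrime p).prod_mem_iff

theorem mem_branchX {p : TS d K} : p ∈ branchX K ↔
    xT d K ∈ PrimeSpectrum.asIdeal p ∧ ∀ j, uT d K j ∈ PrimeSpectrum.asIdeal p := by
  change insert (xT d K) (Set.range (uT d K)) ⊆ (PrimeSpectrum.asIdeal p : Set (RingT d K)) ↔ _
  rw [Set.insert_subset_iff, Set.range_subset_iff]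
  rfl

theorem mem_branchY {p : TS d K} : p ∈ branchY K ↔
    yT d K ∈ PrimeSpectrum.asIdeal p ∧ ∀ j, uT d K j ∈ PrimeSpectrum.asIdeal p := by
  change insert (yT d K) (Set.range (uT d K)) ⊆ (PrimeSpectrum.asIdeal p : Set (RingT d K)) ↔ _
  rw [Set.insert_subset_iff, Set.range_subset_iff]
  rfl

end ChartsOverT

/-! ### Strict transforms -/

section StrictTransform

theorem exists_opens_ι_eq {X : Scheme.{u}} {U : X.Opens} {p : X} (h : p ∈ U) :
    ∃ z : U.toScheme, U.ι z = p := ⟨⟨p, h⟩, rfl⟩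

theorem exists_section_of_isIso {X Y : Scheme.{u}} (f : X ⟶ Y) (U : Y.Opens) [IsIso (f ∣_ U)] :
    ∃ s : U.toScheme ⟶ X, (∀ z, f (s z) = U.ι z) ∧
      ∀ (p : X) (z : U.toScheme), U.ι z = f p → s z = p := by
  have hs : (inv (f ∣_ U) ≫ (f ⁻¹ᵁ U).ι) ≫ f = U.ι := by
    rw [Category.assoc, ← morphismRestrict_ι, IsIso.inv_hom_id_assoc]
  refine ⟨inv (f ∣_ U) ≫ (f ⁻¹ᵁ U).ι, fun z ↦ by rw [← Scheme.Hom.comp_apply, hs],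
    fun p z h ↦ ?_⟩
  obtain ⟨p', rfl⟩ : ∃ p', (f ⁻¹ᵁ U).ι p' = p :=
    exists_opens_ι_eq (show f p ∈ U from h ▸ z.2)
  obtain rfl : (f ∣_ U) p' = z := by
    apply U.ι.isOpenEmbedding.injective
    rw [h, ← Scheme.Hom.comp_apply, ← Scheme.Hom.comp_apply, morphismRestrict_ι]
  rw [← Scheme.Hom.comp_apply, IsIso.hom_inv_id_assoc]

/-- `isoLocus` is a union of opens, over each of which `f` is an isomorphism. The open chosen for `f
p` contains its generization `ξ`, so the section over it lifts the specialization; the sections over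
the two opens give the same lift of `ξ`. -/
theorem exists_preimage_specializes {X Y : Scheme.{u}} (f : X ⟶ Y) {ξ : Y}
    (hξ : ξ ∈ isoLocus f) :
    ∃ ξ' : X, f ξ' = ξ ∧ ∀ p, f p ∈ isoLocus f → ξ ⤳ f p → ξ' ⤳ p := by
  obtain ⟨(U : Y.Opens), hU, hξU⟩ := TopologicalSpace.Opens.mem_sSup.mp hξ
  have := show IsIso (f ∣_ U) from hU
  obtain ⟨s, hs, hs'⟩ := exists_section_of_isIso f U
  obtain ⟨z, hz⟩ := exists_opens_ι_eq hξU
  refine ⟨s z, (hs z).trans hz, fun p hp hsp ↦ ?_⟩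
  obtain ⟨(V : Y.Opens), hV, hpV⟩ := TopologicalSpace.Opens.mem_sSup.mp hp
  have := show IsIso (f ∣_ V) from hV
  obtain ⟨s', hs1, hs2⟩ := exists_section_of_isIso f V
  obtain ⟨z', hz'⟩ := exists_opens_ι_eq (hsp.mem_open V.2 hpV : ξ ∈ V)
  obtain ⟨z'', hz''⟩ := exists_opens_ι_eq hpV
  have h1 : s' z' ⤳ p := by
    rw [← hs2 p z'' hz'']
    refine Specializes.map ?_ s'.continuous
    rwa [← V.ι.isOpenEmbedding.isInducing.specializes_iff, hz', hz'']
  rwa [hs' (s' z') z (by rw [hz, hs1, hz'])]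

/-- Finiteness of `A` makes the union of the closures of the lifted generic points closed, so the
strict transform is no larger than this union. -/
theorem mem_strictTransform_iff {X Y : Scheme.{u}} {f : X ⟶ Y} {Z : Set Y} {J : Type*}
    (A : Finset J) (g : J → Y) (hZ : ∀ p, p ∈ Z ↔ ∃ j ∈ A, g j ⤳ p)
    (hg : ∀ j ∈ A, g j ∈ isoLocus f) (p : X) :
    p ∈ strictTransform f Z ↔ ∃ j ∈ A, ∃ ξ, f ξ = g j ∧ ξ ⤳ p := by
  constructor
  · have : Nonempty X := ⟨p⟩
    choose! ξ h1 h2 using fun j hj ↦ exists_preimage_specializes f (hg j hj)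
    have hcl : IsClosed (⋃ j ∈ A, closure {ξ j}) :=
      A.finite_toSet.isClosed_biUnion fun _ _ ↦ isClosed_closure
    intro hp
    have : p ∈ ⋃ j ∈ A, closure {ξ j} := by
      refine closure_minimal ?_ hcl hp
      rintro z ⟨hz, hz'⟩
      obtain ⟨j, hj, hjz⟩ := (hZ _).mp hz
      exact Set.mem_biUnion hj (specializes_iff_mem_closure.mp (h2 j hj z hz' hjz))
    simp only [Set.mem_iUnion] at this
    obtain ⟨j, hj, hp⟩ := this
    exact ⟨j, hj, ξ j, h1 j hj, specializes_iff_mem_closure.mpr hp⟩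
  · rintro ⟨j, hj, ξ, hξ, hp⟩
    refine hp.mem_closed isClosed_closure (subset_closure ⟨?_, ?_⟩)
    · exact (hZ _).mpr ⟨j, hj, by rw [hξ]⟩
    · rw [hξ]
      exact hg j hj

theorem mem_strictTransform_of_specializes {X Y : Scheme.{u}} {f : X ⟶ Y} {Z : Set Y} {ξ p : X}
    (h1 : f ξ ∈ Z) (h2 : f ξ ∈ isoLocus f) (h : ξ ⤳ p) : p ∈ strictTransform f Z :=
  h.mem_closed isClosed_closure (subset_closure ⟨h1, h2⟩)

theorem exists_specializes_of_isOpenImmersion {X Y : Scheme.{u}} (ι : X ⟶ Y) [IsOpenImmersion ι]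
    {ξ : Y} {q : X} (h : ξ ⤳ ι q) : ∃ q', ι q' = ξ ∧ q' ⤳ q := by
  obtain ⟨q', rfl⟩ : ξ ∈ Set.range ι := h.mem_open ι.isOpenEmbedding.isOpen_range ⟨q, rfl⟩
  exact ⟨q', rfl, ι.isOpenEmbedding.isInducing.specializes_iff.mp h⟩

variable {d : ℕ} {K : Type u} [Field K] {X : Scheme.{u}} {φ : X ⟶ TS d K} {β : Block d}

/-- The basic open subset of `T_S` on which `f` does not vanish. -/
def basicOpenT (f : RingT d K) : (TS d K).Opens := PrimeSpectrum.basicOpen f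

theorem mem_basicOpenT {f : RingT d K} {p : TS d K} :
    p ∈ basicOpenT f ↔ f ∉ PrimeSpectrum.asIdeal p := Iff.rfl

theorem toTS_apply {ι : Spec (.of (Ch K β)) ⟶ X} (hι : ι ≫ φ = Ch.toTS K β)
    (q : Spec (.of (Ch K β))) : φ (ι q) = Ch.toTS K β q := by
  rw [← hι, Scheme.Hom.comp_apply]

theorem mem_asIdeal_apply {ι : Spec (.of (Ch K β)) ⟶ X} (hι : ι ≫ φ = Ch.toTS K β)
    (q : Spec (.of (Ch K β))) {f : RingT d K} :
    f ∈ PrimeSpectrum.asIdeal (φ (ι q)) ↔ Ch.structureMap K β f ∈ PrimeSpectrum.asIdeal q := by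
  rw [toTS_apply hι, Ch.toTS_asIdeal, Ideal.mem_comap]

theorem mem_divX_iff_exists {A : Finset (Fin (d + 1))} (p : TS d K) : p ∈ divX K A ↔
    ∃ j ∈ A, genericT K 0 (Finset.singleton_nonempty j) ⤳ p := by
  simp only [mem_divX, genericT_specializes, Finset.mem_singleton, forall_eq]
  exact ⟨fun ⟨h1, j, hj, h2⟩ ↦ ⟨j, hj, h1, h2⟩, fun ⟨j, hj, h1, h2⟩ ↦ ⟨h1, j, hj, h2⟩⟩

theorem mem_divY_iff_exists {A : Finset (Fin (d + 1))} (p : TS d K) : p ∈ divY K A ↔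
    ∃ j ∈ A, genericT K 1 (Finset.singleton_nonempty j) ⤳ p := by
  simp only [mem_divY, genericT_specializes, Finset.mem_singleton, forall_eq]
  exact ⟨fun ⟨h1, j, hj, h2⟩ ↦ ⟨j, hj, h1, h2⟩, fun ⟨j, hj, h1, h2⟩ ↦ ⟨h1, j, hj, h2⟩⟩

/-- At the generic point of `V(x, u_j)` the element `y = c w` is nonzero, so `j ∉ D` and `w ≠ 0`; if
`j ∈ P`, then `v w = p` forces `v = 0`. Conversely the primes `(u_j)` for `j ∈ B` and `(v, u_j)` for
`j ∈ P` contain `x` and avoid `y`, so they lie over the locus where `φ` is an isomorphism. -/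
theorem mem_strictTransform_divX (hφ : basicOpenT (yT d K) ≤ isoLocus φ)
    {ι : Spec (.of (Ch K β)) ⟶ X} [IsOpenImmersion ι] (hι : ι ≫ φ = Ch.toTS K β)
    {A : Finset (Fin (d + 1))} {q : Spec (.of (Ch K β))} :
    ι q ∈ strictTransform φ (divX K A) ↔
      (∃ j ∈ β.B ∩ A, Ch.u K β j ∈ PrimeSpectrum.asIdeal q) ∨
      (∃ j ∈ β.P ∩ A, Ch.v K β ∈ PrimeSpectrum.asIdeal q ∧
        Ch.u K β j ∈ PrimeSpectrum.asIdeal q) := by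
  constructor
  · intro h
    obtain ⟨j, hj, ξ, hξ, hξq⟩ := (mem_strictTransform_iff A _ mem_divX_iff_exists
      (fun j _ ↦ hφ (mem_basicOpenT.mpr yT_notMem_genericT)) _).mp h
    obtain ⟨q', rfl, hq⟩ := exists_specializes_of_isOpenImmersion ι hξq
    rw [specializes_iff_asIdeal_le] at hq
    have := PrimeSpectrum.isPrime q'
    have hx : xT d K ∈ PrimeSpectrum.asIdeal (φ (ι q')) := by
      rw [hξ, xT, mk_mem_genericT, X_mem_varIdeal]; simp
    have hu : uT d K j ∈ PrimeSpectrum.asIdeal (φ (ι q')) := by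
      rw [hξ, uT, mk_mem_genericT, X_mem_varIdeal]; simp
    have hy : yT d K ∉ PrimeSpectrum.asIdeal (φ (ι q')) := by
      rw [hξ]; exact yT_notMem_genericT
    rw [mem_asIdeal_apply hι] at hx hu hy
    rw [Ch.structureMap_y] at hy
    rw [Ch.structureMap_u] at hu
    have hw : Ch.w K β ∉ PrimeSpectrum.asIdeal q' := fun h ↦ hy (Ideal.mul_mem_right _ _ h)
    have hD : j ∉ β.D := fun h ↦ hy (Ideal.mul_mem_left _ _ (Ch.uprod_mem_iff.mpr ⟨j, h, hu⟩))
    have hj' : j ∈ β.B ∪ β.D ∪ β.P := β.union ▸ Finset.mem_univ j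
    simp only [Finset.mem_union] at hj'
    obtain (hB | hB) | hP := hj'
    · exact .inl ⟨j, Finset.mem_inter.mpr ⟨hB, hj⟩, hq hu⟩
    · exact absurd hB hD
    · refine .inr ⟨j, Finset.mem_inter.mpr ⟨hP, hj⟩, hq ?_, hq hu⟩
      have h1 : Ch.v K β * Ch.w K β ∈ PrimeSpectrum.asIdeal q' := by
        rw [Ch.v_mul_w]
        exact Ch.uprod_mem_iff.mpr ⟨j, hP, hu⟩
      exact ((PrimeSpectrum.isPrime q').mem_or_mem h1).resolve_right hw
  · rintro (⟨j, hj, hq⟩ | ⟨j, hj, hv, hq⟩) <;> obtain ⟨hj, hjA⟩ := Finset.mem_inter.mp hj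
    · obtain ⟨h1, h2⟩ := Ch.span_u_isPrime_of_mem_B (K := K) hj
      have h3 : Ch.u K β j ∈ Ideal.span {Ch.u K β j} := Ideal.mem_span_singleton_self _
      let q' : Spec (.of (Ch K β)) := ⟨_, h1⟩
      refine mem_strictTransform_of_specializes (ξ := ι q') ?_ (hφ ?_)
        (Specializes.map ?_ ι.continuous)
      · rw [mem_divX, mem_asIdeal_apply hι, Ch.structureMap_x]
        refine ⟨Ideal.mul_mem_left _ _ (Ch.uprod_mem_iff.mpr ⟨j, hj, h3⟩), j, hjA, ?_⟩
        rw [mem_asIdeal_apply hι, Ch.structureMap_u]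
        exact h3
      · rw [mem_basicOpenT, mem_asIdeal_apply hι, yT, Ch.structureMap_mk]
        intro h
        have := X_mem_varIdeal.mp (h2 _ h)
        simp at this
      · rw [specializes_iff_asIdeal_le]
        exact (Ideal.span_singleton_le_iff_mem _).mpr hq
    · obtain ⟨h1, h2⟩ := Ch.span_v_u_isPrime (K := K) hj
      have h3 : Ch.u K β j ∈ Ideal.span {Ch.v K β, Ch.u K β j} := Ideal.subset_span (by simp)
      have h4 : Ch.v K β ∈ Ideal.span {Ch.v K β, Ch.u K β j} := Ideal.subset_span (by simp)
      let q' : Spec (.of (Ch K β)) := ⟨_, h1⟩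
      refine mem_strictTransform_of_specializes (ξ := ι q') ?_ (hφ ?_)
        (Specializes.map ?_ ι.continuous)
      · rw [mem_divX, mem_asIdeal_apply hι, Ch.structureMap_x]
        refine ⟨Ideal.mul_mem_right _ _ h4, j, hjA, ?_⟩
        rw [mem_asIdeal_apply hι, Ch.structureMap_u]
        exact h3
      · rw [mem_basicOpenT, mem_asIdeal_apply hι, yT, Ch.structureMap_mk]
        intro h
        have := X_mem_varIdeal.mp (h2 _ h)
        simp at this
      · rw [specializes_iff_asIdeal_le]
        exact Ideal.span_le.mpr (Set.pair_subset hv hq)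

theorem mem_strictTransform_divY (hφ : basicOpenT (xT d K) ≤ isoLocus φ)
    {ι : Spec (.of (Ch K β)) ⟶ X} [IsOpenImmersion ι] (hι : ι ≫ φ = Ch.toTS K β)
    {A : Finset (Fin (d + 1))} {q : Spec (.of (Ch K β))} :
    ι q ∈ strictTransform φ (divY K A) ↔
      (∃ j ∈ β.D ∩ A, Ch.u K β j ∈ PrimeSpectrum.asIdeal q) ∨
      (∃ j ∈ β.P ∩ A, Ch.w K β ∈ PrimeSpectrum.asIdeal q ∧
        Ch.u K β j ∈ PrimeSpectrum.asIdeal q) := by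
  constructor
  · intro h
    obtain ⟨j, hj, ξ, hξ, hξq⟩ := (mem_strictTransform_iff A _ mem_divY_iff_exists
      (fun j _ ↦ hφ (mem_basicOpenT.mpr xT_notMem_genericT)) _).mp h
    obtain ⟨q', rfl, hq⟩ := exists_specializes_of_isOpenImmersion ι hξq
    rw [specializes_iff_asIdeal_le] at hq
    have := PrimeSpectrum.isPrime q'
    have hu : uT d K j ∈ PrimeSpectrum.asIdeal (φ (ι q')) := by
      rw [hξ, uT, mk_mem_genericT, X_mem_varIdeal]; simp
    have hx : xT d K ∉ PrimeSpectrum.asIdeal (φ (ι q')) := by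
      rw [hξ]; exact xT_notMem_genericT
    rw [mem_asIdeal_apply hι] at hx hu
    rw [Ch.structureMap_x] at hx
    rw [Ch.structureMap_u] at hu
    have hv : Ch.v K β ∉ PrimeSpectrum.asIdeal q' := fun h ↦ hx (Ideal.mul_mem_right _ _ h)
    have hB : j ∉ β.B := fun h ↦ hx (Ideal.mul_mem_left _ _ (Ch.uprod_mem_iff.mpr ⟨j, h, hu⟩))
    have hj' : j ∈ β.B ∪ β.D ∪ β.P := β.union ▸ Finset.mem_univ j
    simp only [Finset.mem_union] at hj'
    obtain (hD | hD) | hP := hj'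
    · exact absurd hD hB
    · exact .inl ⟨j, Finset.mem_inter.mpr ⟨hD, hj⟩, hq hu⟩
    · refine .inr ⟨j, Finset.mem_inter.mpr ⟨hP, hj⟩, hq ?_, hq hu⟩
      have h1 : Ch.v K β * Ch.w K β ∈ PrimeSpectrum.asIdeal q' := by
        rw [Ch.v_mul_w]
        exact Ch.uprod_mem_iff.mpr ⟨j, hP, hu⟩
      exact ((PrimeSpectrum.isPrime q').mem_or_mem h1).resolve_left hv
  · rintro (⟨j, hj, hq⟩ | ⟨j, hj, hv, hq⟩) <;> obtain ⟨hj, hjA⟩ := Finset.mem_inter.mp hj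
    · obtain ⟨h1, h2⟩ := Ch.span_u_isPrime_of_mem_D (K := K) hj
      have h3 : Ch.u K β j ∈ Ideal.span {Ch.u K β j} := Ideal.mem_span_singleton_self _
      let q' : Spec (.of (Ch K β)) := ⟨_, h1⟩
      refine mem_strictTransform_of_specializes (ξ := ι q') ?_ (hφ ?_)
        (Specializes.map ?_ ι.continuous)
      · rw [mem_divY, mem_asIdeal_apply hι, Ch.structureMap_y]
        refine ⟨Ideal.mul_mem_left _ _ (Ch.uprod_mem_iff.mpr ⟨j, hj, h3⟩), j, hjA, ?_⟩
        rw [mem_asIdeal_apply hι, Ch.structureMap_u]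
        exact h3
      · rw [mem_basicOpenT, mem_asIdeal_apply hι, xT, Ch.structureMap_mk]
        intro h
        have := X_mem_varIdeal.mp (h2 _ h)
        simp at this
      · rw [specializes_iff_asIdeal_le]
        exact (Ideal.span_singleton_le_iff_mem _).mpr hq
    · obtain ⟨h1, h2⟩ := Ch.span_w_u_isPrime (K := K) hj
      have h3 : Ch.u K β j ∈ Ideal.span {Ch.w K β, Ch.u K β j} := Ideal.subset_span (by simp)
      have h4 : Ch.w K β ∈ Ideal.span {Ch.w K β, Ch.u K β j} := Ideal.subset_span (by simp)
      let q' : Spec (.of (Ch K β)) := ⟨_, h1⟩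
      refine mem_strictTransform_of_specializes (ξ := ι q') ?_ (hφ ?_)
        (Specializes.map ?_ ι.continuous)
      · rw [mem_divY, mem_asIdeal_apply hι, Ch.structureMap_y]
        refine ⟨Ideal.mul_mem_right _ _ h4, j, hjA, ?_⟩
        rw [mem_asIdeal_apply hι, Ch.structureMap_u]
        exact h3
      · rw [mem_basicOpenT, mem_asIdeal_apply hι, xT, Ch.structureMap_mk]
        intro h
        have := X_mem_varIdeal.mp (h2 _ h)
        simp at this
      · rw [specializes_iff_asIdeal_le]
        exact Ideal.span_le.mpr (Set.pair_subset hv hq)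

/-- The ideal of the centre of the next blowup in a chart. -/
theorem pullIdeal_strictTransform_divX (hφ : basicOpenT (yT d K) ≤ isoLocus φ)
    {ι : Spec (.of (Ch K β)) ⟶ X} [IsOpenImmersion ι] (hι : ι ≫ φ = Ch.toTS K β)
    (A : Finset (Fin (d + 1))) :
    pullIdeal (Scheme.IdealSheafData.vanishingIdeal
      ⟨strictTransform φ (divX K A), isClosed_closure⟩) ι =
      Ideal.span {Ch.uprod K β (β.B ∩ A) * Ch.v K β,
        Ch.uprod K β (β.B ∩ A) * Ch.uprod K β (β.P ∩ A)} := by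
  ext a
  rw [mem_pullIdeal_vanishingIdeal]
  refine Iff.trans ?_ Ch.mem_span_pair_iff.symm
  constructor
  · intro h
    refine ⟨fun j hj ↦ ?_, fun j hj ↦ ?_⟩
    · obtain ⟨h1, -⟩ := Ch.span_u_isPrime_of_mem_B (K := K) (Finset.mem_inter.mp hj).1
      exact h ⟨_, h1⟩ ((mem_strictTransform_divX hφ hι).mpr
        (.inl ⟨j, hj, Ideal.mem_span_singleton_self _⟩))
    · obtain ⟨h1, -⟩ := Ch.span_v_u_isPrime (K := K) (Finset.mem_inter.mp hj).1
      exact h ⟨_, h1⟩ ((mem_strictTransform_divX hφ hι).mpr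
        (.inr ⟨j, hj, Ideal.subset_span (by simp), Ideal.subset_span (by simp)⟩))
  · rintro ⟨h1, h2⟩ q hq
    obtain ⟨j, hj, h⟩ | ⟨j, hj, h, h'⟩ := (mem_strictTransform_divX hφ hι).mp hq
    · exact (Ideal.span_singleton_le_iff_mem _).mpr h (h1 j hj)
    · exact Ideal.span_le.mpr (Set.pair_subset h h') (h2 j hj)

end StrictTransform

/-! ### The charts of an iterated blowup -/

section HasCharts

variable {d : ℕ} {K : Type u} [Field K]

theorem hom_ext_of_away {C : CommRingCat.{u}} {X : Scheme.{u}} {g₁ g₂ : Spec C ⟶ X}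
    (h : ∀ q : Spec C, ∃ f : C, f ∉ PrimeSpectrum.asIdeal q ∧
      Spec.map (awayMap f) ≫ g₁ = Spec.map (awayMap f) ≫ g₂) : g₁ = g₂ := by
  refine Scheme.hom_ext_of_forall _ _ fun q ↦ ?_
  obtain ⟨f, hf, hg⟩ := h q
  refine ⟨(Spec.map (awayMap f)).opensRange, ?_, ?_⟩
  · change q ∈ Set.range (Spec.map (awayMap f))
    rw [range_SpecMap_away]
    exact hf
  · rw [← cancel_epi (Spec.map (awayMap f)).isoOpensRange.hom]
    simpa using hg

/-- The iterated blowup `φ` is covered by the charts of the blocks of `𝒜`, and is an isomorphism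
where `x` or `y` is invertible. -/
structure HasCharts (𝒜 : List (Finset (Fin (d + 1)))) {X : Scheme.{u}} (φ : X ⟶ TS d K) :
    Prop where
  exists_chart : ∀ j, ∃ ι : Spec (.of (Ch K (Block.ofCollection 𝒜 j))) ⟶ X,
    IsOpenImmersion ι ∧ ι ≫ φ = Ch.toTS K _
  cover : ∀ p : X, ∃ j, ∃ ι : Spec (.of (Ch K (Block.ofCollection 𝒜 j))) ⟶ X,
    IsOpenImmersion ι ∧ ι ≫ φ = Ch.toTS K _ ∧ p ∈ Set.range ι
  -- A substitute for separatedness, for sources on which `x` and the `u_j` are nonzerodivisors. It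
  -- identifies charts of the same block and compares consecutive ones.
  hom_ext : ∀ ⦃C : CommRingCat.{u}⦄ (θ : CommRingCat.of (RingT d K) ⟶ C) (g₁ g₂ : Spec C ⟶ X),
    g₁ ≫ φ = Spec.map θ → g₂ ≫ φ = Spec.map θ → θ.hom (xT d K) ∈ nonZeroDivisors C →
    (∀ j, θ.hom (uT d K j) ∈ nonZeroDivisors C) → g₁ = g₂
  isIso_x : IsIso (φ ∣_ basicOpenT (xT d K))
  isIso_y : IsIso (φ ∣_ basicOpenT (yT d K))

theorem HasCharts.x_le {𝒜 : List (Finset (Fin (d + 1)))} {X : Scheme.{u}} {φ : X ⟶ TS d K}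
    (h : HasCharts 𝒜 φ) : basicOpenT (xT d K) ≤ isoLocus φ := le_sSup h.isIso_x

theorem HasCharts.y_le {𝒜 : List (Finset (Fin (d + 1)))} {X : Scheme.{u}} {φ : X ⟶ TS d K}
    (h : HasCharts 𝒜 φ) : basicOpenT (yT d K) ≤ isoLocus φ := le_sSup h.isIso_y

namespace Ch

variable {β : Block d}

theorem uprod_empty : uprod K β ∅ = 1 := by rw [uprod_eq, Finset.prod_empty]

theorem uprod_dvd {A A' : Finset (Fin (d + 1))} (h : A ⊆ A') : uprod K β A ∣ uprod K β A' := by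
  rw [uprod_eq, uprod_eq]
  exact Finset.prod_dvd_prod_of_subset _ _ _ h

theorem prodX_inlF_empty : prodX K (inlF (∅ : Finset (Fin (d + 1)))) = 1 := by simp [prodX]

/-- With `b = c = 1` the coordinates `v`, `w` are `x`, `y`, and the remaining relation is the
equation of `T_S`. -/
theorem isIso_toTS (hB : β.B = ∅) (hD : β.D = ∅) : IsIso (toTS K β) := by
  have hP : β.P = Finset.univ := by simpa [hB, hD] using β.union
  have hb : prodX K (inlF β.B) = 1 := by rw [hB, prodX_inlF_empty]
  have hd : prodX K (inlF β.D) = 1 := by rw [hD, prodX_inlF_empty]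
  have hp : (Ideal.Quotient.mk _ (prodX K (inlF β.P)) : RingT d K) = xT d K * yT d K := by
    rw [hP, xT, yT, ← map_mul, eq_comm, Ideal.Quotient.eq, prodX, Finset.prod_map]
    exact Ideal.subset_span rfl
  obtain ⟨g, hgof, hgv, hgw⟩ : ∃ g : Ch K β →+* RingT d K,
      (∀ a, g (of K β a) = Ideal.Quotient.mk _ a) ∧ g (v K β) = xT d K ∧ g (w K β) = yT d K :=
    ⟨ChartRing.lift (Ideal.Quotient.mk _) (xT d K) (yT d K)
      (by rw [hb, map_one, mul_one]; rfl) (by rw [hd, map_one, mul_one]; rfl) hp.symm,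
      ChartRing.lift_of _ _ _ _ _ _, ChartRing.lift_v _ _ _ _ _ _, ChartRing.lift_w _ _ _ _ _ _⟩
  have h0 : ∀ A : Finset (Fin (d + 1)), A = ∅ → uprod K β A = 1 := by
    rintro _ rfl
    exact uprod_empty
  have h1 : g.comp (structureMap K β) = RingHom.id _ := Ideal.Quotient.ringHom_ext
    (RingHom.ext fun a ↦ by simp [structureMap_mk, hgof])
  have h2 : (structureMap K β).comp g = RingHom.id _ := by
    refine ChartRing.hom_ext (fun a ↦ ?_) ?_ ?_
    · rw [RingHom.comp_apply, hgof, structureMap_mk, RingHom.id_apply]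
    · rw [RingHom.comp_apply, hgv, structureMap_x, h0 _ hB, mul_one, RingHom.id_apply]
    · rw [RingHom.comp_apply, hgw, structureMap_y, h0 _ hD, mul_one, RingHom.id_apply]
  have : IsIso (CommRingCat.ofHom (structureMap K β)) := by
    refine ⟨CommRingCat.ofHom g, ?_, ?_⟩
    · rw [← CommRingCat.ofHom_comp, h1]; rfl
    · rw [← CommRingCat.ofHom_comp, h2]; rfl
  rw [toTS]
  infer_instance

end Ch

theorem hasCharts_nil : HasCharts [] (𝟙 (TS d K)) := by
  have h : ∀ j : Fin (d + 1), IsIso (Ch.toTS K (Block.ofCollection [] j)) := fun j ↦ by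
    refine Ch.isIso_toTS ?_ ?_ <;> ext m <;> simp [not_collectionLT_nil]
  refine ⟨fun j ↦ ⟨Ch.toTS K _, inferInstance, Category.comp_id _⟩, fun p ↦ ⟨0, Ch.toTS K _,
    inferInstance, Category.comp_id _, ?_⟩, fun C θ g₁ g₂ h₁ h₂ _ _ ↦ ?_, inferInstance,
    inferInstance⟩
  · exact (Ch.toTS K (Block.ofCollection [] 0)).homeomorph.surjective p
  · rw [← Category.comp_id g₁, h₁, ← h₂, Category.comp_id]

section Step

variable {𝒜 : List (Finset (Fin (d + 1)))} {A : Finset (Fin (d + 1))} {X X' : Scheme.{u}}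
  {φ : X ⟶ TS d K} {b : X' ⟶ X} {β : Block d} {ι : Spec (.of (Ch K β)) ⟶ X}

theorem exists_chart_left (hy : basicOpenT (yT d K) ≤ isoLocus φ)
    (hb : IsBlowup b (Scheme.IdealSheafData.vanishingIdeal
      ⟨strictTransform φ (divX K A), isClosed_closure⟩)) [IsOpenImmersion ι]
    (hι : ι ≫ φ = Ch.toTS K β) :
    ∃ ι' : Spec (.of (Ch K (β.left A))) ⟶ X', IsOpenImmersion ι' ∧
      ι' ≫ b ≫ φ = Ch.toTS K _ ∧
      ∀ (C : CommRingCat.{u}) (θ : .of (Ch K β) ⟶ C) (w : Spec C ⟶ X'), w ≫ b = Spec.map θ ≫ ι →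
        θ.hom (Ch.uprod K β (β.B ∩ A) * Ch.v K β) ∈ nonZeroDivisors C →
        θ.hom (Ch.uprod K β (β.B ∩ A) * Ch.v K β) ∣
          θ.hom (Ch.uprod K β (β.B ∩ A) * Ch.uprod K β (β.P ∩ A)) →
        Set.range w ⊆ Set.range ι' := by
  obtain ⟨ψ, hψ, hψ'⟩ := Ch.exists_isBlowupChart_left (K := K) β A
  obtain ⟨ι', h1, h2, h3⟩ := hb.exists_chart (pullIdeal_strictTransform_divX hy hι A) hψ
  exact ⟨ι', h1, by rw [reassoc_of% h2, hι, hψ'], h3⟩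

theorem exists_chart_right (hy : basicOpenT (yT d K) ≤ isoLocus φ)
    (hb : IsBlowup b (Scheme.IdealSheafData.vanishingIdeal
      ⟨strictTransform φ (divX K A), isClosed_closure⟩)) [IsOpenImmersion ι]
    (hι : ι ≫ φ = Ch.toTS K β) :
    ∃ ι' : Spec (.of (Ch K (β.right A))) ⟶ X', IsOpenImmersion ι' ∧
      ι' ≫ b ≫ φ = Ch.toTS K _ ∧
      ∀ (C : CommRingCat.{u}) (θ : .of (Ch K β) ⟶ C) (w : Spec C ⟶ X'), w ≫ b = Spec.map θ ≫ ι →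
        θ.hom (Ch.uprod K β (β.B ∩ A) * Ch.uprod K β (β.P ∩ A)) ∈ nonZeroDivisors C →
        θ.hom (Ch.uprod K β (β.B ∩ A) * Ch.uprod K β (β.P ∩ A)) ∣
          θ.hom (Ch.uprod K β (β.B ∩ A) * Ch.v K β) →
        Set.range w ⊆ Set.range ι' := by
  obtain ⟨ψ, hψ, hψ'⟩ := Ch.exists_isBlowupChart_right (K := K) β A
  obtain ⟨ι', h1, h2, h3⟩ := hb.exists_chart
    ((pullIdeal_strictTransform_divX hy hι A).trans (by rw [Set.pair_comm])) hψ
  exact ⟨ι', h1, by rw [reassoc_of% h2, hι, hψ'], h3⟩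

theorem HasCharts.exists_chart_concat (h : HasCharts 𝒜 φ)
    (hb : IsBlowup b (Scheme.IdealSheafData.vanishingIdeal
      ⟨strictTransform φ (divX K A), isClosed_closure⟩)) (j : Fin (d + 1)) :
    ∃ ι : Spec (.of (Ch K (Block.ofCollection (𝒜 ++ [A]) j))) ⟶ X',
      IsOpenImmersion ι ∧ ι ≫ b ≫ φ = Ch.toTS K _ := by
  obtain ⟨ι, hι, hι'⟩ := h.exists_chart j
  by_cases hj : j ∈ A
  · rw [Block.ofCollection_concat_of_mem hj]
    obtain ⟨ι', h1, h2, -⟩ := exists_chart_left h.y_le hb hι'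
    exact ⟨ι', h1, h2⟩
  · rw [Block.ofCollection_concat_of_notMem hj]
    obtain ⟨ι', h1, h2, -⟩ := exists_chart_right h.y_le hb hι'
    exact ⟨ι', h1, h2⟩

/-- Near each point one of the two generators of the centre divides the other. The left chart
belongs to the indices of `P ∩ A` and the right one to those of `P \ A`; when the set wanted is
empty, the other chart already contains the point. -/
theorem HasCharts.cover_concat (h : HasCharts 𝒜 φ)
    (hb : IsBlowup b (Scheme.IdealSheafData.vanishingIdeal
      ⟨strictTransform φ (divX K A), isClosed_closure⟩)) (p : X') :
    ∃ j, ∃ ι : Spec (.of (Ch K (Block.ofCollection (𝒜 ++ [A]) j))) ⟶ X',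
      IsOpenImmersion ι ∧ ι ≫ b ≫ φ = Ch.toTS K _ ∧ p ∈ Set.range ι := by
  obtain ⟨j, ι, hι, hι', hp⟩ := h.cover (b p)
  have hjP : j ∈ (Block.ofCollection 𝒜 j).P := Block.self_mem_ofCollection_P
  obtain ⟨C, θ, w, hw, hpw, e, hst⟩ := exists_affine_chart_of_pair b hb.1 ι
    (pullIdeal_strictTransform_divX h.y_le hι' A) p hp
  have hL := exists_chart_left h.y_le hb hι'
  have hR := exists_chart_right h.y_le hb hι'
  have key : ∀ l ∈ (Block.ofCollection 𝒜 j).P, (l ∈ A →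
      Block.ofCollection (𝒜 ++ [A]) l = (Block.ofCollection 𝒜 j).left A) ∧
      (l ∉ A → Block.ofCollection (𝒜 ++ [A]) l = (Block.ofCollection 𝒜 j).right A) := by
    intro l hl
    rw [← Block.ofCollection_eq hl]
    exact ⟨Block.ofCollection_concat_of_mem, Block.ofCollection_concat_of_notMem⟩
  generalize Block.ofCollection 𝒜 j = β at *
  have left : ∀ l ∈ β.P, l ∈ A →
      θ.hom (Ch.uprod K β (β.B ∩ A) * Ch.v K β) ∈ nonZeroDivisors C →
      θ.hom (Ch.uprod K β (β.B ∩ A) * Ch.v K β) ∣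
          θ.hom (Ch.uprod K β (β.B ∩ A) * Ch.uprod K β (β.P ∩ A)) →
      ∃ j, ∃ ι : Spec (.of (Ch K (Block.ofCollection (𝒜 ++ [A]) j))) ⟶ X',
      IsOpenImmersion ι ∧ ι ≫ b ≫ φ = Ch.toTS K _ ∧ p ∈ Set.range ι := by
    intro l hl hlA h1 h2
    refine ⟨l, ?_⟩
    rw [(key l hl).1 hlA]
    obtain ⟨ι', h3, h4, h5⟩ := hL
    exact ⟨ι', h3, h4, h5 C θ w e h1 h2 hpw⟩
  have right : ∀ l ∈ β.P, l ∉ A →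
      θ.hom (Ch.uprod K β (β.B ∩ A) * Ch.uprod K β (β.P ∩ A)) ∈ nonZeroDivisors C →
      θ.hom (Ch.uprod K β (β.B ∩ A) * Ch.uprod K β (β.P ∩ A)) ∣
          θ.hom (Ch.uprod K β (β.B ∩ A) * Ch.v K β) →
      ∃ j, ∃ ι : Spec (.of (Ch K (Block.ofCollection (𝒜 ++ [A]) j))) ⟶ X',
      IsOpenImmersion ι ∧ ι ≫ b ≫ φ = Ch.toTS K _ ∧ p ∈ Set.range ι := by
    intro l hl hlA h1 h2
    refine ⟨l, ?_⟩
    rw [(key l hl).2 hlA]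
    obtain ⟨ι', h3, h4, h5⟩ := hR
    exact ⟨ι', h3, h4, h5 C θ w e h1 h2 hpw⟩
  obtain ⟨h1, h2⟩ | ⟨h1, h2⟩ := hst
  · by_cases hne : ∃ l ∈ β.P, l ∈ A
    · obtain ⟨l, hl, hlA⟩ := hne
      exact left l hl hlA h1 h2
    -- Here `u_{P ∩ A} = 1`, so the common factor alone generates the centre and the right chart
    -- applies.
    · have h3 : β.P ∩ A = ∅ := by
        ext m
        simp only [Finset.mem_inter, Finset.notMem_empty, iff_false]
        exact fun hm ↦ hne ⟨m, hm⟩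
      refine right j hjP (fun hj ↦ hne ⟨j, hjP, hj⟩) ?_ ?_
      · rw [h3, Ch.uprod_empty, mul_one]
        rw [map_mul] at h1
        exact (mul_mem_nonZeroDivisors.mp h1).1
      · rw [h3, Ch.uprod_empty, mul_one, map_mul]
        exact dvd_mul_right _ _
  · by_cases hne : ∃ l ∈ β.P, l ∉ A
    · obtain ⟨l, hl, hlA⟩ := hne
      exact right l hl hlA h1 h2
    -- Here `u_{P ∩ A} = p = v w` is a multiple of `v`, so the left chart applies.
    · have h3 : β.P ∩ A = β.P := by
        rw [Finset.inter_eq_left]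
        intro m hm
        by_contra hmA
        exact hne ⟨m, hm, hmA⟩
      have hjA : j ∈ β.P ∩ A := by rwa [h3]
      refine left j hjP (Finset.mem_inter.mp hjA).2 ?_ ?_
      · rw [h3, ← Ch.v_mul_w, ← mul_assoc, map_mul] at h1
        exact (mul_mem_nonZeroDivisors.mp h1).1
      · rw [h3, ← Ch.v_mul_w, ← mul_assoc, map_mul _ (_ * _)]
        exact dvd_mul_right _ _

theorem HasCharts.concat (h : HasCharts 𝒜 φ)
    (hb : IsBlowup b (Scheme.IdealSheafData.vanishingIdeal
      ⟨strictTransform φ (divX K A), isClosed_closure⟩)) : HasCharts (𝒜 ++ [A]) (b ≫ φ) := by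
  -- Where `f` is inverted the centre has to be generated by one nonzerodivisor; then `b` is an
  -- isomorphism over that locus.
  have hiso : ∀ f : RingT d K, IsIso (φ ∣_ basicOpenT f) →
      (∀ (β : Block d) (R : CommRingCat.{u}) (θ : .of (Ch K β) ⟶ R),
        (∀ a ∈ nonZeroDivisors (Ch K β), θ.hom a ∈ nonZeroDivisors R) →
        IsUnit (θ.hom (Ch.structureMap K β f)) → ∃ a ∈ nonZeroDivisors R,
          Ideal.span {θ.hom (Ch.uprod K β (β.B ∩ A) * Ch.v K β),
            θ.hom (Ch.uprod K β (β.B ∩ A) * Ch.uprod K β (β.P ∩ A))} = Ideal.span {a}) →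
      IsIso ((b ≫ φ) ∣_ basicOpenT f) := by
    intro f hf key
    have : IsIso (b ∣_ (φ ⁻¹ᵁ basicOpenT f)) := by
      refine hb.isIso_morphismRestrict _ fun p hp ↦ ?_
      obtain ⟨j, ι, hι, hι', q, rfl⟩ := h.cover p
      have hq : Ch.structureMap K _ f ∉ PrimeSpectrum.asIdeal q :=
        (mem_asIdeal_apply hι' q).not.mp hp
      obtain ⟨q, rfl⟩ : q ∈ Set.range (Spec.map (awayMap (A := .of (Ch K _))
          (Ch.structureMap K _ f))) := by
        rw [range_SpecMap_away]; exact hq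
      refine ⟨_, Spec.map (awayMap _) ≫ ι, inferInstance, ⟨q, by simp⟩, ?_, ?_⟩
      · rintro _ ⟨z, rfl⟩
        rw [Scheme.Hom.comp_apply]
        refine (mem_asIdeal_apply hι' _).not.mpr ?_
        have h1 : Spec.map (awayMap (A := .of (Ch K _)) (Ch.structureMap K _ f)) z ∈
          Set.range (Spec.map (awayMap (A := .of (Ch K _)) (Ch.structureMap K _ f))) := ⟨z, rfl⟩
        rw [range_SpecMap_away] at h1
        exact h1
      · obtain ⟨a, ha, ha'⟩ := key _ _ (awayMap (A := .of (Ch K _)) (Ch.structureMap K _ f))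
          (fun a ha ↦ localization_mem_nonZeroDivisors _ ha)
          (IsLocalization.Away.algebraMap_isUnit _)
        refine ⟨a, ha, ?_⟩
        rw [pullIdeal_comp, pullIdeal_strictTransform_divX h.y_le hι', Ideal.map_span,
          Set.image_pair, ← ha']
    rw [morphismRestrict_comp]
    exact IsIso.comp_isIso' this hf
  refine ⟨h.exists_chart_concat hb, h.cover_concat hb, ?_, hiso _ h.isIso_x ?_, hiso _ h.isIso_y ?_⟩
  -- The two maps agree in `X` by induction. Locally on the source the centre pulls back to an ideal
  -- generated by a nonzerodivisor, so the uniqueness in the universal property makes them agree in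
  -- `X'`.
  · intro C θ g₁ g₂ h₁ h₂ hx hu
    have e : g₁ ≫ b = g₂ ≫ b := h.hom_ext θ _ _ (by rw [Category.assoc, h₁])
      (by rw [Category.assoc, h₂]) hx hu
    refine hom_ext_of_away fun q ↦ ?_
    obtain ⟨j, ι, hι, hι', hq⟩ := h.cover (b (g₁ q))
    obtain ⟨C', θ', w, hw, ⟨z, hz⟩, e', hst⟩ := exists_affine_chart_of_pair b hb.1 ι
      (pullIdeal_strictTransform_divX h.y_le hι' A) (g₁ q) hq
    obtain ⟨f, hf, hfU⟩ := exists_away q (g₁ ⁻¹' Set.range w)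
      (w.isOpenEmbedding.isOpen_range.preimage g₁.continuous) ⟨z, hz⟩
    refine ⟨f, hf, ?_⟩
    have hr : Set.range (Spec.map (awayMap f) ≫ g₁) ⊆ Set.range w := by
      rintro _ ⟨z, rfl⟩
      have h1 : Spec.map (awayMap f) z ∈ Set.range (Spec.map (awayMap f)) := ⟨z, rfl⟩
      rw [range_SpecMap_away] at h1
      simpa using hfU _ h1
    obtain ⟨l, hl⟩ := Spec.map_surjective (IsOpenImmersion.lift w _ hr)
    have hl' : Spec.map l ≫ w = Spec.map (awayMap f) ≫ g₁ := by
      rw [hl, IsOpenImmersion.lift_fac]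
    have e2 : (Spec.map (awayMap f) ≫ g₁) ≫ b = Spec.map (θ' ≫ l) ≫ ι := by
      rw [← hl', Category.assoc, e', Spec.map_comp, Category.assoc]
    have e3 : CommRingCat.ofHom (Ch.structureMap K _) ≫ θ' ≫ l = θ ≫ awayMap f := by
      apply Spec.map_injective
      rw [Spec.map_comp, Spec.map_comp θ, ← h₁, ← Category.assoc (Spec.map (awayMap f)),
        ← Category.assoc _ b, e2, Category.assoc, hι']
      rfl
    generalize Block.ofCollection 𝒜 j = β at *
    have e4 : ∀ a, (θ' ≫ l).hom (Ch.structureMap K β a) = (awayMap f).hom (θ.hom a) := fun a ↦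
      RingHom.congr_fun (congrArg CommRingCat.Hom.hom e3) a
    have hx' : (θ' ≫ l).hom (Ch.v K β * Ch.uprod K β β.B) ∈ nonZeroDivisors _ := by
      rw [← Ch.structureMap_x, e4]
      exact localization_mem_nonZeroDivisors _ hx
    have hu' : ∀ B, (θ' ≫ l).hom (Ch.uprod K β B) ∈ nonZeroDivisors _ := by
      intro B
      rw [← Ch.structureMap_prod, e4, map_prod, map_prod]
      exact prod_mem fun j _ ↦ localization_mem_nonZeroDivisors _ (hu j)
    have hv : (θ' ≫ l).hom (Ch.v K β) ∈ nonZeroDivisors _ := by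
      rw [map_mul] at hx'
      exact (mul_mem_nonZeroDivisors.mp hx').1
    have hI := pullIdeal_strictTransform_divX h.y_le hι' A
    obtain ⟨-, h2⟩ | ⟨-, h2⟩ := hst
    · refine hb.hom_ext (a := (θ' ≫ l).hom (Ch.uprod K β (β.B ∩ A) * Ch.v K β)) ?_ ?_ ?_
      · rw [Category.assoc, e, Category.assoc]
      · rw [map_mul]
        exact mul_mem (hu' _) hv
      · rw [e2]
        exact pullIdeal_chart hI _ (map_dvd l.hom h2)
    · refine hb.hom_ext
        (a := (θ' ≫ l).hom (Ch.uprod K β (β.B ∩ A) * Ch.uprod K β (β.P ∩ A))) ?_ ?_ ?_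
      · rw [Category.assoc, e, Category.assoc]
      · rw [map_mul]
        exact mul_mem (hu' _) (hu' _)
      · rw [e2]
        exact pullIdeal_chart (hI.trans (by rw [Set.pair_comm])) _ (map_dvd l.hom h2)
  -- If `x = v b` is a unit, so is the first generator of the centre.
  · intro β R θ hθ hunit
    refine ⟨_, hθ _ (mul_mem (Ch.uprod_mem_nonZeroDivisors _) Ch.v_mem_nonZeroDivisors),
      span_pair_eq_of_dvd (IsUnit.dvd ?_)⟩
    rw [Ch.structureMap_x, map_mul] at hunit
    rw [map_mul]
    exact (isUnit_of_dvd_unit (map_dvd _ (Ch.uprod_dvd Finset.inter_subset_left))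
      (isUnit_of_mul_isUnit_right hunit)).mul (isUnit_of_mul_isUnit_left hunit)
  -- If `y = w c` is a unit, so is `w`; then `u_{P ∩ A}`, which divides `p = v w`, divides `v`.
  · intro β R θ hθ hunit
    refine ⟨_, hθ _ (mul_mem (Ch.uprod_mem_nonZeroDivisors (β.B ∩ A))
      (Ch.uprod_mem_nonZeroDivisors (β.P ∩ A))), ?_⟩
    rw [Set.pair_comm]
    refine span_pair_eq_of_dvd ?_
    rw [Ch.structureMap_y, map_mul] at hunit
    have hw := isUnit_of_mul_isUnit_left hunit
    rw [map_mul, map_mul]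
    refine mul_dvd_mul_left _ ((hw.dvd_mul_right).mp ?_)
    rw [← map_mul, Ch.v_mul_w]
    exact map_dvd _ (Ch.uprod_dvd Finset.inter_subset_left)

end Step

theorem IsIteratedBlowup.hasCharts {𝒜 : List (Finset (Fin (d + 1)))} {X : Scheme.{u}}
    {φ : X ⟶ TS d K} (h : IsIteratedBlowup 𝒜 φ) : HasCharts 𝒜 φ := by
  induction h with
  | nil => exact hasCharts_nil
  | concat _ hb ih => exact ih.concat hb

end HasCharts

/-! ### The charts when the blocks are singletons -/

section Chain

variable {d : ℕ} {K : Type u} [Field K]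

/-- The block of the `i`-th element of the ordering `η`. -/
def Block.chain (η : Equiv.Perm (Fin (d + 1))) (i : Fin (d + 1)) : Block d where
  B := Finset.univ.filter fun m ↦ η.symm m < i
  P := Finset.univ.filter fun m ↦ η.symm m = i
  D := Finset.univ.filter fun m ↦ i < η.symm m
  BP := Finset.disjoint_filter.mpr fun _ _ h ↦ h.ne
  BD := Finset.disjoint_filter.mpr fun _ _ h ↦ h.asymm
  DP := Finset.disjoint_filter.mpr fun _ _ h ↦ h.ne'
  union := by
    ext m
    have := lt_trichotomy (η.symm m) i
    simp only [Finset.mem_union, Finset.mem_filter, Finset.mem_univ, true_and, iff_true]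
    tauto

theorem Block.ofCollection_eq_chain {𝒜 : List (Finset (Fin (d + 1)))}
    {η : Equiv.Perm (Fin (d + 1))} (hη : ∀ i j, i < j → CollectionLT 𝒜 (η i) (η j))
    (i : Fin (d + 1)) : Block.ofCollection 𝒜 (η i) = Block.chain η i := by
  have h1 : ∀ k l, CollectionLT 𝒜 (η k) (η l) ↔ k < l := fun k l ↦ by
    refine ⟨fun h ↦ ?_, hη k l⟩
    obtain h' | rfl | h' := lt_trichotomy k l
    · exact h'
    · exact absurd CollectionEqv.refl h.not_eqv
    · exact absurd h (hη _ _ h').asymm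
  have h2 : ∀ k l, CollectionEqv 𝒜 (η k) (η l) ↔ k = l := fun k l ↦ by
    refine ⟨fun h ↦ ?_, fun h ↦ h ▸ CollectionEqv.refl⟩
    obtain h' | rfl | h' := lt_trichotomy k l
    · exact absurd h (hη _ _ h').not_eqv
    · rfl
    · exact absurd h.symm (hη _ _ h').not_eqv
  ext m <;> obtain ⟨k, rfl⟩ := η.surjective m
  · simp [chain, h1]
  · simp [chain, h2]
  · simp [chain, h1]

/-- `X` is covered by charts indexed by the places in the ordering `η`. -/
structure IsChain (η : Equiv.Perm (Fin (d + 1))) {X : Scheme.{u}} (φ : X ⟶ TS d K)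
    (ι : ∀ i, Spec (.of (Ch K (Block.chain η i))) ⟶ X) : Prop where
  isOpenImmersion : ∀ i, IsOpenImmersion (ι i)
  comp : ∀ i, ι i ≫ φ = Ch.toTS K _
  cover : ∀ p, ∃ i q, ι i q = p
  hom_ext : ∀ ⦃C : CommRingCat.{u}⦄ (θ : CommRingCat.of (RingT d K) ⟶ C) (g₁ g₂ : Spec C ⟶ X),
    g₁ ≫ φ = Spec.map θ → g₂ ≫ φ = Spec.map θ → θ.hom (xT d K) ∈ nonZeroDivisors C →
    (∀ j, θ.hom (uT d K j) ∈ nonZeroDivisors C) → g₁ = g₂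
  x_le : basicOpenT (xT d K) ≤ isoLocus φ
  y_le : basicOpenT (yT d K) ≤ isoLocus φ

theorem HasCharts.exists_isChain {𝒜 : List (Finset (Fin (d + 1)))}
    {η : Equiv.Perm (Fin (d + 1))} (hη : ∀ i j, i < j → CollectionLT 𝒜 (η i) (η j))
    {X : Scheme.{u}} {φ : X ⟶ TS d K} (h : HasCharts 𝒜 φ) : ∃ ι, IsChain η φ ι := by
  have h1 : ∀ i, ∃ ι : Spec (.of (Ch K (Block.chain η i))) ⟶ X,
      IsOpenImmersion ι ∧ ι ≫ φ = Ch.toTS K _ := by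
    intro i
    rw [← Block.ofCollection_eq_chain hη]
    exact h.exists_chart _
  choose ι h2 h3 using h1
  refine ⟨ι, h2, h3, fun p ↦ ?_, h.hom_ext, h.x_le, h.y_le⟩
  obtain ⟨j, h4⟩ := h.cover p
  obtain ⟨i, rfl⟩ := η.surjective j
  rw [Block.ofCollection_eq_chain hη] at h4
  obtain ⟨ι', -, h5, q, rfl⟩ := h4
  refine ⟨i, q, ?_⟩
  -- The cover provides some chart `ι'` of this block; it coincides with the chosen one because `x`
  -- and the `u_j` are nonzerodivisors in the chart.
  rw [h.hom_ext (CommRingCat.ofHom (Ch.structureMap K _)) (ι i) ι' (h3 i) h5]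
  · rw [CommRingCat.hom_ofHom, Ch.structureMap_x]
    exact mul_mem Ch.v_mem_nonZeroDivisors (Ch.uprod_mem_nonZeroDivisors _)
  · intro j
    rw [CommRingCat.hom_ofHom, Ch.structureMap_u]
    exact Ch.u_mem_nonZeroDivisors j

namespace Ch

variable {β : Block d}

theorem vIdeal_le_iff {Z : Finset (Fin (d + 1))} {J : Ideal (Ch K β)} :
    MonChart.vIdeal K _ _ _ _ _ (inlF Z) ≤ J ↔ v K β ∈ J ∧ ∀ j ∈ Z, u K β j ∈ J := by
  rw [MonChart.vIdeal_le, Finset.forall_mem_map]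
  rfl

theorem wIdeal_le_iff {Z : Finset (Fin (d + 1))} {J : Ideal (Ch K β)} :
    MonChart.wIdeal K _ _ _ _ _ (inlF Z) ≤ J ↔ w K β ∈ J ∧ ∀ j ∈ Z, u K β j ∈ J := by
  rw [MonChart.wIdeal_le, Finset.forall_mem_map]
  rfl

theorem vwIdeal_le_iff {Z : Finset (Fin (d + 1))} {J : Ideal (Ch K β)} :
    MonChart.vwIdeal K _ _ _ _ _ (inlF Z) ≤ J ↔
      v K β ∈ J ∧ w K β ∈ J ∧ ∀ j ∈ Z, u K β j ∈ J := by
  rw [MonChart.vwIdeal_le, Finset.forall_mem_map]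
  rfl

/-- The generic point of the branch `v = 0` of the special fibre. -/
theorem exists_vPoint (hP : β.P.Nonempty) : ∃ q : Spec (.of (Ch K β)),
    w K β ∉ PrimeSpectrum.asIdeal q ∧ ∀ q' : Spec (.of (Ch K β)), q ⤳ q' ↔
      v K β ∈ PrimeSpectrum.asIdeal q' ∧ ∀ j, u K β j ∈ PrimeSpectrum.asIdeal q' := by
  obtain ⟨l, hl⟩ := hP
  obtain ⟨h1, h2⟩ : (MonChart.vIdeal K (Sum.inr 0) (Sum.inr 1) (inlF β.B) (inlF β.D) (inlF β.P)
      (inlF Finset.univ)).IsPrime ∧ w K β ∉ MonChart.vIdeal K (Sum.inr 0) (Sum.inr 1) (inlF β.B)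
        (inlF β.D) (inlF β.P) (inlF Finset.univ) := by
    -- If `D` is empty then `w = y`; otherwise `c` lies in the ideal and `w` is a free coordinate.
    obtain hD | ⟨m, hm⟩ := β.D.eq_empty_or_nonempty
    · obtain ⟨h1, -, h2⟩ := MonChart.vIdeal_isPrime (K := K) (Z := inlF Finset.univ) β.separated
        ⟨Sum.inl l, by simp [hl], by simp⟩ (by simp [hD]) (by simp)
      exact ⟨h1, h2⟩
    · exact MonChart.vIdeal_isPrime' (K := K) (Z := inlF Finset.univ) β.separated
        ⟨Sum.inl l, by simp [hl], by simp⟩ ⟨Sum.inl m, by simp [hm], by simp⟩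
  refine ⟨⟨_, h1⟩, h2, fun q' ↦ ?_⟩
  refine specializes_iff_asIdeal_le.trans (vIdeal_le_iff.trans ?_)
  simp

/-- The generic point of the branch `w = 0` of the special fibre. -/
theorem exists_wPoint (hP : β.P.Nonempty) : ∃ q : Spec (.of (Ch K β)),
    v K β ∉ PrimeSpectrum.asIdeal q ∧ ∀ q' : Spec (.of (Ch K β)), q ⤳ q' ↔
      w K β ∈ PrimeSpectrum.asIdeal q' ∧ ∀ j, u K β j ∈ PrimeSpectrum.asIdeal q' := by
  obtain ⟨l, hl⟩ := hP
  obtain ⟨h1, h2⟩ : (MonChart.wIdeal K (Sum.inr 0) (Sum.inr 1) (inlF β.B) (inlF β.D) (inlF β.P)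
      (inlF Finset.univ)).IsPrime ∧ v K β ∉ MonChart.wIdeal K (Sum.inr 0) (Sum.inr 1) (inlF β.B)
        (inlF β.D) (inlF β.P) (inlF Finset.univ) := by
    obtain hB | ⟨m, hm⟩ := β.B.eq_empty_or_nonempty
    · obtain ⟨h1, -, h2⟩ := MonChart.wIdeal_isPrime (K := K) (Z := inlF Finset.univ) β.separated
        ⟨Sum.inl l, by simp [hl], by simp⟩ (by simp [hB]) (by simp)
      exact ⟨h1, h2⟩
    · exact MonChart.wIdeal_isPrime' (K := K) (Z := inlF Finset.univ) β.separated
        ⟨Sum.inl l, by simp [hl], by simp⟩ ⟨Sum.inl m, by simp [hm], by simp⟩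
  refine ⟨⟨_, h1⟩, h2, fun q' ↦ ?_⟩
  refine specializes_iff_asIdeal_le.trans (wIdeal_le_iff.trans ?_)
  simp

/-- The node of the special fibre. -/
theorem exists_nodePoint (hP : β.P.Nonempty) : ∃ q : Spec (.of (Ch K β)),
    (v K β ∈ PrimeSpectrum.asIdeal q ∧ w K β ∈ PrimeSpectrum.asIdeal q ∧
      ∀ j, u K β j ∈ PrimeSpectrum.asIdeal q) ∧
    ∀ q' : Spec (.of (Ch K β)), v K β ∈ PrimeSpectrum.asIdeal q' →
      w K β ∈ PrimeSpectrum.asIdeal q' → (∀ j, u K β j ∈ PrimeSpectrum.asIdeal q') → q' = q := by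
  have h1 := MonChart.vwIdeal_isMaximal (K := K) (i := (Sum.inr 0 : Fin (d + 1) ⊕ Fin 2))
    (k := Sum.inr 1) (B := inlF β.B) (D := inlF β.D) (P := inlF β.P) (Z := inlF Finset.univ)
    (by simpa using hP) (by
      ext (j | t)
      · simp
      · fin_cases t <;> simp)
  refine ⟨⟨_, h1.isPrime⟩, by simpa using (vwIdeal_le_iff (Z := Finset.univ)).mp le_rfl,
    fun q' hv hw hu ↦ ?_⟩
  refine PrimeSpectrum.ext (h1.eq_of_le (PrimeSpectrum.isPrime q').ne_top ?_).symm
  exact vwIdeal_le_iff.mpr ⟨hv, hw, fun j _ ↦ hu j⟩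

end Ch

theorem Block.mem_chain_B {η : Equiv.Perm (Fin (d + 1))} {i k : Fin (d + 1)} :
    η k ∈ (Block.chain η i).B ↔ k < i := by simp [chain]

theorem Block.mem_chain_P {η : Equiv.Perm (Fin (d + 1))} {i k : Fin (d + 1)} :
    η k ∈ (Block.chain η i).P ↔ k = i := by simp [chain]

theorem Block.mem_chain_D {η : Equiv.Perm (Fin (d + 1))} {i k : Fin (d + 1)} :
    η k ∈ (Block.chain η i).D ↔ i < k := by simp [chain]

theorem Block.chain_P {η : Equiv.Perm (Fin (d + 1))} {i : Fin (d + 1)} :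
    (Block.chain η i).P = {η i} := by
  ext m
  simp [chain, Equiv.symm_apply_eq]

theorem Block.chain_P_nonempty {η : Equiv.Perm (Fin (d + 1))} {i : Fin (d + 1)} :
    (Block.chain η i).P.Nonempty := ⟨η i, mem_chain_P.mpr rfl⟩

theorem mem_asIdeal_closedPointS {f : RingS d K} :
    f ∈ PrimeSpectrum.asIdeal (closedPointS K : S d K) ↔ MvPowerSeries.constantCoeff f = 0 := by
  change f ∈ IsLocalRing.maximalIdeal (RingS d K) ↔ _
  rw [IsLocalRing.mem_maximalIdeal, mem_nonunits_iff, MvPowerSeries.isUnit_iff_constantCoeff,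
    isUnit_iff_ne_zero, not_not]

theorem eq_closedPointS_iff {p : S d K} : p = closedPointS K ↔
    ∀ j, (MvPowerSeries.X j : RingS d K) ∈ PrimeSpectrum.asIdeal p := by
  constructor
  · rintro rfl j
    rw [mem_asIdeal_closedPointS, MvPowerSeries.constantCoeff_X]
  · intro h
    have h1 : (IsLocalRing.maximalIdeal (RingS d K)).IsMaximal := inferInstance
    refine PrimeSpectrum.ext (h1.eq_of_le (PrimeSpectrum.isPrime p).ne_top fun f hf ↦ ?_).symm
    have h2 := MonChart.mem_varIdeal_univ f (mem_asIdeal_closedPointS.mp hf)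
    refine (Ideal.span_le.mpr ?_ : varIdeal K Finset.univ ≤ _) h2
    rintro _ ⟨j, -, rfl⟩
    exact h j

theorem projTS_asIdeal (p : TS d K) (f : RingS d K) :
    f ∈ PrimeSpectrum.asIdeal (projTS d K p) ↔
      (Ideal.Quotient.mk _ (MvPowerSeries.rename Sum.inl f) : RingT d K) ∈
        PrimeSpectrum.asIdeal p := Iff.rfl

theorem X_mem_projTS_asIdeal {p : TS d K} {j : Fin (d + 1)} :
    (MvPowerSeries.X j : RingS d K) ∈ PrimeSpectrum.asIdeal (projTS d K p) ↔
      uT d K j ∈ PrimeSpectrum.asIdeal p := by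
  rw [projTS_asIdeal, MvPowerSeries.rename_X]
  rfl

theorem mem_specialFibre_iff {X : Scheme.{u}} {φ : X ⟶ TS d K} {p : X} :
    p ∈ specialFibre φ ↔ ∀ j, uT d K j ∈ PrimeSpectrum.asIdeal (φ p) := by
  rw [specialFibre, Set.mem_preimage, Set.mem_singleton_iff, Scheme.Hom.comp_apply,
    eq_closedPointS_iff]
  exact forall_congr' fun j ↦ X_mem_projTS_asIdeal

end Chain

/-! ### The chain of components of the special fibre -/

section ChainTopology

variable {d : ℕ} {K : Type u} [Field K] {η : Equiv.Perm (Fin (d + 1))}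

variable (K η) in
/-- The generic point of the branch `v = 0` of the special fibre of a chart. -/
def vPt (i : Fin (d + 1)) : Spec (.of (Ch K (Block.chain η i))) :=
  (Ch.exists_vPoint Block.chain_P_nonempty).choose

variable (K η) in
/-- The generic point of the branch `w = 0` of the special fibre of a chart. -/
def wPt (i : Fin (d + 1)) : Spec (.of (Ch K (Block.chain η i))) :=
  (Ch.exists_wPoint Block.chain_P_nonempty).choose

variable (K η) in
/-- The node of the special fibre of a chart. -/
def nPt (i : Fin (d + 1)) : Spec (.of (Ch K (Block.chain η i))) :=
  (Ch.exists_nodePoint Block.chain_P_nonempty).choose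

theorem w_notMem_vPt (i : Fin (d + 1)) : Ch.w K _ ∉ PrimeSpectrum.asIdeal (vPt K η i) :=
  (Ch.exists_vPoint Block.chain_P_nonempty).choose_spec.1

theorem vPt_specializes {i : Fin (d + 1)} {q : Spec (.of (Ch K (Block.chain η i)))} :
    vPt K η i ⤳ q ↔ Ch.v K _ ∈ PrimeSpectrum.asIdeal q ∧
      ∀ j, Ch.u K _ j ∈ PrimeSpectrum.asIdeal q :=
  (Ch.exists_vPoint Block.chain_P_nonempty).choose_spec.2 q

theorem v_notMem_wPt (i : Fin (d + 1)) : Ch.v K _ ∉ PrimeSpectrum.asIdeal (wPt K η i) :=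
  (Ch.exists_wPoint Block.chain_P_nonempty).choose_spec.1

theorem wPt_specializes {i : Fin (d + 1)} {q : Spec (.of (Ch K (Block.chain η i)))} :
    wPt K η i ⤳ q ↔ Ch.w K _ ∈ PrimeSpectrum.asIdeal q ∧
      ∀ j, Ch.u K _ j ∈ PrimeSpectrum.asIdeal q :=
  (Ch.exists_wPoint Block.chain_P_nonempty).choose_spec.2 q

theorem mem_nPt (i : Fin (d + 1)) : Ch.v K _ ∈ PrimeSpectrum.asIdeal (nPt K η i) ∧
    Ch.w K _ ∈ PrimeSpectrum.asIdeal (nPt K η i) ∧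
      ∀ j, Ch.u K _ j ∈ PrimeSpectrum.asIdeal (nPt K η i) :=
  (Ch.exists_nodePoint Block.chain_P_nonempty).choose_spec.1

theorem eq_nPt {i : Fin (d + 1)} {q : Spec (.of (Ch K (Block.chain η i)))}
    (hv : Ch.v K _ ∈ PrimeSpectrum.asIdeal q) (hw : Ch.w K _ ∈ PrimeSpectrum.asIdeal q)
    (hu : ∀ j, Ch.u K _ j ∈ PrimeSpectrum.asIdeal q) : q = nPt K η i :=
  (Ch.exists_nodePoint Block.chain_P_nonempty).choose_spec.2 q hv hw hu

namespace Ch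

theorem uprod_insert {β : Block d} {A : Finset (Fin (d + 1))} {j : Fin (d + 1)} (h : j ∉ A) :
    uprod K β (insert j A) = u K β j * uprod K β A := by
  rw [uprod_eq, uprod_eq, Finset.prod_insert h]

theorem v_mul_w_chain (i : Fin (d + 1)) :
    v K (Block.chain η i) * w K (Block.chain η i) = u K (Block.chain η i) (η i) := by
  have h : ∀ A : Finset (Fin (d + 1)), A = {η i} →
      uprod K (Block.chain η i) A = u K (Block.chain η i) (η i) := by
    rintro _ rfl
    rw [uprod_eq, Finset.prod_singleton]
  rw [v_mul_w, h _ Block.chain_P]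

/-- The comparison of two consecutive charts. -/
theorem exists_overlap (i : Fin d) :
    ∃ θ : Ch K (Block.chain η i.succ) →+*
      Localization.Away (w K (Block.chain η i.castSucc)),
      (∀ a, θ (of K _ a) = algebraMap _ _ (of K (Block.chain η i.castSucc) a)) ∧
      θ (w K _) = algebraMap _ _ (w K (Block.chain η i.castSucc) *
        u K (Block.chain η i.castSucc) (η i.succ)) := by
  set β := Block.chain η i.castSucc with hβ
  have hB : (Block.chain η i.succ).B = insert (η i.castSucc) β.B := by
    ext m
    obtain ⟨k, rfl⟩ := η.surjective m
    simp only [Finset.mem_insert, hβ, Block.mem_chain_B, EmbeddingLike.apply_eq_iff_eq,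
      Fin.lt_def, Fin.ext_iff, Fin.val_succ, Fin.val_castSucc]
    omega
  have hD : β.D = insert (η i.succ) (Block.chain η i.succ).D := by
    ext m
    obtain ⟨k, rfl⟩ := η.surjective m
    simp only [Finset.mem_insert, hβ, Block.mem_chain_D, EmbeddingLike.apply_eq_iff_eq,
      Fin.lt_def, Fin.ext_iff, Fin.val_succ, Fin.val_castSucc]
    omega
  have hB' : uprod K β (Block.chain η i.succ).B = u K β (η i.castSucc) * uprod K β β.B := by
    rw [hB, uprod_insert (by simp [hβ, Block.mem_chain_B])]
  have hD' : ∀ A, A = β.D → uprod K β A =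
      u K β (η i.succ) * uprod K β (Block.chain η i.succ).D := by
    intro A hA
    rw [hA.trans hD, uprod_insert (by simp [Block.mem_chain_D])]
  have hP' : uprod K β (Block.chain η i.succ).P = u K β (η i.succ) := by
    rw [Block.chain_P, uprod_eq, Finset.prod_singleton]
  have hinv := IsLocalization.Away.mul_invSelf (S := Localization.Away (w K β)) (w K β)
  -- The new coordinates are `v' = 1 / w` and `w' = w u_{η(i+1)}`: in the next chart `b` gains the
  -- factor `u_{η(i)} = v w`, and `c` loses `u_{η(i+1)}`.
  refine ⟨ChartRing.lift ((algebraMap _ _).comp (of K β)) (IsLocalization.Away.invSelf (w K β))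
    (algebraMap _ _ (w K β * u K β (η i.succ))) ?_ ?_ ?_, ChartRing.lift_of _ _ _ _ _ _,
    ChartRing.lift_w _ _ _ _ _ _⟩
  · change algebraMap _ _ (of K β (MvPowerSeries.X (Sum.inr 0))) =
      _ * algebraMap _ _ (uprod K β (Block.chain η i.succ).B)
    rw [hB', of_x, ← v_mul_w_chain, map_mul, map_mul, map_mul]
    linear_combination -(algebraMap (Ch K β) (Localization.Away (w K β)) (v K β) *
      algebraMap (Ch K β) (Localization.Away (w K β)) (uprod K β β.B)) * hinv
  · change algebraMap _ _ (of K β (MvPowerSeries.X (Sum.inr 1))) =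
      _ * algebraMap _ _ (uprod K β (Block.chain η i.succ).D)
    rw [of_y, hD' _ rfl, ← mul_assoc, map_mul]
  · change _ = algebraMap _ _ (uprod K β (Block.chain η i.succ).P)
    rw [hP', map_mul, ← mul_assoc, mul_comm (IsLocalization.Away.invSelf _), hinv, one_mul]

end Ch

variable {X : Scheme.{u}} {φ : X ⟶ TS d K} {ι : ∀ i, Spec (.of (Ch K (Block.chain η i))) ⟶ X}

/-- The generic points of the components of the special fibre. -/
def chainPoint (ι : ∀ i, Spec (.of (Ch K (Block.chain η i))) ⟶ X) (k : Fin (d + 2)) : X :=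
  Fin.lastCases (ι (Fin.last d) (vPt K η (Fin.last d))) (fun i ↦ ι i (wPt K η i)) k

theorem chainPoint_castSucc (i : Fin (d + 1)) : chainPoint ι i.castSucc = ι i (wPt K η i) :=
  Fin.lastCases_castSucc ..

theorem chainPoint_last : chainPoint ι (Fin.last (d + 1)) = ι _ (vPt K η (Fin.last d)) :=
  Fin.lastCases_last ..

theorem isClosed_specialFibre : IsClosed (specialFibre φ) := by
  refine IsClosed.preimage (φ ≫ projTS d K).continuous ?_
  exact (PrimeSpectrum.isClosed_singleton_iff_isMaximal _).mpr
    (inferInstance : (IsLocalRing.maximalIdeal (RingS d K)).IsMaximal)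

namespace IsChain

variable (hc : IsChain η φ ι)
include hc

theorem hom_ext_of_comp {i i' : Fin (d + 1)} {C : CommRingCat.{u}}
    {θ : CommRingCat.of (Ch K (Block.chain η i)) ⟶ C}
    {θ' : CommRingCat.of (Ch K (Block.chain η i')) ⟶ C}
    (h : ∀ a, θ.hom (Ch.of K _ a) = θ'.hom (Ch.of K _ a))
    (h' : ∀ a ∈ nonZeroDivisors (Ch K (Block.chain η i')), θ'.hom a ∈ nonZeroDivisors C) :
    Spec.map θ ≫ ι i = Spec.map θ' ≫ ι i' := by
  refine hc.hom_ext (CommRingCat.ofHom (Ch.structureMap K _) ≫ θ') _ _ ?_ ?_ (h' _ ?_)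
    fun j ↦ h' _ ?_
  · rw [Category.assoc, hc.comp, Ch.toTS, ← Spec.map_comp]
    congr 1
    ext1
    exact Ch.comp_structureMap h
  · rw [Category.assoc, hc.comp, Ch.toTS, ← Spec.map_comp]
  · refine (congrArg (· ∈ nonZeroDivisors _) Ch.structureMap_x).mpr ?_
    exact mul_mem Ch.v_mem_nonZeroDivisors (Ch.uprod_mem_nonZeroDivisors _)
  · refine (congrArg (· ∈ nonZeroDivisors _) (Ch.structureMap_u j)).mpr ?_
    exact Ch.u_mem_nonZeroDivisors j

/-- The branch `v = 0` of chart `i` continues as the branch `w' = 0` of chart `i + 1`: its generic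
point lies on the overlap, where `w' = w u_{η(i+1)}` vanishes along the special fibre. -/
theorem chainPoint_succ_specializes (i : Fin (d + 1)) :
    chainPoint ι i.succ ⤳ ι i (vPt K η i) := by
  induction i using Fin.lastCases with
  | last =>
    rw [Fin.succ_last, chainPoint_last]
  | cast i =>
    rw [← Fin.castSucc_succ, chainPoint_castSucc]
    obtain ⟨θ, h1, h2⟩ := Ch.exists_overlap (K := K) (η := η) i
    have e : Spec.map (CommRingCat.ofHom θ) ≫ ι i.succ =
        Spec.map (awayMap (A := .of (Ch K _)) (Ch.w K (Block.chain η i.castSucc))) ≫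
          ι i.castSucc :=
      hc.hom_ext_of_comp h1 fun a ha ↦ localization_mem_nonZeroDivisors _ ha
    obtain ⟨ζ, hζ⟩ : vPt K η i.castSucc ∈ Set.range (Spec.map (awayMap (A := .of (Ch K _))
        (Ch.w K (Block.chain η i.castSucc)))) := by
      rw [range_SpecMap_away]
      exact w_notMem_vPt _
    rw [← hζ, ← Scheme.Hom.comp_apply, ← e, Scheme.Hom.comp_apply]
    refine Specializes.map (wPt_specializes.mpr ?_) (ι i.succ).continuous
    have hu : ∀ j, algebraMap _ _ (Ch.u K (Block.chain η i.castSucc) j) ∈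
        PrimeSpectrum.asIdeal ζ := by
      intro j
      have h3 := (vPt_specializes (K := K) (η := η)).mp (specializes_refl (vPt K η i.castSucc))
      have h4 := h3.2 j
      rw [← hζ, SpecMap_apply_asIdeal] at h4
      exact h4
    simp only [SpecMap_apply_asIdeal, Ideal.mem_comap, CommRingCat.hom_ofHom]
    refine ⟨?_, fun j ↦ ?_⟩
    · rw [h2, map_mul]
      exact Ideal.mul_mem_left _ _ (hu _)
    · rw [h1]
      exact hu j

theorem mem_specialFibre {i : Fin (d + 1)} {q : Spec (.of (Ch K (Block.chain η i)))} :
    ι i q ∈ specialFibre φ ↔ ∀ j, Ch.u K _ j ∈ PrimeSpectrum.asIdeal q := by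
  rw [mem_specialFibre_iff]
  refine forall_congr' fun j ↦ ?_
  rw [mem_asIdeal_apply (hc.comp i), Ch.structureMap_u]

theorem mem_strictTransform_divX {i k : Fin (d + 1)} {q : Spec (.of (Ch K (Block.chain η i)))} :
    ι i q ∈ strictTransform φ (divX K {η k}) ↔
      (k < i ∧ Ch.u K _ (η k) ∈ PrimeSpectrum.asIdeal q) ∨
      (k = i ∧ Ch.v K _ ∈ PrimeSpectrum.asIdeal q ∧ Ch.u K _ (η k) ∈ PrimeSpectrum.asIdeal q) := by
  have := hc.isOpenImmersion i
  rw [NodalBlowup.mem_strictTransform_divX hc.y_le (hc.comp i)]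
  simp only [Finset.mem_inter, Finset.mem_singleton, and_assoc]
  rw [← Block.mem_chain_B, ← Block.mem_chain_P]
  constructor
  · rintro (⟨j, h1, rfl, h2⟩ | ⟨j, h1, rfl, h2⟩)
    exacts [.inl ⟨h1, h2⟩, .inr ⟨h1, h2⟩]
  · rintro (⟨h1, h2⟩ | ⟨h1, h2⟩)
    exacts [.inl ⟨_, h1, rfl, h2⟩, .inr ⟨_, h1, rfl, h2⟩]

theorem mem_strictTransform_divY {i k : Fin (d + 1)} {q : Spec (.of (Ch K (Block.chain η i)))} :
    ι i q ∈ strictTransform φ (divY K {η k}) ↔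
      (i < k ∧ Ch.u K _ (η k) ∈ PrimeSpectrum.asIdeal q) ∨
      (k = i ∧ Ch.w K _ ∈ PrimeSpectrum.asIdeal q ∧ Ch.u K _ (η k) ∈ PrimeSpectrum.asIdeal q) := by
  have := hc.isOpenImmersion i
  rw [NodalBlowup.mem_strictTransform_divY hc.x_le (hc.comp i)]
  simp only [Finset.mem_inter, Finset.mem_singleton, and_assoc]
  rw [← Block.mem_chain_D, ← Block.mem_chain_P]
  constructor
  · rintro (⟨j, h1, rfl, h2⟩ | ⟨j, h1, rfl, h2⟩)
    exacts [.inl ⟨h1, h2⟩, .inr ⟨h1, h2⟩]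
  · rintro (⟨h1, h2⟩ | ⟨h1, h2⟩)
    exacts [.inl ⟨_, h1, rfl, h2⟩, .inr ⟨_, h1, rfl, h2⟩]

theorem chainPoint_mem_specialFibre (k : Fin (d + 2)) : chainPoint ι k ∈ specialFibre φ := by
  induction k using Fin.lastCases with
  | last =>
    rw [chainPoint_last, hc.mem_specialFibre]
    exact (vPt_specializes.mp (specializes_refl _)).2
  | cast i =>
    rw [chainPoint_castSucc, hc.mem_specialFibre]
    exact (wPt_specializes.mp (specializes_refl _)).2

/-- The components to the right of the `i`-th node lie in the strict transform of
`V(x, u_{η(i)})`. -/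
theorem chainPoint_mem_divX {i : Fin (d + 1)} {k : Fin (d + 2)} (h : i.castSucc < k) :
    chainPoint ι k ∈ strictTransform φ (divX K {η i}) := by
  induction k using Fin.lastCases with
  | last =>
    rw [chainPoint_last, hc.mem_strictTransform_divX]
    have h1 := vPt_specializes.mp (specializes_refl (vPt K η (Fin.last d)))
    obtain hi | rfl := (Fin.le_last i).lt_or_eq
    exacts [.inl ⟨hi, h1.2 _⟩, .inr ⟨rfl, h1.1, h1.2 _⟩]
  | cast m =>
    rw [chainPoint_castSucc, hc.mem_strictTransform_divX]
    exact .inl ⟨h, (wPt_specializes.mp (specializes_refl _)).2 _⟩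

theorem chainPoint_mem_divY {i : Fin (d + 1)} {k : Fin (d + 2)} (h : k ≤ i.castSucc) :
    chainPoint ι k ∈ strictTransform φ (divY K {η i}) := by
  induction k using Fin.lastCases with
  | last => exact absurd h (Fin.castSucc_lt_last i).not_ge
  | cast m =>
    rw [chainPoint_castSucc, hc.mem_strictTransform_divY]
    have h1 := wPt_specializes.mp (specializes_refl (wPt K η m))
    obtain hi | rfl := (Fin.castSucc_le_castSucc_iff.mp h).lt_or_eq
    exacts [.inl ⟨hi, h1.2 _⟩, .inr ⟨rfl, h1.1, h1.2 _⟩]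

/-- The trace of a component of the special fibre on a chart. -/
theorem chainPoint_specializes {k : Fin (d + 2)} {i : Fin (d + 1)}
    {q : Spec (.of (Ch K (Block.chain η i)))} : chainPoint ι k ⤳ ι i q ↔
      (∀ j, Ch.u K _ j ∈ PrimeSpectrum.asIdeal q) ∧
      ((k = i.castSucc ∧ Ch.w K _ ∈ PrimeSpectrum.asIdeal q) ∨
        (k = i.succ ∧ Ch.v K _ ∈ PrimeSpectrum.asIdeal q)) := by
  constructor
  · intro h
    refine ⟨hc.mem_specialFibre.mp (h.mem_closed isClosed_specialFibre
      (hc.chainPoint_mem_specialFibre k)), ?_⟩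
    -- Component `k` lies in the strict transform of `V(y, u_{η(m)})` for `k ≤ m` and of `V(x,
    -- u_{η(m)})` for `m < k`. In chart `i` the former is nonempty only if `i ≤ m`, the latter only
    -- if `m ≤ i`. Taking `m = k` and `m = k - 1` leaves `k = i` and `k = i + 1`.
    obtain hk | rfl | hk := lt_trichotomy k i.castSucc
    · obtain ⟨m, rfl⟩ := Fin.exists_castSucc_eq.mpr (Fin.ne_last_of_lt hk)
      have h1 := hc.chainPoint_mem_divY (i := m) le_rfl
      have hm := Fin.castSucc_lt_castSucc_iff.mp hk
      obtain ⟨h2, -⟩ | ⟨h2, -⟩ :=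
        hc.mem_strictTransform_divY.mp (h.mem_closed isClosed_closure h1)
      exacts [absurd h2 hm.asymm, absurd h2 hm.ne]
    · refine .inl ⟨rfl, ?_⟩
      have h1 := hc.chainPoint_mem_divY (i := i) le_rfl
      obtain ⟨h2, -⟩ | ⟨-, h2, -⟩ :=
        hc.mem_strictTransform_divY.mp (h.mem_closed isClosed_closure h1)
      · exact absurd h2 (lt_irrefl _)
      · exact h2
    · obtain ⟨m, rfl⟩ := Fin.exists_succ_eq.mpr (Fin.ne_zero_of_lt hk)
      have h1 := hc.chainPoint_mem_divX (i := m) (Fin.castSucc_lt_succ)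
      obtain ⟨h2, -⟩ | ⟨rfl, h2, -⟩ :=
        hc.mem_strictTransform_divX.mp (h.mem_closed isClosed_closure h1)
      · rw [Fin.lt_def] at h2 hk
        simp at hk
        omega
      · exact .inr ⟨rfl, h2⟩
  · rintro ⟨h1, ⟨rfl, h2⟩ | ⟨rfl, h2⟩⟩
    · rw [chainPoint_castSucc]
      exact (wPt_specializes.mpr ⟨h2, h1⟩).map (ι i).continuous
    · exact (hc.chainPoint_succ_specializes i).trans
        ((vPt_specializes.mpr ⟨h2, h1⟩).map (ι i).continuous)

end IsChain

end ChainTopology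

/-! ### Components of the special fibre, their intersections and their numbering -/

section ExceptionalChain

variable {d : ℕ} {K : Type u} [Field K] {η : Equiv.Perm (Fin (d + 1))}
  {X : Scheme.{u}} {φ : X ⟶ TS d K} {ι : ∀ i, Spec (.of (Ch K (Block.chain η i))) ⟶ X}

namespace IsChain

variable (hc : IsChain η φ ι)
include hc

/-- On the special fibre `v w = u_{η(i)}` vanishes, so each of its points in chart `i` is on one of
the two branches. -/
theorem exists_chainPoint_specializes {p : X} (hp : p ∈ specialFibre φ) :
    ∃ k, chainPoint ι k ⤳ p := by
  obtain ⟨i, q, rfl⟩ := hc.cover p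
  rw [hc.mem_specialFibre] at hp
  have h1 : Ch.v K (Block.chain η i) * Ch.w K (Block.chain η i) ∈ PrimeSpectrum.asIdeal q := by
    rw [Ch.v_mul_w_chain]
    exact hp _
  obtain h1 | h1 := (PrimeSpectrum.isPrime q).mem_or_mem h1
  · exact ⟨_, hc.chainPoint_specializes.mpr ⟨hp, .inr ⟨rfl, h1⟩⟩⟩
  · exact ⟨_, hc.chainPoint_specializes.mpr ⟨hp, .inl ⟨rfl, h1⟩⟩⟩

theorem eq_of_specializes {k l : Fin (d + 2)} (h : chainPoint ι k ⤳ chainPoint ι l) : k = l := by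
  induction l using Fin.lastCases with
  | last =>
    rw [chainPoint_last, hc.chainPoint_specializes] at h
    obtain ⟨-, ⟨-, h⟩ | ⟨h, -⟩⟩ := h
    exacts [absurd h (w_notMem_vPt _), h]
  | cast i =>
    rw [chainPoint_castSucc, hc.chainPoint_specializes] at h
    obtain ⟨-, ⟨h, -⟩ | ⟨-, h⟩⟩ := h
    exacts [h, absurd h (v_notMem_wPt _)]

theorem closure_subset_specialFibre (k : Fin (d + 2)) :
    closure {chainPoint ι k} ⊆ specialFibre φ :=
  closure_minimal (Set.singleton_subset_iff.mpr (hc.chainPoint_mem_specialFibre k))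
    isClosed_specialFibre

theorem exists_subset_closure {Z : Set X} (hZ : IsIrreducible Z) (hZF : Z ⊆ specialFibre φ) :
    ∃ k, Z ⊆ closure {chainPoint ι k} := by
  classical
  obtain ⟨z, hz, h⟩ := isIrreducible_iff_sUnion_isClosed.mp hZ
    (Finset.univ.image fun k ↦ closure {chainPoint ι k})
    (by simp only [Finset.mem_image]; rintro _ ⟨k, -, rfl⟩; exact isClosed_closure) (by
      intro p hp
      obtain ⟨k, hk⟩ := hc.exists_chainPoint_specializes (hZF hp)
      exact ⟨_, by simp, specializes_iff_mem_closure.mp hk⟩)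
  obtain ⟨k, -, rfl⟩ := Finset.mem_image.mp hz
  exact ⟨k, h⟩

theorem eq_of_closure_subset {k l : Fin (d + 2)}
    (h : closure {chainPoint ι k} ⊆ closure {chainPoint ι l}) : l = k :=
  hc.eq_of_specializes (specializes_iff_mem_closure.mpr (h (subset_closure rfl)))

theorem range_closure : Set.range (fun k ↦ closure {chainPoint ι k}) =
    {Z | Maximal (fun Z => IsIrreducible Z ∧ Z ⊆ specialFibre φ) Z} := by
  ext Z
  constructor
  · rintro ⟨k, rfl⟩
    refine ⟨⟨isIrreducible_singleton.closure, hc.closure_subset_specialFibre k⟩, ?_⟩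
    rintro Z ⟨hZ, hZF⟩ hle
    obtain ⟨l, hl⟩ := hc.exists_subset_closure hZ hZF
    obtain rfl := hc.eq_of_closure_subset (hle.trans hl)
    exact hl
  · rintro ⟨⟨hZ, hZF⟩, hmax⟩
    obtain ⟨k, hk⟩ := hc.exists_subset_closure hZ hZF
    exact ⟨k, (hmax ⟨isIrreducible_singleton.closure, hc.closure_subset_specialFibre k⟩
      hk).antisymm hk⟩

theorem closure_inter_closure_succ (i : Fin (d + 1)) :
    closure {chainPoint ι i.castSucc} ∩ closure {chainPoint ι i.succ} = {ι i (nPt K η i)} := by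
  ext p
  rw [Set.mem_inter_iff, ← specializes_iff_mem_closure, ← specializes_iff_mem_closure,
    Set.mem_singleton_iff]
  constructor
  · rintro ⟨h1, h2⟩
    obtain ⟨m, q, rfl⟩ := hc.cover p
    rw [hc.chainPoint_specializes] at h1 h2
    obtain ⟨hu, ⟨e, hw⟩ | ⟨e, hv⟩⟩ := h1
    · obtain rfl := Fin.castSucc_injective _ e
      obtain ⟨-, ⟨e, -⟩ | ⟨-, hv⟩⟩ := h2
      · exact absurd e (Fin.castSucc_lt_succ).ne'
      · rw [eq_nPt hv hw hu]
    · obtain ⟨-, ⟨e', -⟩ | ⟨e', -⟩⟩ := h2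
      · rw [Fin.ext_iff] at e e'
        simp at e e'
        omega
      · exact absurd (e.trans e'.symm) (Fin.castSucc_lt_succ).ne
  · rintro rfl
    obtain ⟨hv, hw, hu⟩ := mem_nPt (K := K) (η := η) i
    exact ⟨hc.chainPoint_specializes.mpr ⟨hu, .inl ⟨rfl, hw⟩⟩,
      hc.chainPoint_specializes.mpr ⟨hu, .inr ⟨rfl, hv⟩⟩⟩

theorem le_add_one_of_specializes {k l : Fin (d + 2)} {p : X} (hk : chainPoint ι k ⤳ p)
    (hl : chainPoint ι l ⤳ p) : (l : ℕ) ≤ k + 1 := by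
  obtain ⟨m, q, rfl⟩ := hc.cover p
  rw [hc.chainPoint_specializes] at hk hl
  obtain ⟨-, ⟨rfl, -⟩ | ⟨rfl, -⟩⟩ := hk <;> obtain ⟨-, ⟨rfl, -⟩ | ⟨rfl, -⟩⟩ := hl <;>
    simp <;> omega

/-- At the generic point of the branch `y = 0` all the `u_j` vanish but `x = v b` does not. So `b`
is an empty product, the point lies in the first chart, and `v ≠ 0` forces `w = 0`. -/
theorem closure_zero : closure {chainPoint ι 0} = strictTransform φ (branchY K) := by
  -- The branch is irreducible; the index type `Unit` gives its single generic point the form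
  -- expected by `mem_strictTransform_iff`.
  have hZ : ∀ p : TS d K, p ∈ branchY K ↔ ∃ j ∈ ({()} : Finset Unit),
      genericT K 1 Finset.univ_nonempty ⤳ p := fun p ↦ by
    simp only [mem_branchY, genericT_specializes, Finset.mem_univ, forall_const,
      Finset.mem_singleton, true_and, exists_const]
    rfl
  have h0 : chainPoint ι 0 = ι 0 (wPt K η 0) := chainPoint_castSucc 0
  have hB : (Block.chain η 0).B = ∅ := by
    ext m
    obtain ⟨k, rfl⟩ := η.surjective m
    simp [Block.mem_chain_B]
  ext p
  rw [← specializes_iff_mem_closure]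
  constructor
  · intro h
    refine mem_strictTransform_of_specializes ?_ (hc.x_le ?_) h
    · obtain ⟨hw, hu⟩ := wPt_specializes.mp (specializes_refl (wPt K η 0))
      rw [mem_branchY, h0, mem_asIdeal_apply (hc.comp 0), Ch.structureMap_y]
      refine ⟨Ideal.mul_mem_right _ _ hw, fun j ↦ ?_⟩
      rw [mem_asIdeal_apply (hc.comp 0), Ch.structureMap_u]
      exact hu j
    · rw [mem_basicOpenT, h0, mem_asIdeal_apply (hc.comp 0), Ch.structureMap_x]
      have := PrimeSpectrum.isPrime (wPt K η 0)
      intro h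
      obtain h | h := this.mem_or_mem h
      · exact v_notMem_wPt _ h
      · obtain ⟨j, hj, -⟩ := Ch.uprod_mem_iff.mp h
        rw [hB] at hj
        exact Finset.notMem_empty _ hj
  · intro h
    obtain ⟨-, -, ξ, hξ, hp⟩ := (mem_strictTransform_iff _ (fun _ ↦ genericT K 1 _) hZ
      (fun _ _ ↦ hc.x_le (mem_basicOpenT.mpr xT_notMem_genericT)) p).mp h
    refine Specializes.trans ?_ hp
    obtain ⟨m, q, rfl⟩ := hc.cover ξ
    have hx : xT d K ∉ PrimeSpectrum.asIdeal (φ (ι m q)) := by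
      rw [hξ]; exact xT_notMem_genericT
    have hF : ι m q ∈ specialFibre φ := by
      rw [mem_specialFibre_iff, hξ]
      intro j
      rw [uT, mk_mem_genericT, X_mem_varIdeal]
      simp
    rw [hc.mem_specialFibre] at hF
    rw [mem_asIdeal_apply (hc.comp m), Ch.structureMap_x] at hx
    have := PrimeSpectrum.isPrime q
    have hv : Ch.v K _ ∉ PrimeSpectrum.asIdeal q := fun h ↦ hx (Ideal.mul_mem_right _ _ h)
    have hm : m = 0 := by
      by_contra hm
      exact hx (Ideal.mul_mem_left _ _ (Ch.uprod_mem_iff.mpr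
        ⟨η 0, Block.mem_chain_B.mpr (Fin.pos_of_ne_zero hm), hF _⟩))
    subst hm
    refine hc.chainPoint_specializes.mpr ⟨hF, .inl ⟨rfl, ?_⟩⟩
    refine (this.mem_or_mem ?_).resolve_left hv
    rw [Ch.v_mul_w_chain]
    exact hF _

theorem closure_last :
    closure {chainPoint ι (Fin.last (d + 1))} = strictTransform φ (branchX K) := by
  have hZ : ∀ p : TS d K, p ∈ branchX K ↔ ∃ j ∈ ({()} : Finset Unit),
      genericT K 0 Finset.univ_nonempty ⤳ p := fun p ↦ by
    simp only [mem_branchX, genericT_specializes, Finset.mem_univ, forall_const,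
      Finset.mem_singleton, true_and, exists_const]
    rfl
  have hD : (Block.chain η (Fin.last d)).D = ∅ := by
    ext m
    obtain ⟨k, rfl⟩ := η.surjective m
    simp [Block.mem_chain_D, Fin.le_last]
  ext p
  rw [← specializes_iff_mem_closure]
  constructor
  · intro h
    refine mem_strictTransform_of_specializes ?_ (hc.y_le ?_) h
    · obtain ⟨hv, hu⟩ := vPt_specializes.mp (specializes_refl (vPt K η (Fin.last d)))
      rw [mem_branchX, chainPoint_last, mem_asIdeal_apply (hc.comp _), Ch.structureMap_x]
      refine ⟨Ideal.mul_mem_right _ _ hv, fun j ↦ ?_⟩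
      rw [mem_asIdeal_apply (hc.comp _), Ch.structureMap_u]
      exact hu j
    · rw [mem_basicOpenT, chainPoint_last, mem_asIdeal_apply (hc.comp _), Ch.structureMap_y]
      have := PrimeSpectrum.isPrime (vPt K η (Fin.last d))
      intro h
      obtain h | h := this.mem_or_mem h
      · exact w_notMem_vPt _ h
      · obtain ⟨j, hj, -⟩ := Ch.uprod_mem_iff.mp h
        rw [hD] at hj
        exact Finset.notMem_empty _ hj
  · intro h
    obtain ⟨-, -, ξ, hξ, hp⟩ := (mem_strictTransform_iff _ (fun _ ↦ genericT K 0 _) hZ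
      (fun _ _ ↦ hc.y_le (mem_basicOpenT.mpr yT_notMem_genericT)) p).mp h
    refine Specializes.trans ?_ hp
    obtain ⟨m, q, rfl⟩ := hc.cover ξ
    have hy : yT d K ∉ PrimeSpectrum.asIdeal (φ (ι m q)) := by
      rw [hξ]; exact yT_notMem_genericT
    have hF : ι m q ∈ specialFibre φ := by
      rw [mem_specialFibre_iff, hξ]
      intro j
      rw [uT, mk_mem_genericT, X_mem_varIdeal]
      simp
    rw [hc.mem_specialFibre] at hF
    rw [mem_asIdeal_apply (hc.comp m), Ch.structureMap_y] at hy
    have := PrimeSpectrum.isPrime q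
    have hw : Ch.w K _ ∉ PrimeSpectrum.asIdeal q := fun h ↦ hy (Ideal.mul_mem_right _ _ h)
    have hm : m = Fin.last d := by
      by_contra hm
      exact hy (Ideal.mul_mem_left _ _ (Ch.uprod_mem_iff.mpr
        ⟨η (Fin.last d), Block.mem_chain_D.mpr (Fin.lt_last_iff_ne_last.mpr hm), hF _⟩))
    subst hm
    refine hc.chainPoint_specializes.mpr ⟨hF, .inr ⟨rfl, ?_⟩⟩
    refine (this.mem_or_mem ?_).resolve_right hw
    rw [Ch.v_mul_w_chain]
    exact hF _

/-- The chain of components of the special fibre. -/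
theorem nonempty_exceptionalChain : Nonempty (ExceptionalChain φ) :=
  ⟨{ comp := fun k ↦ closure {chainPoint ι k}
     node := fun i ↦ ι i (nPt K η i)
     comp_injective := fun _ _ h ↦ (hc.eq_of_closure_subset (Set.Subset.antisymm_iff.mp h).1).symm
     range_comp := hc.range_closure
     comp_zero := hc.closure_zero
     comp_last := hc.closure_last
     comp_inter := hc.closure_inter_closure_succ
     comp_disjoint := fun i j h ↦ Set.disjoint_left.mpr fun p hi hj ↦ by
      rw [← specializes_iff_mem_closure] at hi hj
      have := hc.le_add_one_of_specializes hi hj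
      omega }⟩

/-- The numbering of the components is unique. -/
theorem comp_eq (c : ExceptionalChain φ) (k : Fin (d + 2)) :
    c.comp k = closure {chainPoint ι k} := by
  have h1 : ∀ k, ∃ l, closure {chainPoint ι l} = c.comp k := by
    intro k
    have : c.comp k ∈ Set.range (fun k ↦ closure {chainPoint ι k}) := by
      rw [hc.range_closure, ← c.range_comp]
      exact ⟨k, rfl⟩
    exact this
  choose σ hσ using h1
  have hinj : Function.Injective σ := fun k l h ↦ c.comp_injective (by rw [← hσ, ← hσ, h])
  have h0 : σ 0 = 0 := by
    refine (hc.eq_of_closure_subset (subset_of_eq ?_)).symm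
    rw [hσ, c.comp_zero, hc.closure_zero]
  have hadj : ∀ i : Fin (d + 1), (σ i.succ : ℕ) ≤ σ i.castSucc + 1 := by
    intro i
    have h2 : c.node i ∈ c.comp i.castSucc ∩ c.comp i.succ := c.comp_inter i ▸ rfl
    rw [← hσ, ← hσ, Set.mem_inter_iff, ← specializes_iff_mem_closure,
      ← specializes_iff_mem_closure] at h2
    exact hc.le_add_one_of_specializes h2.1 h2.2
  -- `σ` is injective, fixes `0` and grows by at most one at each step. If it fixes all indices up
  -- to `n` and sends `n + 1` to some `l ≤ n`, then `σ l = l = σ (n + 1)`, and injectivity gives `l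
  -- = n + 1`; so `σ` is the identity.
  have hid : ∀ n (k : Fin (d + 2)), (k : ℕ) ≤ n → σ k = k := by
    intro n
    induction n with
    | zero =>
      intro k hk
      obtain rfl : k = 0 := Fin.ext (by simpa using hk)
      exact h0
    | succ n ih =>
      intro k hk
      obtain hk | hk := hk.lt_or_eq
      · exact ih k (by omega)
      · obtain ⟨i, rfl⟩ := Fin.exists_succ_eq.mpr (show k ≠ 0 by rintro rfl; simp at hk)
        have h3 := hadj i
        have hi : (i : ℕ) = n := by simpa using hk
        rw [ih i.castSucc (by simp [hi])] at h3
        obtain h4 | h4 := h3.lt_or_eq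
        · have h5 := ih (σ i.succ) (by simp at h4; omega)
          have h6 := hinj h5
          rw [h6]
        · exact Fin.ext (by simpa using h4)
  rw [← hσ, hid k k le_rfl]

theorem node_eq (c : ExceptionalChain φ) (i : Fin (d + 1)) : c.node i = ι i (nPt K η i) := by
  have h := c.comp_inter i
  rw [hc.comp_eq, hc.comp_eq, hc.closure_inter_closure_succ] at h
  exact (Set.singleton_eq_singleton_iff.mp h).symm

theorem comp_subset_strictTransform (c : ExceptionalChain φ) {i : Fin (d + 1)} {k : Fin (d + 2)}
    (h : i.castSucc < k) : c.comp k ⊆ strictTransform φ (divX K {η i}) := by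
  rw [hc.comp_eq]
  exact closure_minimal (Set.singleton_subset_iff.mpr (hc.chainPoint_mem_divX h)) isClosed_closure

/-- In chart `m` the strict transform of `V(x, u_{η(k)})` is empty for `k > m` and that of `V(y,
u_{η(k)})` for `k < m`. The two conditions at `k = i` force `m = i` and `v = w = 0`; together the
conditions make every `u_{η(k)}` vanish, which leaves the node. -/
theorem inter_strictTransform (c : ExceptionalChain φ) (i : Fin (d + 1)) :
    (⋂ k : Fin (d + 1), ⋂ _ : k ≤ i, strictTransform φ (divX K {η k})) ∩
      (⋂ k : Fin (d + 1), ⋂ _ : i ≤ k, strictTransform φ (divY K {η k})) = {c.node i} := by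
  ext p
  simp only [Set.mem_inter_iff, Set.mem_iInter, Set.mem_singleton_iff]
  rw [hc.node_eq]
  constructor
  · rintro ⟨h1, h2⟩
    obtain ⟨m, q, rfl⟩ := hc.cover p
    simp only [hc.mem_strictTransform_divX] at h1
    simp only [hc.mem_strictTransform_divY] at h2
    have hX := h1 i le_rfl
    have hY := h2 i le_rfl
    have hm : i = m := by
      obtain ⟨hX, -⟩ | ⟨hX, -⟩ := hX
      · obtain ⟨hY, -⟩ | ⟨hY, -⟩ := hY
        exacts [absurd hX hY.asymm, hY]
      · exact hX
    subst hm
    have hv := (hX.resolve_left (fun h ↦ lt_irrefl _ h.1)).2.1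
    have hw := (hY.resolve_left (fun h ↦ lt_irrefl _ h.1)).2.1
    rw [eq_nPt hv hw]
    intro j
    obtain ⟨k, rfl⟩ := η.surjective j
    obtain hk | hk := le_total k i
    · obtain ⟨-, h⟩ | ⟨-, -, h⟩ := h1 k hk <;> exact h
    · obtain ⟨-, h⟩ | ⟨-, -, h⟩ := h2 k hk <;> exact h
  · rintro rfl
    obtain ⟨hv, hw, hu⟩ := mem_nPt (K := K) (η := η) i
    refine ⟨fun k hk ↦ hc.mem_strictTransform_divX.mpr ?_,
      fun k hk ↦ hc.mem_strictTransform_divY.mpr ?_⟩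
    · obtain hk | rfl := hk.lt_or_eq
      exacts [.inl ⟨hk, hu _⟩, .inr ⟨rfl, hv, hu _⟩]
    · obtain hk | rfl := hk.lt_or_eq
      exacts [.inl ⟨hk, hu _⟩, .inr ⟨rfl, hw, hu _⟩]

end IsChain

end ExceptionalChain

/-! ### A criterion for non-regularity -/

section NotRegular

open IsLocalRing

variable {Q : Type*} [CommRing Q] [IsLocalRing Q] [IsNoetherianRing Q]

/-- Nakayama's lemma: the hypothesis says that `I` is contained in `J` plus the maximal ideal times
`I`. -/
theorem le_of_forall_mem_exists {I J : Ideal Q} {t : Q} (ht : t ∈ maximalIdeal Q)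
    (h : ∀ a ∈ I, ∃ b ∈ I, a - t * b ∈ J) : I ≤ J := by
  refine Submodule.le_of_le_smul_of_le_jacobson_bot (I := maximalIdeal Q)
    (IsNoetherian.noetherian I) (maximalIdeal_le_jacobson ⊥) fun a ha ↦ ?_
  obtain ⟨b, hb, hab⟩ := h a ha
  rw [← sub_add_cancel a (t * b)]
  exact Submodule.add_mem_sup hab (Submodule.smul_mem_smul ht hb)

/-- Every prime contains `v` or `w`. A nonmaximal prime `I` containing `v` omits `w`, so an element
`x v + y w` of `I` has `y ∈ I`. A prime `J ≤ I` contains `v` too, and Nakayama gives `I ≤ J`; hence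
`I` is minimal. -/
theorem krullDimLE_one_of_mul_eq_zero {v w : Q} (hm : maximalIdeal Q = Ideal.span {v, w})
    (hvw : v * w = 0) : Ring.KrullDimLE 1 Q := by
  have key : ∀ v w : Q, maximalIdeal Q = Ideal.span {v, w} → v * w = 0 →
      ∀ I : Ideal Q, I.IsPrime → ¬ I.IsMaximal → v ∈ I → I ∈ minimalPrimes Q := by
    intro v w hm hvw I hI hI' hv
    have hw : w ∉ I := fun hw ↦ hI' <| by
      have : maximalIdeal Q ≤ I := by
        rw [hm, Ideal.span_le]
        rintro _ (rfl | rfl) <;> assumption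
      exact eq_of_le_of_ge this (le_maximalIdeal hI.ne_top) ▸ maximalIdeal.isMaximal Q
    refine ⟨⟨hI, bot_le⟩, fun J hJ hJI ↦ ?_⟩
    have := hJ.1
    have hvJ : v ∈ J := (this.mem_or_mem (hvw ▸ J.zero_mem)).resolve_right fun h ↦ hw (hJI h)
    refine le_of_forall_mem_exists (t := w) (hm ▸ Ideal.subset_span (by simp)) fun a ha ↦ ?_
    obtain ⟨x, y, hxy⟩ := Ideal.mem_span_pair.mp (hm ▸ le_maximalIdeal hI.ne_top ha)
    refine ⟨y, ?_, ?_⟩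
    · have : y * w ∈ I := by
        rw [eq_sub_of_add_eq' hxy]
        exact sub_mem ha (I.mul_mem_left _ hv)
      exact (hI.mem_or_mem this).resolve_right hw
    · rw [← hxy, mul_comm w y, add_sub_cancel_right]
      exact J.mul_mem_left _ hvJ
  refine Ring.krullDimLE_one_iff.mpr fun I hI ↦ or_iff_not_imp_right.mpr fun hI' ↦ ?_
  obtain h | h := hI.mem_or_mem (hvw ▸ I.zero_mem : v * w ∈ I)
  · exact key v w hm hvw I hI hI' h
  · exact key w v (by rw [hm, Set.pair_comm]) (by rw [mul_comm, hvw]) I hI hI' h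

/-- A node is not a regular point of a curve. -/
theorem _root_.IsRegularLocalRing.eq_zero_or_eq_zero_of_mul_eq_zero {Q : Type*} [CommRing Q]
    [IsRegularLocalRing Q] {v w : Q} (hm : maximalIdeal Q = Ideal.span {v, w})
    (hvw : v * w = 0) : v = 0 ∨ w = 0 := by
  have h1 := (isRegularLocalRing_iff Q).mp inferInstance
  have h2 : (maximalIdeal Q).FG := IsNoetherian.noetherian _
  -- In dimension zero regularity makes the maximal ideal zero. Otherwise it is generated by a
  -- single `t`; a nonmaximal prime omits `t`, so it equals `t` times itself and is zero, and the
  -- ring is a domain.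
  by_cases h3 : ∀ I : Ideal Q, I.IsPrime → I.IsMaximal
  · have h4 : Ring.KrullDimLE 0 Q := Ring.krullDimLE_zero_iff.mpr h3
    have h5 : (maximalIdeal Q).spanFinrank = 0 := by
      have := Ring.krullDimLE_iff.mp h4
      rw [← h1] at this
      exact_mod_cast Nat.le_zero.mp (by exact_mod_cast this)
    left
    rw [← Submodule.mem_bot Q, ← (Submodule.spanFinrank_eq_zero_iff_eq_bot h2).mp h5, hm]
    exact Ideal.subset_span (by simp)
  · push Not at h3
    obtain ⟨I, hI, hI'⟩ := h3
    have h4 := Ring.krullDimLE_iff.mp (krullDimLE_one_of_mul_eq_zero hm hvw)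
    rw [← h1] at h4
    have h5 : (maximalIdeal Q).spanFinrank ≤ 1 := by exact_mod_cast h4
    obtain ⟨t, ht⟩ : ∃ t, maximalIdeal Q = Ideal.span {t} := by
      obtain h | h := Nat.le_one_iff_eq_zero_or_eq_one.mp h5
      · exact ⟨0, by rw [(Submodule.spanFinrank_eq_zero_iff_eq_bot h2).mp h]; simp⟩
      · exact ((Submodule.spanFinrank_eq_one_iff _).mp h).1.principal
    have htI : t ∉ I := fun h ↦ hI' <| by
      have : maximalIdeal Q ≤ I := by rwa [ht, Ideal.span_singleton_le_iff_mem]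
      exact eq_of_le_of_ge this (le_maximalIdeal hI.ne_top) ▸ maximalIdeal.isMaximal Q
    have h6 : I ≤ ⊥ := by
      refine le_of_forall_mem_exists (t := t) (ht ▸ Ideal.mem_span_singleton_self t) fun a ha ↦ ?_
      obtain ⟨b, rfl⟩ := Ideal.mem_span_singleton.mp (ht ▸ le_maximalIdeal hI.ne_top ha)
      exact ⟨b, (hI.mem_or_mem ha).resolve_left htI, by simp⟩
    exact (hI.mem_or_mem (hvw ▸ I.zero_mem)).imp (fun h ↦ h6 h) fun h ↦ h6 h

/-- The localization at a node of a family of curves is not regular over the base. -/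
theorem not_isRegularAlgebra {R C A B : Type u} [CommRing R] [CommRing C] [CommRing A] [CommRing B]
    [Algebra R A] [Algebra C B] [Algebra A B] (ρ : R →+* C) {p : Ideal R} [p.IsPrime]
    {q : Ideal C} [q.IsPrime] [IsLocalization.AtPrime A p]
    [IsLocalization.AtPrime B q]
    (hAB : ∀ r, algebraMap A B (algebraMap R A r) = algebraMap C B (ρ r))
    {v w : C} (hq : q = Ideal.span {v, w} ⊔ p.map ρ) (hvw : v * w ∈ p.map ρ)
    {V W : Ideal C} [V.IsPrime] [W.IsPrime] (hV : p.map ρ ≤ V) (hW : p.map ρ ≤ W)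
    (hVq : V ≤ q) (hWq : W ≤ q) (hvW : v ∉ W) (hwV : w ∉ V) : ¬ IsRegularAlgebra A B := by
  rintro ⟨-, h⟩
  have : IsLocalRing A := IsLocalization.AtPrime.isLocalRing A p
  have : IsLocalRing B := IsLocalization.AtPrime.isLocalRing B q
  -- The trivial extension of the residue field suffices: its tensor product with `B` is the fibre
  -- ring `B ⧸ I`.
  have h1 := h (ResidueField A)
  have h2 : (maximalIdeal A).map (algebraMap A B) = (p.map ρ).map (algebraMap C B) := by
    rw [← IsLocalization.AtPrime.map_eq_maximalIdeal p A, Ideal.map_map, Ideal.map_map]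
    congr 1
    ext r
    exact hAB r
  set I := (maximalIdeal A).map (algebraMap A B) with hI
  have hmB := IsLocalization.AtPrime.map_eq_maximalIdeal q B
  have h3 : IsRegularRing (B ⧸ I) := IsRegularRing.of_ringEquiv
    ((Algebra.TensorProduct.comm A (ResidueField A) B).toRingEquiv.trans
      (Algebra.TensorProduct.quotIdealMapEquivTensorQuot B (maximalIdeal A)).symm.toRingEquiv)
  have hle : I ≤ maximalIdeal B := by
    rw [h2, ← hmB]
    exact Ideal.map_mono (hq ▸ le_sup_right)
  have : Nontrivial (B ⧸ I) := Ideal.Quotient.nontrivial_iff.mpr fun h ↦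
    (maximalIdeal.isMaximal B).ne_top (top_le_iff.mp (h ▸ hle))
  have hs := Ideal.Quotient.mk_surjective (I := I)
  have : IsLocalRing (B ⧸ I) := .of_surjective' _ hs
  have := IsRegularLocalRing.of_isRegularRing_of_isLocalRing (B ⧸ I)
  set v' := Ideal.Quotient.mk I (algebraMap C B v)
  set w' := Ideal.Quotient.mk I (algebraMap C B w)
  have h4 : maximalIdeal (B ⧸ I) = Ideal.span {v', w'} := by
    have : (maximalIdeal B).map (Ideal.Quotient.mk I) = maximalIdeal (B ⧸ I) := by
      have h5 := Ideal.map_eq_top_or_isMaximal_of_surjective (Ideal.Quotient.mk I) hs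
        (maximalIdeal.isMaximal B)
      refine eq_maximalIdeal (h5.resolve_left fun h6 ↦ ?_)
      have h7 := congrArg (Ideal.comap (Ideal.Quotient.mk I)) h6
      rw [Ideal.comap_map_of_surjective _ hs, Ideal.comap_top, ← RingHom.ker_eq_comap_bot,
        Ideal.mk_ker, sup_eq_left.mpr hle] at h7
      exact (maximalIdeal.isMaximal B).ne_top h7
    rw [← this, ← hmB]
    conv_lhs => rw [hq]
    rw [Ideal.map_sup, Ideal.map_sup, ← h2, Ideal.map_quotient_self, sup_bot_eq, Ideal.map_span,
      Ideal.map_span, Set.image_pair, Set.image_pair]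
  -- An element that dies in the fibre ring is multiplied into the extension of `p` by some `s ∉ q`,
  -- so every prime between that extension and `q` contains it. `W` and `V` thus show that `v` and
  -- `w` survive.
  have h5 : ∀ a : C, ∀ J : Ideal C, J.IsPrime → p.map ρ ≤ J → J ≤ q → a ∉ J →
      Ideal.Quotient.mk I (algebraMap C B a) ≠ 0 := by
    intro a J hJ hpJ hJq ha h6
    rw [Ideal.Quotient.eq_zero_iff_mem, h2,
      IsLocalization.algebraMap_mem_map_algebraMap_iff q.primeCompl] at h6
    obtain ⟨s, hs, h7⟩ := h6
    exact (hJ.mem_or_mem (hpJ h7)).elim (fun h ↦ hs (hJq h)) ha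
  obtain h6 | h6 := IsRegularLocalRing.eq_zero_or_eq_zero_of_mul_eq_zero h4 (by
    rw [← map_mul, ← map_mul, Ideal.Quotient.eq_zero_iff_mem, h2]
    exact Ideal.mem_map_of_mem _ hvw)
  · exact h5 v W inferInstance hW hWq hvW h6
  · exact h5 w V inferInstance hV hVq hwV h6

open StructureSheaf in
/-- A point of a chart which is a node of a family of curves is in the singular locus. -/
theorem mem_singularLocus_of_isOpenImmersion {R C : CommRingCat.{u}} {X : Scheme.{u}}
    (f : X ⟶ Spec R) (ι : Spec C ⟶ X) [IsOpenImmersion ι] (ρ : R ⟶ C) (hf : ι ≫ f = Spec.map ρ)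
    (q : Spec C) {v w : C} (hq : PrimeSpectrum.asIdeal q =
      Ideal.span {v, w} ⊔ ((PrimeSpectrum.asIdeal q).comap ρ.hom).map ρ.hom)
    (hvw : v * w ∈ ((PrimeSpectrum.asIdeal q).comap ρ.hom).map ρ.hom)
    {V W : Ideal C} [V.IsPrime] [W.IsPrime]
    (hV : ((PrimeSpectrum.asIdeal q).comap ρ.hom).map ρ.hom ≤ V)
    (hW : ((PrimeSpectrum.asIdeal q).comap ρ.hom).map ρ.hom ≤ W)
    (hVq : V ≤ PrimeSpectrum.asIdeal q) (hWq : W ≤ PrimeSpectrum.asIdeal q)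
    (hvW : v ∉ W) (hwV : w ∉ V) : ι q ∈ singularLocus f := by
  have hp : PrimeSpectrum.asIdeal (f (ι q)) = (PrimeSpectrum.asIdeal q).comap ρ.hom := by
    have : f (ι q) = Spec.map ρ q := by rw [← hf]; rfl
    rw [this]
    rfl
  have := PrimeSpectrum.isPrime q
  have := PrimeSpectrum.isPrime (f (ι q))
  -- Localization of `C` at `q`, carried to the stalk of `X` through the open immersion.
  let κ : C ⟶ X.presheaf.stalk (ι q) := (Scheme.ΓSpecIso C).inv ≫
    (Spec C).presheaf.germ ⊤ q (TopologicalSpace.Opens.mem_top _) ≫ inv (ι.stalkMap q)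
  let κ₀ : R ⟶ (Spec R).presheaf.stalk (f (ι q)) := (Scheme.ΓSpecIso R).inv ≫
    (Spec R).presheaf.germ ⊤ (f (ι q)) (TopologicalSpace.Opens.mem_top _)
  let _ := κ.hom.toAlgebra
  let _ := κ₀.hom.toAlgebra
  let _ := (f.stalkMap (ι q)).hom.toAlgebra
  have h1 : IsLocalization.AtPrime ((Spec R).presheaf.stalk (f (ι q)))
      (PrimeSpectrum.asIdeal (f (ι q))) := IsLocalization.to_stalk R (f (ι q))
  have h2 : IsLocalization.AtPrime (X.presheaf.stalk (ι q)) (PrimeSpectrum.asIdeal q) := by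
    let _ := ((Scheme.ΓSpecIso C).inv ≫ (Spec C).presheaf.germ ⊤ q (TopologicalSpace.Opens.mem_top _)).hom.toAlgebra
    have h3 : IsLocalization.AtPrime ((Spec C).presheaf.stalk q) (PrimeSpectrum.asIdeal q) :=
      IsLocalization.to_stalk C q
    let e : (Spec C).presheaf.stalk q ≃ₐ[C] X.presheaf.stalk (ι q) :=
      { (asIso (ι.stalkMap q)).symm.commRingCatIsoToRingEquiv with
        commutes' := fun _ ↦ rfl }
    exact IsLocalization.isLocalization_of_algEquiv _ e
  have hcomp : κ₀ ≫ f.stalkMap (ι q) = ρ ≫ κ := by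
    have h3 : (Spec R).presheaf.germ ⊤ (f (ι q)) (TopologicalSpace.Opens.mem_top _) ≫
        f.stalkMap (ι q) = f.appTop ≫ X.presheaf.germ ⊤ (ι q) (TopologicalSpace.Opens.mem_top _) :=
      f.germ_stalkMap ⊤ (ι q) _
    have h4 : X.presheaf.germ ⊤ (ι q) (TopologicalSpace.Opens.mem_top _) ≫ ι.stalkMap q =
        ι.appTop ≫ (Spec C).presheaf.germ ⊤ q (TopologicalSpace.Opens.mem_top _) :=
      ι.germ_stalkMap ⊤ q _
    have h5 : f.appTop ≫ ι.appTop = (Spec.map ρ).appTop := by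
      rw [← hf, Scheme.Hom.comp_appTop]
    simp only [κ₀, κ, Category.assoc]
    rw [← Category.assoc ρ, Scheme.ΓSpecIso_inv_naturality, ← h5, ← cancel_mono (ι.stalkMap q)]
    simp only [Category.assoc, IsIso.inv_hom_id, Category.comp_id]
    rw [← h4, reassoc_of% h3]
  exact not_isRegularAlgebra ρ.hom (fun r ↦ RingHom.congr_fun
    (congrArg CommRingCat.Hom.hom hcomp) r) (hp ▸ hq) (hp ▸ hvw) (hp ▸ hV) (hp ▸ hW) hVq hWq
    hvW hwV

end NotRegular

/-! ### Components of the singular locus through the nodes -/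

section SingularComponent

variable {d : ℕ} {K : Type u} [Field K]

/-- Setting `x = y = 0` is a retraction of the inclusion of the power series in the `u_j`, and it
carries the larger ideal into `varIdeal K Z`. -/
theorem rename_inl_mem_varIdeal {Z : Finset (Fin (d + 1))} {f : RingS d K}
    (h : MvPowerSeries.rename Sum.inl f ∈
      varIdeal K (insert (Sum.inr 1) (insert (Sum.inr 0) (inlF Z)))) : f ∈ varIdeal K Z := by
  have h1 : varIdeal K (insert (Sum.inr 1) (insert (Sum.inr 0) (inlF Z))) ≤
      (varIdeal K Z).comap
        (MvPowerSeries.killCompl (R := K)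
          (Function.Embedding.inl : Fin (d + 1) ↪ Fin (d + 1) ⊕ Fin 2)) := by
    rw [varIdeal, Ideal.span_le]
    rintro _ ⟨j | t, hj, rfl⟩
    · refine Ideal.mem_comap.mpr ?_
      have := MvPowerSeries.killCompl_X (R := K)
        (e := (Function.Embedding.inl : Fin (d + 1) ↪ Fin (d + 1) ⊕ Fin 2)) j
      rw [Function.Embedding.inl_apply] at this
      rw [this, X_mem_varIdeal]
      simpa using hj
    · refine Ideal.mem_comap.mpr ?_
      rw [MvPowerSeries.killCompl_X_eq_zero (by simp)]
      exact zero_mem _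
  have h2 := h1 h
  rw [Ideal.mem_comap] at h2
  exact MvPowerSeries.killCompl_rename_app (R := K)
    (e := (Function.Embedding.inl : Fin (d + 1) ↪ Fin (d + 1) ⊕ Fin 2)) f ▸ h2

namespace Ch

variable {β : Block d}

variable (K β) in
/-- The structure map of a chart over `S`. -/
def baseMap : RingS d K →+* Ch K β :=
  (structureMap K β).comp ((Ideal.Quotient.mk _).comp
    (MvPowerSeries.rename (Sum.inl : Fin (d + 1) → Fin (d + 1) ⊕ Fin 2) :
      RingS d K →ₐ[K] RingP d K).toRingHom)

theorem toTS_comp_projTS :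
    toTS K β ≫ projTS d K = Spec.map (CommRingCat.ofHom (baseMap K β)) := by
  rw [toTS, projTS, ← Spec.map_comp]
  rfl

theorem baseMap_apply (f : RingS d K) :
    baseMap K β f = of K β (MvPowerSeries.rename Sum.inl f) := structureMap_mk _

theorem baseMap_X (j : Fin (d + 1)) : baseMap K β (MvPowerSeries.X j) = u K β j := by
  rw [baseMap_apply, MvPowerSeries.rename_X]

theorem map_varIdeal_le_iff {Z : Finset (Fin (d + 1))} {J : Ideal (Ch K β)} :
    (varIdeal K Z).map (baseMap K β) ≤ J ↔ ∀ j ∈ Z, u K β j ∈ J := by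
  rw [varIdeal, Ideal.map_span, Ideal.span_le, Set.image_image, Set.image_subset_iff]
  refine forall₂_congr fun j _ ↦ ?_
  rw [Set.mem_preimage, baseMap_X]
  rfl

/-- The point with `v = w = u_Z = 0`, where `Z` meets the block, together with the generic points
of the two branches through it. -/
theorem exists_nodal_point {Z : Finset (Fin (d + 1))} {j : Fin (d + 1)} (hj : j ∈ β.P)
    (hjZ : j ∈ Z) : ∃ q V W : Spec (.of (Ch K β)),
      (∀ J, PrimeSpectrum.asIdeal q ≤ J ↔ v K β ∈ J ∧ w K β ∈ J ∧ ∀ j ∈ Z, u K β j ∈ J) ∧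
      (PrimeSpectrum.asIdeal q).comap (baseMap K β) = varIdeal K Z ∧
      (∀ J, PrimeSpectrum.asIdeal V ≤ J ↔ v K β ∈ J ∧ ∀ j ∈ Z, u K β j ∈ J) ∧
      (∀ J, PrimeSpectrum.asIdeal W ≤ J ↔ w K β ∈ J ∧ ∀ j ∈ Z, u K β j ∈ J) ∧
      w K β ∉ PrimeSpectrum.asIdeal V ∧ v K β ∉ PrimeSpectrum.asIdeal W := by
  have hP : ∃ l ∈ inlF β.P, l ∈ inlF Z := ⟨Sum.inl j, by simpa using hj, by simpa using hjZ⟩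
  obtain ⟨h1, h2⟩ := MonChart.vwIdeal_isPrime (K := K) (i := (Sum.inr 0 : Fin (d + 1) ⊕ Fin 2))
    (k := Sum.inr 1) (B := inlF β.B) (D := inlF β.D) hP
  obtain ⟨h3, h4⟩ : (MonChart.vIdeal K (Sum.inr 0) (Sum.inr 1) (inlF β.B) (inlF β.D) (inlF β.P)
      (inlF Z)).IsPrime ∧ w K β ∉ MonChart.vIdeal K (Sum.inr 0) (Sum.inr 1) (inlF β.B)
        (inlF β.D) (inlF β.P) (inlF Z) := by
    by_cases hD : Disjoint (inlF β.D) (inlF Z)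
    · obtain ⟨h1, -, h2⟩ := MonChart.vIdeal_isPrime (K := K) β.separated hP hD (by simp)
      exact ⟨h1, h2⟩
    · exact MonChart.vIdeal_isPrime' (K := K) β.separated hP (Finset.not_disjoint_iff.mp hD)
  obtain ⟨h5, h6⟩ : (MonChart.wIdeal K (Sum.inr 0) (Sum.inr 1) (inlF β.B) (inlF β.D) (inlF β.P)
      (inlF Z)).IsPrime ∧ v K β ∉ MonChart.wIdeal K (Sum.inr 0) (Sum.inr 1) (inlF β.B)
        (inlF β.D) (inlF β.P) (inlF Z) := by
    by_cases hB : Disjoint (inlF β.B) (inlF Z)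
    · obtain ⟨h1, -, h2⟩ := MonChart.wIdeal_isPrime (K := K) β.separated hP hB (by simp)
      exact ⟨h1, h2⟩
    · exact MonChart.wIdeal_isPrime' (K := K) β.separated hP (Finset.not_disjoint_iff.mp hB)
  refine ⟨⟨_, h1⟩, ⟨_, h3⟩, ⟨_, h5⟩, fun J ↦ vwIdeal_le_iff, le_antisymm (fun f hf ↦ ?_) ?_,
    fun J ↦ vIdeal_le_iff, fun J ↦ wIdeal_le_iff, h4, h6⟩
  · rw [Ideal.mem_comap, baseMap_apply] at hf
    exact rename_inl_mem_varIdeal (h2 _ hf)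
  · rw [← Ideal.map_le_iff_le_comap, map_varIdeal_le_iff]
    exact (vwIdeal_le_iff.mp le_rfl).2.2

end Ch

variable {η : Equiv.Perm (Fin (d + 1))} {X : Scheme.{u}} {φ : X ⟶ TS d K}
  {ι : ∀ i, Spec (.of (Ch K (Block.chain η i))) ⟶ X}

/-- In every chart, the points with `v = w = u_Z = 0` are singular. -/
theorem IsChain.exists_mem_singularLocus (hc : IsChain η φ ι) {i : Fin (d + 1)}
    {Z : Finset (Fin (d + 1))} (hZ : η i ∈ Z) : ∃ q : Spec (.of (Ch K (Block.chain η i))),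
      ι i q ∈ singularLocus (φ ≫ projTS d K) ∧
      PrimeSpectrum.asIdeal ((φ ≫ projTS d K) (ι i q)) = varIdeal K Z ∧
      ∀ J, PrimeSpectrum.asIdeal q ≤ J ↔
        Ch.v K _ ∈ J ∧ Ch.w K _ ∈ J ∧ ∀ j ∈ Z, Ch.u K _ j ∈ J := by
  have hP : η i ∈ (Block.chain η i).P := by simp [Block.chain_P]
  obtain ⟨q, V, W, h1, h2, h3, h4, h5, h6⟩ := Ch.exists_nodal_point (K := K) hP hZ
  have := hc.isOpenImmersion i
  have hcomp : ι i ≫ φ ≫ projTS d K =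
      Spec.map (CommRingCat.ofHom (Ch.baseMap K (Block.chain η i))) := by
    rw [← Category.assoc, hc.comp, Ch.toTS_comp_projTS]
  have hq := (h1 _).mp le_rfl
  have hV := (h3 _).mp le_rfl
  have hW := (h4 _).mp le_rfl
  have hVp := PrimeSpectrum.isPrime V
  have hWp := PrimeSpectrum.isPrime W
  refine ⟨q, ?_, ?_, h1⟩
  · refine mem_singularLocus_of_isOpenImmersion (φ ≫ projTS d K) (ι i)
      (CommRingCat.ofHom (Ch.baseMap K (Block.chain η i))) hcomp q
      (v := Ch.v K (Block.chain η i)) (w := Ch.w K (Block.chain η i))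
      (V := PrimeSpectrum.asIdeal V) (W := PrimeSpectrum.asIdeal W) ?_ ?_ ?_ ?_
      ((h3 _).mpr ⟨hq.1, hq.2.2⟩) ((h4 _).mpr hq.2) h6 h5
    · rw [CommRingCat.hom_ofHom, h2]
      refine le_antisymm ((h1 _).mpr ⟨?_, ?_, ?_⟩) (sup_le ?_ ?_)
      · exact Ideal.mem_sup_left (Ideal.subset_span (by simp))
      · exact Ideal.mem_sup_left (Ideal.subset_span (by simp))
      · exact Ch.map_varIdeal_le_iff.mp le_sup_right
      · rw [Ideal.span_le]
        rintro _ (rfl | rfl)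
        exacts [hq.1, hq.2.1]
      · exact Ch.map_varIdeal_le_iff.mpr hq.2.2
    · rw [CommRingCat.hom_ofHom, h2, Ch.v_mul_w_chain]
      exact Ch.map_varIdeal_le_iff.mp le_rfl _ hZ
    · rw [CommRingCat.hom_ofHom, h2]
      exact Ch.map_varIdeal_le_iff.mpr hV.2
    · rw [CommRingCat.hom_ofHom, h2]
      exact Ch.map_varIdeal_le_iff.mpr hW.2
  · have h7 : (φ ≫ projTS d K) (ι i q) =
        Spec.map (CommRingCat.ofHom (Ch.baseMap K (Block.chain η i))) q := by
      rw [← hcomp]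
      rfl
    rw [h7]
    exact h2

theorem isGenericPointOfDivisor_of_asIdeal_eq {j : Fin (d + 1)} {s : S d K}
    (h : PrimeSpectrum.asIdeal s = varIdeal K {j}) : IsGenericPointOfDivisor K j s := by
  refine (PrimeSpectrum.closure_singleton s).trans ?_
  rw [h, varIdeal, PrimeSpectrum.zeroLocus_span]
  simp

/-- The node of the `i`-th chart lies on the component of the singular locus over the divisor
of the `i`-th variable. -/
theorem IsChain.node_mem_singularComponent (hc : IsChain η φ ι) (i : Fin (d + 1)) :
    ι i (nPt K η i) ∈ singularComponent φ (η i) := by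
  -- `Z = {η i}` gives the generic point of `v = w = u_{η(i)} = 0`, which lies over the generic
  -- point of `V(u_{η(i)})`; `Z = univ` gives the node. Both are singular.
  obtain ⟨z, h1, h2, h3⟩ := hc.exists_mem_singularLocus (Finset.mem_singleton_self (η i))
  obtain ⟨n, h4, -, h6⟩ := hc.exists_mem_singularLocus (Finset.mem_univ (η i))
  have h7 := (h6 _).mp le_rfl
  obtain rfl : n = nPt K η i := eq_nPt h7.1 h7.2.1 fun j ↦ h7.2.2 j (Finset.mem_univ j)
  have hz : z ⤳ nPt K η i :=
    specializes_iff_asIdeal_le.mpr ((h3 _).mpr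
      ⟨h7.1, h7.2.1, fun j _ ↦ h7.2.2 j (Finset.mem_univ j)⟩)
  have hz' : ι i z ⤳ ι i (nPt K η i) := hz.map (ι i).continuous
  refine ⟨ι i z, h1, isGenericPointOfDivisor_of_asIdeal_eq h2, ?_⟩
  -- A point together with one of its specializations is connected, since it lies between the point
  -- and its closure.
  have h8 : IsPreconnected {ι i z, ι i (nPt K η i)} :=
    isPreconnected_singleton.subset_closure (by simp) (Set.insert_subset_iff.mpr
      ⟨subset_closure rfl, by simpa using specializes_iff_mem_closure.mp hz'⟩)
  exact h8.subset_connectedComponentIn (by simp) (by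
    rintro _ (rfl | rfl) <;> assumption) (by simp)

end SingularComponent

end NodalBlowup

end

theorem mainTheorem6 (K : Type u) [Field K] [IsAlgClosed K] (d : ℕ)
    (𝒜 : List (Finset (Fin (d + 1))))
    (hproper : ∀ A ∈ 𝒜, A.Nonempty ∧ A ≠ Finset.univ)
    (hsmooth : NodalBlowup.IsSmoothCollection 𝒜)
    (η : Equiv.Perm (Fin (d + 1)))
    (hη : ∀ i j : Fin (d + 1), i < j → NodalBlowup.CollectionLT 𝒜 (η i) (η j))
    (X : Scheme.{u}) (φ : X ⟶ NodalBlowup.TS d K)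
    (hφ : NodalBlowup.IsIteratedBlowup 𝒜 φ) :
    Nonempty (NodalBlowup.ExceptionalChain φ) ∧
    ∀ c : NodalBlowup.ExceptionalChain φ, ∀ i : Fin (d + 1),
      c.node i ∈ NodalBlowup.singularComponent φ (η i) ∧
      (∀ k : Fin (d + 2), i.castSucc < k →
        c.comp k ⊆ NodalBlowup.strictTransform φ (NodalBlowup.divX K {η i})) ∧
      (⋂ k : Fin (d + 1), ⋂ _ : k ≤ i,
          NodalBlowup.strictTransform φ (NodalBlowup.divX K {η k})) ∩
        (⋂ k : Fin (d + 1), ⋂ _ : i ≤ k,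
          NodalBlowup.strictTransform φ (NodalBlowup.divY K {η k})) = {c.node i} := by
  obtain ⟨ι, hc⟩ := hφ.hasCharts.exists_isChain hη
  refine ⟨hc.nonempty_exceptionalChain, fun c i ↦ ⟨?_, fun k hk ↦
    hc.comp_subset_strictTransform c hk, hc.inter_strictTransform c i⟩⟩
  rw [hc.node_eq]
  exact hc.node_mem_singularComponent i
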